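/- Let $M$ be a closed (compact, without boundary) smooth manifold of dimension $n$ with a smooth Riemannian metric $g$, let $f:M\to\mathbb R$ be a smooth function (for instance a Morse function), and let $t\ge 0$. On the space $\Omega^q(M)$ of smooth real $q$-forms put the $L^2$ inner product $(\alpha,\beta)=\int_M g(\alpha,\beta)\,dv_g$, where $dv_g$ is the Riemannian density and $g(\cdot,\cdot)$ is the metric induced by $g$ on $\Lambda^qT^*M$ (for which $dx_{i_1}\wedge\cdots\wedge dx_{i_q}$, $i_1<\cdots<i_q$, are orthonormal wherever $g_{ij}=\delta_{ij}$). Let $d_t=d_t^{(q)}=e^{-tf}\,d\,e^{tf}:\Omega^q(M)\to\Omega^{q+1}(M)$. Then $d_t$ has a formal adjoint $d_t^*:\Omega^{q+1}(M)\to\Omega^q(M)$, i.e. $(d_tu,v)=(u,d_t^*v)$ for all $u\in\Omega^q(M)$, $v\in\Omega^{q+1}(M)$. Let $\triangle_t^{(q)}=d_td_t^*+d_t^*d_t$ on $\Omega^q(M)$ be the Witten Laplacian (with $\triangle_t^{(0)}=d_t^*d_t$), let $E^q_{\mu,t}=\{u\in\Omega^q(M):\triangle^{(q)}_tu=\mu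 u\}$, and for $\lambda>0$ let $$E^q_{(0,\lambda],t}=\bigoplus_{\mu}E^q_{\mu,t},$$ where $\mu$ runs over the eigenvalues of $\triangle_t^{(q)}$ in $(0,\lambda]$. Then for every $\lambda>0$: 1. $d_t$ maps $E^q_{(0,\lambda],t}$ into $E^{q+1}_{(0,\lambda],t}$ for every $q$, and the sequence $$0\to E^0_{(0,\lambda],t}\xrightarrow{d_t^{(0)}}E^1_{(0,\lambda],t}\xrightarrow{d_t^{(1)}}\cdots\xrightarrow{d_t^{(n-1)}}E^n_{(0,\lambda],t}\xrightarrow{d_t^{(n)}}0$$ is exact; that is, $d_t^{(0)}$ is injective on $E^0_{(0,\lambda],t}$, at $E^q_{(0,\lambda],t}$ with $1\le q\le n$ the kernel of $d_t^{(q)}$ is the image of $d_t^{(q-1)}$, and $E^{n+1}_{(0,\lambda],t}=0$. 2. The spaces $E^q_{(0,\lambda],t}$, $0\le q\le n$, are finite-dimensional, $$\sum_{j=0}^q(-1)^{q-j}\dim E^j_{(0,\lambda],t}\ \ge\ 0\quad(0\le q\le n),\qquad \sum_{j=0}^n(-1)^{n-j}\dim E^j_{(0,\lambda],t}=0 .$$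 -/

import Mathlib

open scoped Manifold ContDiff Topology
open MeasureTheory

namespace Witten

/-- The model space `ℝⁿ`. -/
abbrev Model (n : ℕ) : Type := EuclideanSpace ℝ (Fin n)

section Forms

variable {n : ℕ} {M : Type*} [TopologicalSpace M] [ChartedSpace (Model n) M]

/-- The derivative at `z` of the inverse of the chart `φ` at `x₀`, as a map
`ℝⁿ → T_y M`, `y = φ⁻¹ z`; it sends `eᵢ` to the coordinate vector `∂/∂xᵢ` at `y`. -/
noncomputable def chartInvDeriv (x₀ : M) (z : Model n) :
    Model n →L[ℝ] TangentSpace (𝓡 n) ((extChartAt (𝓡 n) x₀).symm z) :=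
  mfderiv 𝓘(ℝ, Model n) (𝓡 n) (extChartAt (𝓡 n) x₀).symm z

/-- The expression of a (not necessarily smooth) `q`-form `α` in the chart `φ` at `x₀`: the
pullback `(φ⁻¹)^* α`, a `q`-form on the open set `φ.target` of `ℝⁿ`. -/
noncomputable def inChart {q : ℕ} (α : ∀ x : M, TangentSpace (𝓡 n) x [⋀^Fin q]→L[ℝ] ℝ)
    (x₀ : M) (z : Model n) : Model n [⋀^Fin q]→L[ℝ] ℝ :=
  (α ((extChartAt (𝓡 n) x₀).symm z)).compContinuousLinearMap (chartInvDeriv x₀ z)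

variable (n M) in
/-- The space of sections of `Λ^q T^*M` whose expressions in the charts of `M` are smooth. -/
noncomputable def smoothForms (q : ℕ) :
    Submodule ℝ (∀ x : M, TangentSpace (𝓡 n) x [⋀^Fin q]→L[ℝ] ℝ) where
  carrier := {α | ∀ x₀ : M, ContDiffOn ℝ ∞ (inChart α x₀) (extChartAt (𝓡 n) x₀).target}
  zero_mem' := fun _ => contDiffOn_const (c := 0)
  add_mem' := fun ha hb x₀ => (ha x₀).add (hb x₀)
  smul_mem' := fun c _ ha x₀ => (ha x₀).const_smul c

variable (n M) in
/-- `Ω^q(M)`: the real vector space of smooth `q`-forms on `M`. -/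
def Form (q : ℕ) : Type _ := smoothForms n M q

noncomputable instance (q : ℕ) : AddCommGroup (Form n M q) :=
  inferInstanceAs (AddCommGroup (smoothForms n M q))

noncomputable instance (q : ℕ) : Module ℝ (Form n M q) :=
  inferInstanceAs (Module ℝ (smoothForms n M q))

/-- Multiplication of forms by a smooth function. -/
noncomputable def Form.mul (h : C^∞⟮𝓡 n, M; ℝ⟯) [IsManifold (𝓡 n) ∞ M] (q : ℕ) :
    Form n M q →ₗ[ℝ] Form n M q where
  toFun α := ⟨fun x => h x • α.1 x,
    fun x₀ => ContDiffOn.smul (contMDiffOn_iff_contDiffOn.1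
      (h.contMDiff.comp_contMDiffOn (contMDiffOn_extChartAt_symm x₀))) (α.2 x₀)⟩
  map_add' a b := Subtype.ext (funext fun x => smul_add (h x) (a.1 x) (b.1 x))
  map_smul' c a := Subtype.ext (funext fun x => smul_comm (h x) c (a.1 x))

/-- The exterior derivative of a form at `x`, computed in the chart `φ` at `x`:
`(dα)_x = φ^* (d ((φ⁻¹)^* α))` at `x`. -/
noncomputable def extDerivAt {q : ℕ} (α : ∀ x : M, TangentSpace (𝓡 n) x [⋀^Fin q]→L[ℝ] ℝ)
    (x : M) : TangentSpace (𝓡 n) x [⋀^Fin (q + 1)]→L[ℝ] ℝ :=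
  (extDeriv (inChart α x) (extChartAt (𝓡 n) x x)).compContinuousLinearMap
    (mfderiv (𝓡 n) 𝓘(ℝ, Model n) (extChartAt (𝓡 n) x) x)

/-- The function `e^{sf}`. -/
noncomputable def expMul (f : C^∞⟮𝓡 n, M; ℝ⟯) (s : ℝ) : C^∞⟮𝓡 n, M; ℝ⟯ :=
  ⟨fun x => Real.exp (s * f x),
    (Real.contDiff_exp.comp (contDiff_const.mul contDiff_id)).comp_contMDiff f.contMDiff⟩

variable [IsManifold (𝓡 n) ∞ M]

theorem inv_mdiff {x₀ : M} {z : Model n} (hz : z ∈ (extChartAt (𝓡 n) x₀).target) :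
    MDifferentiableAt 𝓘(ℝ, Model n) (𝓡 n) (extChartAt (𝓡 n) x₀).symm z :=
  ((contMDiffOn_extChartAt_symm (n := ∞) x₀).contMDiffAt
    ((isOpen_extChartAt_target x₀).mem_nhds hz)).mdifferentiableAt (by simp)

theorem chart_mdiff {x₀ x : M} (hx : x ∈ (extChartAt (𝓡 n) x₀).source) :
    MDifferentiableAt (𝓡 n) 𝓘(ℝ, Model n) (extChartAt (𝓡 n) x₀) x :=
  (contMDiffAt_extChartAt' (n := ∞) (by simpa using hx)).mdifferentiableAt (by simp)

/-- In overlapping charts the expressions of a form are related by pullback along the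
transition map. -/
theorem inChart_eq {q : ℕ} (α : ∀ x : M, TangentSpace (𝓡 n) x [⋀^Fin q]→L[ℝ] ℝ) {x₀ y : M}
    {z : Model n} (hz : z ∈ (extChartAt (𝓡 n) x₀).target)
    (hy : (extChartAt (𝓡 n) x₀).symm z ∈ (extChartAt (𝓡 n) y).source) :
    inChart α x₀ z = (inChart α y (extChartAt (𝓡 n) y ((extChartAt (𝓡 n) x₀).symm z))
      ).compContinuousLinearMap
        (fderiv ℝ (extChartAt (𝓡 n) y ∘ (extChartAt (𝓡 n) x₀).symm) z) := by
  have key : (mfderiv 𝓘(ℝ, Model n) (𝓡 n) (extChartAt (𝓡 n) x₀).symm z :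
      Model n →L[ℝ] Model n) =
      (mfderiv 𝓘(ℝ, Model n) (𝓡 n) (extChartAt (𝓡 n) y).symm
        (extChartAt (𝓡 n) y ((extChartAt (𝓡 n) x₀).symm z)) : Model n →L[ℝ] Model n).comp
        (fderiv ℝ (extChartAt (𝓡 n) y ∘ (extChartAt (𝓡 n) x₀).symm) z) := by
    have hd : MDifferentiableAt 𝓘(ℝ, Model n) 𝓘(ℝ, Model n)
        (extChartAt (𝓡 n) y ∘ (extChartAt (𝓡 n) x₀).symm) z :=
      (chart_mdiff hy).comp z (inv_mdiff hz)
    have h1 := mfderiv_comp z (f := extChartAt (𝓡 n) y ∘ (extChartAt (𝓡 n) x₀).symm)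
      (g := (extChartAt (𝓡 n) y).symm) (inv_mdiff ((extChartAt (𝓡 n) y).map_source hy)) hd
    rw [mfderiv_eq_fderiv] at h1
    refine Eq.trans ?_ h1
    refine Filter.EventuallyEq.mfderiv_eq ?_
    have : ∀ᶠ w in 𝓝 z, (extChartAt (𝓡 n) x₀).symm w ∈ (extChartAt (𝓡 n) y).source :=
      (inv_mdiff hz).continuousAt ((isOpen_extChartAt_source y).mem_nhds hy)
    filter_upwards [this] with w hw
    exact ((extChartAt (𝓡 n) y).left_inv hw).symm
  have h2 : ∀ p : M, p = (extChartAt (𝓡 n) x₀).symm z →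
      ∀ A B : Model n →L[ℝ] Model n, A = B →
      (α ((extChartAt (𝓡 n) x₀).symm z) : Model n [⋀^Fin q]→L[ℝ] ℝ).compContinuousLinearMap A =
      (α p : Model n [⋀^Fin q]→L[ℝ] ℝ).compContinuousLinearMap B := by
    rintro p rfl A B rfl; rfl
  exact h2 _ ((extChartAt (𝓡 n) y).left_inv hy) _ _ key

/-- In every chart the exterior derivative on `M` is the exterior derivative on `ℝⁿ`. -/
theorem inChart_extDerivAt {q : ℕ} (α : Form n M q) {x₀ : M} {z : Model n}
    (hz : z ∈ (extChartAt (𝓡 n) x₀).target) :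
    inChart (extDerivAt α.1) x₀ z =
      extDeriv (inChart α.1 x₀) z := by
  set y := (extChartAt (𝓡 n) x₀).symm z with hy
  have hys : (extChartAt (𝓡 n) x₀).symm z ∈ (extChartAt (𝓡 n) y).source :=
    mem_extChartAt_source y
  have hcd : ContDiffAt ℝ ∞ (extChartAt (𝓡 n) y ∘ (extChartAt (𝓡 n) x₀).symm) z :=
    contMDiffAt_iff_contDiffAt.1 <| (contMDiffAt_extChartAt' (by simpa using hys)).comp z
      ((contMDiffOn_extChartAt_symm (n := ∞) x₀).contMDiffAt
        ((isOpen_extChartAt_target x₀).mem_nhds hz))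
  have hev : inChart α.1 x₀ =ᶠ[𝓝 z]
      fun w => (inChart α.1 y ((extChartAt (𝓡 n) y ∘ (extChartAt (𝓡 n) x₀).symm) w)
        ).compContinuousLinearMap
          (fderiv ℝ (extChartAt (𝓡 n) y ∘ (extChartAt (𝓡 n) x₀).symm) w) := by
    have : ∀ᶠ w in 𝓝 z, (extChartAt (𝓡 n) x₀).symm w ∈ (extChartAt (𝓡 n) y).source :=
      (inv_mdiff hz).continuousAt ((isOpen_extChartAt_source y).mem_nhds hys)
    filter_upwards [this, (isOpen_extChartAt_target x₀).mem_nhds hz] with w hw hw'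
    exact inChart_eq _ hw' hw
  rw [hev.extDeriv_eq, extDeriv_pullback (r := ∞) ?_ hcd (by simpa using (WithTop.coe_le_coe.2 le_top : ((2 : ℕ∞) : WithTop ℕ∞) ≤ ∞))]
  · have h3 := mfderiv_comp z (chart_mdiff hys) (inv_mdiff hz)
    rw [mfderiv_eq_fderiv] at h3
    rw [h3]
    rfl
  · exact ((α.2 y).contDiffAt ((isOpen_extChartAt_target y).mem_nhds
      ((extChartAt (𝓡 n) y).map_source hys))).differentiableAt (by simp)

variable (n M) in
/-- The exterior derivative `d : Ω^q(M) → Ω^{q+1}(M)`. -/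
noncomputable def extD (q : ℕ) : Form n M q →ₗ[ℝ] Form n M (q + 1) where
  toFun α := ⟨extDerivAt α.1, fun x₀ => by
    refine ContDiffOn.congr ?_ (fun z hz => inChart_extDerivAt α hz)
    exact (ContinuousAlternatingMap.alternatizeUncurryFinCLM ℝ (Model n) ℝ).contDiff.comp_contDiffOn
      ((α.2 x₀).fderiv_of_isOpen (isOpen_extChartAt_target x₀) (m := ∞) le_rfl)⟩
  map_add' a b := by
    refine Subtype.ext (funext fun x => ?_)
    have hd : ∀ c : Form n M q, DifferentiableAt ℝ (inChart c.1 x) (extChartAt (𝓡 n) x x) :=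
      fun c => ((c.2 x).contDiffAt (extChartAt_target_mem_nhds x)).differentiableAt (by simp)
    have h := extDeriv_add (hd a) (hd b)
    exact congrArg (fun η : Model n [⋀^Fin (q + 1)]→L[ℝ] ℝ => η.compContinuousLinearMap
      (mfderiv (𝓡 n) 𝓘(ℝ, Model n) (extChartAt (𝓡 n) x) x)) h
  map_smul' c a := by
    refine Subtype.ext (funext fun x => ?_)
    have h := extDeriv_smul (x := extChartAt (𝓡 n) x x) c (inChart a.1 x)
    exact congrArg (fun η : Model n [⋀^Fin (q + 1)]→L[ℝ] ℝ => η.compContinuousLinearMap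
      (mfderiv (𝓡 n) 𝓘(ℝ, Model n) (extChartAt (𝓡 n) x) x)) h

/-- Deformed exterior derivative `d_t = e^{-tf} d e^{tf} : Ω^q(M) → Ω^{q+1}(M)`. -/
noncomputable def dt (f : C^∞⟮𝓡 n, M; ℝ⟯) (t : ℝ) (q : ℕ) : Form n M q →ₗ[ℝ] Form n M (q + 1) :=
  Form.mul (expMul f (-t)) (q + 1) ∘ₗ extD n M q ∘ₗ Form.mul (expMul f t) q

end Forms

section Metric

variable {n : ℕ} {M : Type*} [TopologicalSpace M] [ChartedSpace (Model n) M]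
  [IsManifold (𝓡 n) ∞ M]

variable (n M) in
/-- Smooth Riemannian metrics on `M`. -/
abbrev Metric : Type _ :=
  Bundle.ContMDiffRiemannianMetric (𝓡 n) ∞ (Model n) (TangentSpace (𝓡 n) : M → Type _)

/-- The matrix `(g_{ij})`, `g_{ij} = g(∂/∂xᵢ, ∂/∂xⱼ)`, of the metric in the chart at `x₀`, as a
function on the target of the chart. -/
noncomputable def gram (g : Metric n M) (x₀ : M) (z : Model n) : Matrix (Fin n) (Fin n) ℝ :=
  Matrix.of fun i j => g.inner ((extChartAt (𝓡 n) x₀).symm z)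
    (chartInvDeriv x₀ z (EuclideanSpace.single i 1)) (chartInvDeriv x₀ z (EuclideanSpace.single j 1))

/-- The bundle metric induced by `g` on `Λ^q T^*M`, at the point `x`: in coordinates
`g(α, β) = (1/q!) ∑ g^{i₁j₁} ⋯ g^{i_q j_q} α_{i₁…i_q} β_{j₁…j_q}`, where all indices run over
`1, …, n`. With the factor `1/q!` the forms `dx_{i₁} ∧ ⋯ ∧ dx_{i_q}`, `i₁ < ⋯ < i_q`, are
orthonormal if `g_{ij} = δ_{ij}`. The value does not depend on the chart; the chart at `x` is used. -/
noncomputable def formInner {q : ℕ} (g : Metric n M)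
    (α β : ∀ x : M, TangentSpace (𝓡 n) x [⋀^Fin q]→L[ℝ] ℝ) (x : M) : ℝ :=
  ((q.factorial : ℝ))⁻¹ * ∑ i : Fin q → Fin n, ∑ j : Fin q → Fin n,
    (∏ a, (gram g x (extChartAt (𝓡 n) x x))⁻¹ (i a) (j a)) *
      inChart α x (extChartAt (𝓡 n) x x) (fun a => EuclideanSpace.single (i a) 1) *
      inChart β x (extChartAt (𝓡 n) x x) (fun a => EuclideanSpace.single (j a) 1)

variable [MeasurableSpace M] [BorelSpace M]

/-- The Riemannian volume of the domain of the chart at `x₀`: the measure `√(det g_{ij}) dx` on the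
target of the chart, transported to `M`. -/
noncomputable def chartVolume (g : Metric n M) (x₀ : M) : Measure M :=
  Measure.map (extChartAt (𝓡 n) x₀).symm
    ((volume.restrict (extChartAt (𝓡 n) x₀).target).withDensity
      fun z => ENNReal.ofReal (Real.sqrt (gram g x₀ z).det))

/-- The Riemannian measure `dv_g`. The measures `chartVolume g x₀` agree on the overlaps of the
charts, and `dv_g` is the measure on `M` that they glue to, i.e. the smallest one that is at least
`chartVolume g x₀` for every `x₀`; on the domain of each chart it is `√(det g_{ij}) dx`. -/
noncomputable def riemVolume (g : Metric n M) : Measure M := ⨆ x₀ : M, chartVolume g x₀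

/-- The `L²` inner product `(α, β) = ∫_M g(α, β) dv_g` of smooth forms. -/
noncomputable def l2Inner {q : ℕ} (g : Metric n M) (α β : Form n M q) : ℝ :=
  ∫ x, formInner g α.1 β.1 x ∂(riemVolume g)

/-- `δ` is a formal adjoint of `D : Ω^q(M) → Ω^{q+1}(M)`: `(D u, v) = (u, δ v)` for all smooth
forms `u`, `v`. -/
def IsFormalAdjoint {q : ℕ} (g : Metric n M) (D : Form n M q →ₗ[ℝ] Form n M (q + 1))
    (δ : Form n M (q + 1) →ₗ[ℝ] Form n M q) : Prop :=
  ∀ u v, l2Inner g (D u) v = l2Inner g u (δ v)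

/-- The formal adjoint `d_t^* : Ω^{q+1}(M) → Ω^q(M)` of `d_t` (unique because the `L²` inner product
is definite on smooth forms). -/
noncomputable def dtStar (g : Metric n M) (f : C^∞⟮𝓡 n, M; ℝ⟯) (t : ℝ) (q : ℕ) :
    Form n M (q + 1) →ₗ[ℝ] Form n M q :=
  Classical.epsilon (IsFormalAdjoint g (dt f t q))

/-- The Witten Laplacian `Δ_t = d_t d_t^* + d_t^* d_t` on `Ω^q(M)`; for `q = 0` the first term is
absent. -/
noncomputable def laplacian (g : Metric n M) (f : C^∞⟮𝓡 n, M; ℝ⟯) (t : ℝ) :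
    (q : ℕ) → Module.End ℝ (Form n M q)
  | 0 => dtStar g f t 0 ∘ₗ dt f t 0
  | q + 1 => dt f t q ∘ₗ dtStar g f t q + dtStar g f t (q + 1) ∘ₗ dt f t (q + 1)

/-- `E^q_{I,t}(M)`: the (internal) direct sum of the eigenspaces
`E^q_{μ,t}(M) = {u ∈ Ω^q(M) : Δ_t u = μ u}` over the eigenvalues `μ ∈ I` of `Δ_t` on `Ω^q(M)`. -/
noncomputable def eigenSum (g : Metric n M) (f : C^∞⟮𝓡 n, M; ℝ⟯) (t : ℝ) (I : Set ℝ) (q : ℕ) :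
    Submodule ℝ (Form n M q) :=
  ⨆ μ ∈ {μ : ℝ | Module.End.HasEigenvalue (laplacian g f t q) μ} ∩ I,
    Module.End.eigenspace (laplacian g f t q) μ

end Metric

end Witten

/-! The homological half is Hodge theory inside the eigenspaces. Since `d_t² = 0`, also `(d_t^*)² =
0`, so the Laplacian commutes with `d_t` and `d_t^*`, and both preserve the sums of eigenspaces. On
the part with eigenvalues in `(0, λ]` the Laplacian is onto, because an eigenvector `u` is the image
of `μ⁻¹ u`, and injective, because it is symmetric. If `d_t u = 0`, write `u = Δ w`; then `Δ (d_t w)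
= d_t u = 0`, so `d_t w = 0` and `u = d_t (d_t^* w)`, or `u = 0` in degree zero. By rank–nullity the
alternating sum of dimensions up to degree `q` telescopes to the rank of `d_t` on `E^q`
(`sum_finrank_eq_finrank_range`), and for `q = n` this rank is zero.

The analytic half is finite-dimensionality, and it uses neither Sobolev spaces nor elliptic
regularity nor a spectral theorem. Eigenspaces are orthogonal, so on `E^q` the energy `‖d_t u‖² +
‖d_t^* u‖²` is at most `λ ‖u‖²` (`energy_le_of_mem_eigenSum`). Rellich compactness is replaced by
`exists_cofg_l2_le`: for every `ε > 0` there is a subspace of finite codimension on which `‖u‖² ≤ ε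
(energy + ‖u‖²)`. For small `ε` it meets `E^q` only in zero.

That subspace is cut out by mean values. A partition of unity moves `u` into charts, where the
components are required to have mean zero over the cubes of a fine grid. Poincaré's inequality on
each cube (`poincare_convex`) bounds the `L²` norm by a small multiple of the Dirichlet integral,
which Gårding's inequality (`garding_zero`, `garding_succ`) bounds by the energy of the undeformed
`d` and `d^*` plus the `L²` norm. Deforming by `t f` and multiplying by a cutoff change `d` and
`d^*` only by `L²`-bounded operators.

Gårding's inequality rests on a pointwise identity: `|dw|²` plus the square of the principal part of
`d^* w` equals `|∇w|²` plus antisymmetrised products of first derivatives. Integrated by parts,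
these products lose their second derivatives by symmetry and are controlled by `‖w‖ ‖∇w‖`
(`integral_cross_term`).

The adjoint is built in a chart by integration by parts and glued with the partition of unity. This
requires that the coordinate metrics on forms and the coordinate densities agree on overlaps. -/

section

set_option maxSynthPendingDepth 3

namespace Witten

/-- Alternating `q`-forms on `ℝⁿ`. -/
abbrev Alt (n q : ℕ) : Type := Model n [⋀^Fin q]→L[ℝ] ℝ

/-- The `i`-th vector of the standard basis of `ℝⁿ`. -/
noncomputable abbrev stdVec {n : ℕ} (i : Fin n) : Model n := EuclideanSpace.single i (1 : ℝ)

/-! ### Alternating forms: induced metrics, contraction and alternatization. -/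

section LinearAlgebra

variable {n q : ℕ}

theorem sum_coord_smul_stdVec (v : Model n) : ∑ i, v i • stdVec i = v := by
  ext j
  simp [stdVec, Finset.sum_apply, Pi.single_apply]

/-- The component `a_I = a(e_{i₁}, …, e_{i_q})` of an alternating form. -/
noncomputable def altComp (I : Fin q → Fin n) : Alt n q →L[ℝ] ℝ :=
  ContinuousAlternatingMap.apply ℝ (Model n) ℝ (fun k => stdVec (I k))

@[simp] theorem altComp_apply (I : Fin q → Fin n) (a : Alt n q) :
    altComp I a = a (fun k => stdVec (I k)) := rfl

theorem alt_apply_sum {ι : Type*} [Fintype ι] (a : Alt n q) (c : Fin q → ι → ℝ) (v : ι → Model n) :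
    a (fun k => ∑ i, c k i • v i) = ∑ I : Fin q → ι, (∏ k, c k (I k)) * a (fun k => v (I k)) := by
  have h := a.toMultilinearMap.map_sum (fun k i => c k i • v i)
  refine h.trans (Finset.sum_congr rfl fun I _ => ?_)
  exact a.toMultilinearMap.map_smul_univ (fun k => c k (I k)) (fun k => v (I k))

theorem alt_apply_eq_sum_comp (a : Alt n q) (w : Fin q → Model n) :
    a w = ∑ I : Fin q → Fin n, (∏ k, w k (I k)) * altComp I a := by
  have h := alt_apply_sum a (fun k i => w k i) (fun i : Fin n => stdVec i)
  simp only [sum_coord_smul_stdVec] at h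
  exact h

theorem alt_ext {a b : Alt n q} (h : ∀ I, altComp I a = altComp I b) : a = b := by
  ext w
  rw [alt_apply_eq_sum_comp a, alt_apply_eq_sum_comp b]
  simp only [h]

/-- All components of an alternating form. -/
noncomputable def altComps (n q : ℕ) : Alt n q →L[ℝ] ((Fin q → Fin n) → ℝ) :=
  ContinuousLinearMap.pi fun I => altComp I

theorem altComps_injective : Function.Injective (altComps n q) :=
  fun _ _ h => alt_ext fun I => congrFun h I

instance : FiniteDimensional ℝ (Alt n q) :=
  FiniteDimensional.of_injective (altComps n q).toLinearMap altComps_injective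

/-- A continuous left inverse of `altComps`. -/
theorem exists_altComps_leftInverse :
    ∃ r : ((Fin q → Fin n) → ℝ) →L[ℝ] Alt n q, ∀ a, r (altComps n q a) = a := by
  obtain ⟨g, hg⟩ := LinearMap.exists_leftInverse_of_injective (altComps n q).toLinearMap
    (LinearMap.ker_eq_bot.2 altComps_injective)
  exact ⟨LinearMap.toContinuousLinearMap g, fun a => LinearMap.congr_fun hg a⟩

theorem contDiffOn_alt_iff {F : Type*} [NormedAddCommGroup F] [NormedSpace ℝ F] {s : Set F}
    {a : F → Alt n q} {m : WithTop ℕ∞} :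
    ContDiffOn ℝ m a s ↔ ∀ I, ContDiffOn ℝ m (fun z => altComp I (a z)) s := by
  refine ⟨fun h I => (altComp I).contDiff.comp_contDiffOn h, fun h => ?_⟩
  obtain ⟨r, hr⟩ := exists_altComps_leftInverse (n := n) (q := q)
  have h1 : ContDiffOn ℝ m (fun z => altComps n q (a z)) s := contDiffOn_pi.2 h
  refine (r.contDiff.comp_contDiffOn h1).congr fun z _ => (hr _).symm

/-- The bilinear form on `q`-covectors induced by a bilinear form `B` on covectors. -/
noncomputable def altInner (B : Matrix (Fin n) (Fin n) ℝ) (a b : Alt n q) : ℝ :=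
  ((q.factorial : ℝ))⁻¹ * ∑ i : Fin q → Fin n, ∑ j : Fin q → Fin n,
    (∏ k, B (i k) (j k)) * a (fun k => stdVec (i k)) * b (fun k => stdVec (j k))

theorem altInner_comm {B : Matrix (Fin n) (Fin n) ℝ} (hB : B.transpose = B) (a b : Alt n q) :
    altInner B a b = altInner B b a := by
  unfold altInner
  rw [Finset.sum_comm]
  congr 1
  refine Finset.sum_congr rfl fun i _ => Finset.sum_congr rfl fun j _ => ?_
  have : ∀ k, B (j k) (i k) = B (i k) (j k) := fun k => by
    conv_lhs => rw [← hB]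
    rfl
  simp only [this]
  ring

/-- The matrix of a linear map. -/
noncomputable def clmMatrix (P : Model n →L[ℝ] Model n) : Matrix (Fin n) (Fin n) ℝ :=
  Matrix.of fun i j => P (stdVec j) i

theorem altComp_comp (a : Alt n q) (P : Model n →L[ℝ] Model n) (I : Fin q → Fin n) :
    a (fun k => P (stdVec (I k))) =
      ∑ K : Fin q → Fin n, (∏ k, clmMatrix P (K k) (I k)) * a (fun k => stdVec (K k)) :=
  alt_apply_eq_sum_comp a _

/-- The `q`-fold tensor power of the congruence `B ↦ P B Pᵀ`, obtained by exchanging the product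
with the sums. -/
theorem prod_mul_mul_transpose (P B : Matrix (Fin n) (Fin n) ℝ) (K L : Fin q → Fin n) :
    ∏ k, (P * B * P.transpose) (K k) (L k) = ∑ I : Fin q → Fin n, ∑ J : Fin q → Fin n,
      (∏ k, B (I k) (J k)) * (∏ k, P (K k) (I k)) * ∏ k, P (L k) (J k) := by
  have h1 : ∀ k, (P * B * P.transpose) (K k) (L k) =
      ∑ j, ∑ i, P (K k) i * B i j * P (L k) j := fun k => by
    simp [Matrix.mul_apply, Finset.sum_mul]
  simp only [h1, Finset.prod_univ_sum, Fintype.piFinset_univ]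
  rw [Finset.sum_comm]
  refine Finset.sum_congr rfl fun I _ => Finset.sum_congr rfl fun J _ => ?_
  simp only [Finset.prod_mul_distrib]
  ring

/-- A change of variables on forms is a congruence on the cometric. This yields independence of the
chart and, starting from `B = 1`, all positivity statements. -/
theorem altInner_comp (B : Matrix (Fin n) (Fin n) ℝ) (P : Model n →L[ℝ] Model n) (a b : Alt n q) :
    altInner B (a.compContinuousLinearMap P) (b.compContinuousLinearMap P) =
      altInner (clmMatrix P * B * (clmMatrix P).transpose) a b := by
  unfold altInner
  congr 1
  have h : ∀ (c : Alt n q) (I : Fin q → Fin n),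
      (c.compContinuousLinearMap P) (fun k => stdVec (I k)) =
      ∑ K : Fin q → Fin n, (∏ k, clmMatrix P (K k) (I k)) * c (fun k => stdVec (K k)) :=
    fun c I => altComp_comp c P I
  simp only [h, prod_mul_mul_transpose, Finset.mul_sum, Finset.sum_mul]
  have e : ∀ F : (Fin q → Fin n) → (Fin q → Fin n) → (Fin q → Fin n) → (Fin q → Fin n) → ℝ,
      ∑ I, ∑ J, ∑ L, ∑ K, F I J L K = ∑ K, ∑ L, ∑ I, ∑ J, F I J L K := by
    intro F
    calc ∑ I, ∑ J, ∑ L, ∑ K, F I J L K = ∑ I, ∑ L, ∑ J, ∑ K, F I J L K :=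
          Finset.sum_congr rfl fun I _ => Finset.sum_comm
      _ = ∑ L, ∑ I, ∑ J, ∑ K, F I J L K := Finset.sum_comm
      _ = ∑ L, ∑ I, ∑ K, ∑ J, F I J L K :=
          Finset.sum_congr rfl fun L _ => Finset.sum_congr rfl fun I _ => Finset.sum_comm
      _ = ∑ L, ∑ K, ∑ I, ∑ J, F I J L K := Finset.sum_congr rfl fun L _ => Finset.sum_comm
      _ = _ := Finset.sum_comm
  rw [e]
  refine Finset.sum_congr rfl fun K _ => Finset.sum_congr rfl fun L _ =>
    Finset.sum_congr rfl fun I _ => Finset.sum_congr rfl fun J _ => ?_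
  ring

theorem altInner_one (a b : Alt n q) :
    altInner 1 a b = ((q.factorial : ℝ))⁻¹ * ∑ I : Fin q → Fin n,
      a (fun k => stdVec (I k)) * b (fun k => stdVec (I k)) := by
  unfold altInner
  congr 1
  refine Finset.sum_congr rfl fun I _ => ?_
  rw [Finset.sum_eq_single I]
  · simp
  · intro J _ hJ
    obtain ⟨k, hk⟩ := Function.ne_iff.1 hJ
    rw [Finset.prod_eq_zero (Finset.mem_univ k)]
    · simp
    · exact Matrix.one_apply_ne fun h => hk h.symm
  · simp

theorem altInner_one_nonneg (a : Alt n q) : 0 ≤ altInner 1 a a := by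
  rw [altInner_one]
  exact mul_nonneg (by positivity) (Finset.sum_nonneg fun I _ => mul_self_nonneg _)

theorem eq_zero_of_altInner_one {a : Alt n q} (h : altInner 1 a a = 0) : a = 0 := by
  rw [altInner_one, mul_eq_zero, Finset.sum_eq_zero_iff_of_nonneg
    fun I _ => mul_self_nonneg _] at h
  rcases h with h | h
  · exact absurd h (by positivity)
  · exact alt_ext fun I => by simpa using mul_self_eq_zero.1 (h I (Finset.mem_univ I))

-- A positive definite matrix is `yᵀ y` with `y` invertible; `P` has matrix `yᵀ` and `Q` is its
-- inverse. The invertibility serves to pull definiteness back from the standard metric.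
open scoped MatrixOrder in
theorem exists_eq_mul_transpose {B : Matrix (Fin n) (Fin n) ℝ} (hB : B.PosDef) :
    ∃ P Q : Model n →L[ℝ] Model n, B = clmMatrix P * (clmMatrix P).transpose ∧ ∀ x, P (Q x) = x := by
  obtain ⟨y, hy⟩ := CStarAlgebra.nonneg_iff_eq_star_mul_self.mp hB.posSemidef.nonneg
  rw [Matrix.star_eq_conjTranspose, Matrix.conjTranspose_eq_transpose_of_trivial] at hy
  have hP : clmMatrix (Matrix.toEuclideanCLM (𝕜 := ℝ) y.transpose) = y.transpose := by
    ext i j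
    simp [clmMatrix, stdVec, Matrix.ofLp_toEuclideanCLM]
  have hdet : IsUnit y.transpose.det := by
    have := hB.det_pos
    rw [hy, Matrix.det_mul, Matrix.det_transpose] at this
    rw [Matrix.det_transpose]
    exact isUnit_iff_ne_zero.2 fun h => by simp [h] at this
  refine ⟨Matrix.toEuclideanCLM (𝕜 := ℝ) y.transpose,
    Matrix.toEuclideanCLM (𝕜 := ℝ) (y.transpose)⁻¹, by rw [hP, Matrix.transpose_transpose, hy], ?_⟩
  intro x
  rw [← mul_apply_eq_comp, ← map_mul, Matrix.mul_nonsing_inv _ hdet, map_one]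
  rfl

theorem altInner_self_nonneg {B : Matrix (Fin n) (Fin n) ℝ} (hB : B.PosDef) (a : Alt n q) :
    0 ≤ altInner B a a := by
  obtain ⟨P, -, rfl, -⟩ := exists_eq_mul_transpose hB
  have := altInner_comp 1 P a a
  rw [mul_one] at this
  rw [← this]
  exact altInner_one_nonneg _

theorem altInner_self_pos {B : Matrix (Fin n) (Fin n) ℝ} (hB : B.PosDef) {a : Alt n q}
    (ha : a ≠ 0) : 0 < altInner B a a := by
  refine lt_of_le_of_ne (altInner_self_nonneg hB a) fun h => ha ?_
  obtain ⟨P, Q, rfl, hPQ⟩ := exists_eq_mul_transpose hB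
  have := altInner_comp 1 P a a
  rw [mul_one, ← h] at this
  have h0 := eq_zero_of_altInner_one this
  ext w
  have := congrArg (fun c : Alt n q => c (fun k => Q (w k))) h0
  simpa [hPQ, Function.comp_def] using this

theorem sum_insertNth (p : Fin (q + 1)) (F : (Fin (q + 1) → Fin n) → ℝ) :
    ∑ I, F I = ∑ i, ∑ I : Fin q → Fin n, F (p.insertNth i I) := by
  rw [← Fintype.sum_prod_type' (f := fun i I => F (p.insertNth (α := fun _ => Fin n) i I))]
  exact (Fintype.sum_equiv (Fin.insertNthEquiv (fun _ => Fin n) p) _ _ fun _ => rfl).symm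

theorem stdVec_insertNth (p : Fin (q + 1)) (i : Fin n) (I : Fin q → Fin n) :
    (fun k => stdVec ((p.insertNth i I : Fin (q + 1) → Fin n) k)) =
      (p.insertNth (stdVec i) (fun k => stdVec (I k)) : Fin (q + 1) → Model n) := by
  funext k
  cases k using p.succAboveCases <;> simp

/-- Exterior multiplication is adjoint to contraction. All `q + 1` terms of the alternatization
contribute equally, and this factor turns `1/(q+1)!` into `1/q!`. -/
theorem altInner_alternatize (B : Matrix (Fin n) (Fin n) ℝ) (L : Model n →L[ℝ] Alt n q)
    (b : Alt n (q + 1)) :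
    altInner B (ContinuousAlternatingMap.alternatizeUncurryFin L) b =
      ∑ i, ∑ j, B i j * altInner B (L (stdVec i)) (b.curryLeft (stdVec j)) := by
  have key : ∀ p : Fin (q + 1), ∑ I : Fin (q + 1) → Fin n, ∑ J : Fin (q + 1) → Fin n,
      (∏ k, B (I k) (J k)) * ((-1) ^ (p : ℕ) • L (stdVec (I p)) (p.removeNth fun k => stdVec (I k))) *
        b (fun k => stdVec (J k)) =
      ∑ i, ∑ j, B i j * ∑ I : Fin q → Fin n, ∑ J : Fin q → Fin n, (∏ k, B (I k) (J k)) *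
        L (stdVec i) (fun k => stdVec (I k)) * b.curryLeft (stdVec j) (fun k => stdVec (J k)) := by
    intro p
    rw [sum_insertNth p]
    refine Finset.sum_congr rfl fun i _ => ?_
    simp only [Finset.mul_sum]
    rw [Finset.sum_comm (s := (Finset.univ : Finset (Fin n)))]
    refine Finset.sum_congr rfl fun I _ => ?_
    rw [sum_insertNth p]
    refine Finset.sum_congr rfl fun j _ => Finset.sum_congr rfl fun J _ => ?_
    rw [Fin.prod_univ_succAbove _ p, stdVec_insertNth p j J, stdVec_insertNth p i I,
      ContinuousAlternatingMap.map_insertNth, ContinuousAlternatingMap.curryLeft_apply_apply]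
    simp only [Fin.insertNth_apply_same, Fin.insertNth_apply_succAbove, Fin.removeNth_insertNth]
    -- The sign of the `p`-th term meets the sign of moving slot `p` of `b` to the front, and their
    -- product is `1`.
    rcases neg_one_pow_eq_or ℤ (p : ℕ) with h | h <;> rw [h] <;> simp <;> ring
  have hsum : ∑ I : Fin (q + 1) → Fin n, ∑ J : Fin (q + 1) → Fin n,
      (∏ k, B (I k) (J k)) * (ContinuousAlternatingMap.alternatizeUncurryFin L)
        (fun k => stdVec (I k)) * b (fun k => stdVec (J k)) =
      (q + 1 : ℝ) * ∑ i, ∑ j, B i j * ∑ I : Fin q → Fin n, ∑ J : Fin q → Fin n,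
        (∏ k, B (I k) (J k)) * L (stdVec i) (fun k => stdVec (I k)) *
          b.curryLeft (stdVec j) (fun k => stdVec (J k)) := by
    simp only [ContinuousAlternatingMap.alternatizeUncurryFin_apply, Finset.mul_sum, Finset.sum_mul]
    simp only [Finset.mul_sum] at key
    calc _ = ∑ I : Fin (q + 1) → Fin n, ∑ p : Fin (q + 1), ∑ J : Fin (q + 1) → Fin n,
          (∏ k, B (I k) (J k)) *
          ((-1) ^ (p : ℕ) • L (stdVec (I p)) (p.removeNth fun k => stdVec (I k))) *
          b (fun k => stdVec (J k)) := Finset.sum_congr rfl fun I _ => Finset.sum_comm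
      _ = _ := by
        rw [Finset.sum_comm]
        simp only [key, Finset.sum_const, Finset.card_univ, Fintype.card_fin, nsmul_eq_mul,
          Finset.mul_sum]
        push_cast
        rfl
  unfold altInner
  rw [hsum, Nat.factorial_succ]
  push_cast
  rw [mul_inv, Finset.mul_sum, Finset.mul_sum]
  have hq : (q + 1 : ℝ) ≠ 0 := by positivity
  refine Finset.sum_congr rfl fun i _ => ?_
  rw [Finset.mul_sum, Finset.mul_sum]
  refine Finset.sum_congr rfl fun j _ => ?_
  field_simp

/-- The anticommutation rule of contraction and exterior multiplication: slot `0` of the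
alternatization gives `L v`, and the other slots carry one additional sign. -/
theorem curryLeft_alternatize (L : Model n →L[ℝ] Alt n (q + 1)) (v : Model n) :
    (ContinuousAlternatingMap.alternatizeUncurryFin L).curryLeft v =
      L v - ContinuousAlternatingMap.alternatizeUncurryFin
        (((ContinuousLinearMap.apply ℝ (Alt n q) v).comp
          (ContinuousAlternatingMap.curryLeftLI (𝕜 := ℝ) (E := Model n) (F := ℝ)
            (n := q)).toContinuousLinearMap).comp L) := by
  ext w
  rw [ContinuousAlternatingMap.curryLeft_apply_apply, ContinuousAlternatingMap.sub_apply,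
    ContinuousAlternatingMap.alternatizeUncurryFin_apply,
    ContinuousAlternatingMap.alternatizeUncurryFin_apply, Fin.sum_univ_succ, sub_eq_add_neg,
    ← Finset.sum_neg_distrib]
  congr 1
  · simp [Matrix.vecCons]
  · refine Finset.sum_congr rfl fun k _ => ?_
    simp only [Matrix.cons_val_succ, Fin.val_succ, pow_succ]
    have : Fin.removeNth k.succ (Matrix.vecCons v w) = Matrix.vecCons v (Fin.removeNth k w) := by
      funext m
      cases m using Fin.cases <;> simp [Fin.removeNth, Matrix.vecCons]
    rw [this]
    simp

/-- `altInner` as a continuous bilinear map. -/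
noncomputable def covPair (q : ℕ) (B : Matrix (Fin n) (Fin n) ℝ) : Alt n q →L[ℝ] Alt n q →L[ℝ] ℝ :=
  ∑ i : Fin q → Fin n, ∑ j : Fin q → Fin n,
    (((q.factorial : ℝ))⁻¹ * ∏ k, B (i k) (j k)) •
      ContinuousLinearMap.smulRight (altComp i) (altComp j)

theorem covPair_apply (B : Matrix (Fin n) (Fin n) ℝ) (a b : Alt n q) :
    covPair q B a b = altInner B a b := by
  simp only [covPair, altInner, Finset.mul_sum, sum_apply, smul_apply,
    ContinuousLinearMap.smulRight_apply, altComp_apply, smul_eq_mul]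
  refine Finset.sum_congr rfl fun i _ => Finset.sum_congr rfl fun j _ => ?_
  ring

/-- Contraction of a form with a vector. -/
noncomputable def covContract (q : ℕ) (v : Model n) : Alt n (q + 1) →L[ℝ] Alt n q :=
  LinearMap.toContinuousLinearMap
    { toFun := fun b => ContinuousAlternatingMap.curryLeft (b : Alt n (q + 1)) v
      map_add' := fun _ _ => rfl
      map_smul' := fun _ _ => rfl }

/-- The alternatization `E → Λ^q → Λ^{q+1}`. -/
noncomputable def covD (q : ℕ) : (Model n →L[ℝ] Alt n q) →L[ℝ] Alt n (q + 1) :=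
  ContinuousAlternatingMap.alternatizeUncurryFinCLM ℝ (Model n) ℝ

theorem covPair_covD (B : Matrix (Fin n) (Fin n) ℝ) (L : Model n →L[ℝ] Alt n q)
    (b : Alt n (q + 1)) :
    covPair (q + 1) B (covD q L) b =
      ∑ i, ∑ j, B i j * covPair q B (L (stdVec i)) (covContract q (stdVec j) b) := by
  simp only [covPair_apply]
  exact altInner_alternatize B L b

theorem covContract_covD (L : Model n →L[ℝ] Alt n (q + 1)) (v : Model n) :
    covContract (q + 1) v (covD (q + 1) L) = L v - covD q ((covContract q v).comp L) :=
  curryLeft_alternatize L v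

theorem covContract_covD_zero (L : Model n →L[ℝ] Alt n 0) (v : Model n) :
    covContract 0 v (covD 0 L) = L v := by
  refine ContinuousAlternatingMap.ext fun w => ?_
  refine (ContinuousAlternatingMap.alternatizeUncurryFin_apply (𝕜 := ℝ) (E := Model n) (F := ℝ)
    L (Matrix.vecCons v w)).trans ?_
  simp only [Nat.reduceAdd, Finset.univ_unique, Finset.sum_singleton]
  simp [Matrix.vecCons]

theorem covPair_comm {B : Matrix (Fin n) (Fin n) ℝ} (hB : B.PosDef) (a b : Alt n q) :
    covPair q B a b = covPair q B b a := by
  simp only [covPair_apply]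
  refine altInner_comm ?_ _ _
  rw [← Matrix.conjTranspose_eq_transpose_of_trivial]
  exact hB.isHermitian

theorem covPair_self_pos {B : Matrix (Fin n) (Fin n) ℝ} (hB : B.PosDef) {a : Alt n q}
    (ha : a ≠ 0) : 0 < covPair q B a a := by
  rw [covPair_apply]
  exact altInner_self_pos hB ha

theorem covPair_self_nonneg {B : Matrix (Fin n) (Fin n) ℝ} (hB : B.PosDef) (a : Alt n q) :
    0 ≤ covPair q B a a := by
  rw [covPair_apply]
  exact altInner_self_nonneg hB a

/-- The principal symbol of the codifferential (up to sign): `∑ B_{ij} ι_j ∂_i`. -/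
noncomputable def covDiv (q : ℕ) (B : Matrix (Fin n) (Fin n) ℝ) :
    (Model n →L[ℝ] Alt n (q + 1)) →L[ℝ] Alt n q :=
  ∑ i, ∑ j, B i j • (covContract q (stdVec j)).comp
    (ContinuousLinearMap.apply ℝ (Alt n (q + 1)) (stdVec i))

theorem covDiv_apply (B : Matrix (Fin n) (Fin n) ℝ) (L : Model n →L[ℝ] Alt n (q + 1)) :
    covDiv q B L = ∑ i, ∑ j, B i j • covContract q (stdVec j) (L (stdVec i)) := by
  simp [covDiv, sum_apply]

/-- For functions `|dw|²` already is `|∇w|²`, so degree zero has no cross terms. -/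
theorem covPair_covD_zero (B : Matrix (Fin n) (Fin n) ℝ) (L : Model n →L[ℝ] Alt n 0) :
    covPair 1 B (covD 0 L) (covD 0 L) =
      ∑ i, ∑ j, B i j * covPair 0 B (L (stdVec i)) (L (stdVec j)) := by
  simp only [covPair_covD, covContract_covD_zero]

/-- The antisymmetrised products of first derivatives that enter the comparison of
`|dw|² + |δw|²` with `|∇w|²`. -/
theorem covPair_covD_succ {B : Matrix (Fin n) (Fin n) ℝ} (hB : B.PosDef)
    (L : Model n →L[ℝ] Alt n (q + 1)) :
    covPair (q + 2) B (covD (q + 1) L) (covD (q + 1) L) +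
        covPair q B (covDiv q B L) (covDiv q B L) =
      ∑ i, ∑ j, B i j * covPair (q + 1) B (L (stdVec i)) (L (stdVec j)) +
      ∑ i, ∑ j, ∑ k, ∑ l, B i j * B k l *
        (covPair q B (covContract q (stdVec j) (L (stdVec i)))
            (covContract q (stdVec l) (L (stdVec k))) -
          covPair q B (covContract q (stdVec j) (L (stdVec k)))
            (covContract q (stdVec l) (L (stdVec i)))) := by
  -- Adjointness moves one alternatization across the pairing, anticommutation splits the resulting
  -- contraction, and adjointness once more gives the terms with `i` and `k` exchanged.
  have h1 : covPair (q + 2) B (covD (q + 1) L) (covD (q + 1) L) =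
      ∑ i, ∑ j, B i j * covPair (q + 1) B (L (stdVec i)) (L (stdVec j)) -
      ∑ i, ∑ j, ∑ k, ∑ l, B i j * B k l * covPair q B (covContract q (stdVec j) (L (stdVec k)))
            (covContract q (stdVec l) (L (stdVec i))) := by
    rw [covPair_covD, ← Finset.sum_sub_distrib]
    refine Finset.sum_congr rfl fun i _ => ?_
    rw [← Finset.sum_sub_distrib]
    refine Finset.sum_congr rfl fun j _ => ?_
    rw [covContract_covD, map_sub, mul_sub, covPair_comm hB _ (covD q _), covPair_covD]
    simp only [Finset.mul_sum, ContinuousLinearMap.comp_apply, mul_assoc]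
  have h2 : covPair q B (covDiv q B L) (covDiv q B L) =
      ∑ i, ∑ j, ∑ k, ∑ l, B i j * B k l *
        covPair q B (covContract q (stdVec j) (L (stdVec i)))
            (covContract q (stdVec l) (L (stdVec k))) := by
    simp only [covDiv_apply, map_sum, map_smul, sum_apply, smul_apply, smul_eq_mul, Finset.mul_sum]
    refine Finset.sum_congr rfl fun i _ => Finset.sum_congr rfl fun j _ =>
      Finset.sum_congr rfl fun k _ => Finset.sum_congr rfl fun l _ => ?_
    rw [covPair_comm hB]
    ring
  rw [h1, h2]
  simp only [mul_sub, Finset.sum_sub_distrib]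
  ring

end LinearAlgebra

/-! ### Integration by parts and uniform coercivity on compact sets. -/

section Calculus

variable {n : ℕ} {V W : Type*} [NormedAddCommGroup V] [NormedSpace ℝ V]
  [NormedAddCommGroup W] [NormedSpace ℝ W]

theorem integrable_of_continuousOn {W : Type*} [NormedAddCommGroup W] {F : Model n → W} {K O : Set (Model n)} (hO : ContinuousOn F O)
    (hK : IsCompact K) (hKO : K ⊆ O) (h0 : ∀ z ∉ K, F z = 0) : Integrable F := by
  rw [← integrableOn_iff_integrable_of_support_subset (s := K)
    (fun z hz => by_contra fun h => hz (h0 z h))]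
  exact (hO.mono hKO).integrableOn_compact hK

theorem tsupport_subset_of_zero {V : Type*} [NormedAddCommGroup V] {w : Model n → V} {K : Set (Model n)} (hK : IsCompact K)
    (h0 : ∀ z ∉ K, w z = 0) : tsupport w ⊆ K :=
  closure_minimal (fun z hz => by_contra fun h => hz (h0 z h)) hK.isClosed

theorem fderiv_eq_zero_of_zero {w : Model n → V} {K : Set (Model n)} (hK : IsCompact K)
    (h0 : ∀ z ∉ K, w z = 0) : ∀ z ∉ K, fderiv ℝ w z = 0 := fun z hz => by
  have : w =ᶠ[𝓝 z] fun _ => 0 := by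
    filter_upwards [hK.isClosed.isOpen_compl.mem_nhds hz] with y hy using h0 y hy
  rw [this.fderiv_eq]
  simp

/-- Integration by parts against a covector field which is differentiable near the support. -/
theorem integral_apply_fderiv {h : Model n → V →L[ℝ] ℝ} {w : Model n → V} {K O : Set (Model n)}
    (hO : IsOpen O) (hK : IsCompact K) (hKO : K ⊆ O) (hh : ContDiffOn ℝ 1 h O)
    (hw : ContDiff ℝ 1 w) (h0 : ∀ z ∉ K, w z = 0) (e : Model n) :
    ∫ z, h z (fderiv ℝ w z e) = - ∫ z, (fderiv ℝ h z e) (w z) := by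
  have hdw : Continuous fun z => fderiv ℝ w z e :=
    (hw.continuous_fderiv one_ne_zero).clm_apply continuous_const
  have hdh : ContinuousOn (fun z => fderiv ℝ h z e) O :=
    (hh.continuousOn_fderiv_of_isOpen hO le_rfl).clm_apply continuousOn_const
  refine integral_bilinear_fderiv_right_eq_neg_left_of_integrable
    (B := ContinuousLinearMap.id ℝ (V →L[ℝ] ℝ)) (f := h) (g := w) (v := e) ?_ ?_ ?_ ?_ ?_
  · exact integrable_of_continuousOn (O := O) (hdh.clm_apply hw.continuous.continuousOn) hK hKO
      fun z hz => by simp [h0 z hz]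
  · refine integrable_of_continuousOn (O := O) (hh.continuousOn.clm_apply hdw.continuousOn) hK hKO
      fun z hz => by simp [fderiv_eq_zero_of_zero hK h0 z hz]
  · exact integrable_of_continuousOn (O := O) (hh.continuousOn.clm_apply hw.continuous.continuousOn)
      hK hKO fun z hz => by simp [h0 z hz]
  · intro z hz
    have hzO := hKO (tsupport_subset_of_zero hK h0 hz)
    exact (hh.contDiffAt (hO.mem_nhds hzO)).differentiableAt one_ne_zero
  · intro z _
    exact hw.contDiffAt.differentiableAt one_ne_zero

/-- Antisymmetrised products of first derivatives are of lower order after integration. -/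
theorem integral_cross_term {β : Model n → V →L[ℝ] V →L[ℝ] ℝ} {w : Model n → V}
    {K O : Set (Model n)} (hO : IsOpen O) (hK : IsCompact K) (hKO : K ⊆ O)
    (hβ : ContDiffOn ℝ 1 β O) (hw : ContDiff ℝ 2 w) (h0 : ∀ z ∉ K, w z = 0) (e f : Model n) :
    ∫ z, (β z (fderiv ℝ w z e) (fderiv ℝ w z f) - β z (fderiv ℝ w z f) (fderiv ℝ w z e)) =
      ∫ z, ((fderiv ℝ β z f) (w z) (fderiv ℝ w z e) - (fderiv ℝ β z e) (w z) (fderiv ℝ w z f)) := by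
  have hdw1 : ContDiff ℝ 1 (fderiv ℝ w) := hw.fderiv_right (by norm_num)
  have hdw : ∀ v, ContDiff ℝ 1 fun z => fderiv ℝ w z v := fun v =>
    hdw1.clm_apply contDiff_const
  have hd0 := fderiv_eq_zero_of_zero hK h0
  -- The only second derivative that appears is `D²w(e, f)`, paired with `w`. It is symmetric in `e`
  -- and `f` and cancels in the difference.
  have key : ∀ e f : Model n, ∫ z, β z (fderiv ℝ w z e) (fderiv ℝ w z f) =
      - ∫ z, ((fderiv ℝ β z e) (w z) (fderiv ℝ w z f) +
        β z (w z) (fderiv ℝ (fderiv ℝ w) z e f)) := by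
    intro e f
    -- Flipping makes the slot whose derivative is moved the last one, as `integral_apply_fderiv`
    -- requires.
    let Fl : (V →L[ℝ] V →L[ℝ] ℝ) →L[ℝ] (V →L[ℝ] V →L[ℝ] ℝ) :=
      (ContinuousLinearMap.flipₗᵢ ℝ V V ℝ).toContinuousLinearEquiv
    have hFl : ∀ b x y, Fl b x y = b y x := fun _ _ _ => rfl
    have hFc : ContDiff ℝ 1 fun b => Fl b := ContinuousLinearMap.contDiff Fl
    have hflip : ContDiffOn ℝ 1 (fun z => Fl (β z) (fderiv ℝ w z f)) O :=
      (hFc.comp_contDiffOn hβ).clm_apply (hdw f).contDiffOn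
    have h1 := integral_apply_fderiv hO hK hKO hflip (hw.of_le (by norm_num)) h0 e
    simp only [hFl] at h1
    rw [h1]
    congr 1
    refine integral_congr_ae (Filter.Eventually.of_forall fun z => ?_)
    by_cases hz : z ∈ O
    · have hb : HasFDerivAt β (fderiv ℝ β z) z :=
        ((hβ.contDiffAt (hO.mem_nhds hz)).differentiableAt one_ne_zero).hasFDerivAt
      have hb' := (ContinuousLinearMap.hasFDerivAt Fl (x := β z)).comp z hb
      have hc : HasFDerivAt (fun z => fderiv ℝ w z f) ((fderiv ℝ (fderiv ℝ w) z).flip f) z := by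
        have := (hdw1.contDiffAt.differentiableAt one_ne_zero (x := z)).hasFDerivAt.clm_apply
          (hasFDerivAt_const f z)
        simpa using this
      have := (hb'.clm_apply hc).fderiv
      simp only [Function.comp_def] at this
      simp only [this]
      simp [hFl, add_comm]
    · have hz' : z ∉ K := fun h => hz (hKO h)
      simp [h0 z hz']
  have hi : ∀ e f, Integrable fun z => β z (fderiv ℝ w z e) (fderiv ℝ w z f) := fun e f =>
    integrable_of_continuousOn (O := O) ((hβ.continuousOn.clm_apply
      (hdw e).continuous.continuousOn).clm_apply (hdw f).continuous.continuousOn) hK hKO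
      fun z hz => by simp [hd0 z hz]
  have hj : ∀ e f, Integrable fun z => (fderiv ℝ β z e) (w z) (fderiv ℝ w z f) := fun e f =>
    integrable_of_continuousOn (O := O) ((((hβ.continuousOn_fderiv_of_isOpen hO le_rfl).clm_apply
      continuousOn_const).clm_apply hw.continuous.continuousOn).clm_apply
      (hdw f).continuous.continuousOn) hK hKO fun z hz => by simp [hd0 z hz]
  have hk : ∀ e f, Integrable fun z => β z (w z) (fderiv ℝ (fderiv ℝ w) z e f) := fun e f =>
    integrable_of_continuousOn (O := O) ((hβ.continuousOn.clm_apply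
      hw.continuous.continuousOn).clm_apply (((hdw1.continuous_fderiv one_ne_zero).clm_apply
      continuous_const).clm_apply continuous_const).continuousOn) hK hKO
      fun z hz => by simp [h0 z hz]
  rw [integral_sub (hi e f) (hi f e), key e f, key f e, integral_add (hj e f) (hk e f),
    integral_add (hj f e) (hk f e), integral_sub (hj f e) (hj e f)]
  have hsymm : ∀ z, fderiv ℝ (fderiv ℝ w) z e f = fderiv ℝ (fderiv ℝ w) z f e := fun z =>
    (hw.contDiffAt.isSymmSndFDerivAt (by simp)).eq e f
  simp only [hsymm]
  ring

/-- Uniform coercivity of a continuous family of positive definite quadratic forms over a compact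
set. -/
theorem exists_coercive_const [FiniteDimensional ℝ V] {X : Type*} [TopologicalSpace X]
    {Φ : X → V → ℝ} {K : Set X} (hK : IsCompact K)
    (hΦ : ContinuousOn (fun p : X × V => Φ p.1 p.2) (K ×ˢ Set.univ))
    (hhom : ∀ z ∈ K, ∀ (r : ℝ) v, Φ z (r • v) = r ^ 2 * Φ z v)
    (hpos : ∀ z ∈ K, ∀ v, v ≠ 0 → 0 < Φ z v) :
    ∃ c > 0, ∀ z ∈ K, ∀ v, c * ‖v‖ ^ 2 ≤ Φ z v := by
  have : ProperSpace V := FiniteDimensional.proper_real V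
  have hS : IsCompact (K ×ˢ Metric.sphere (0 : V) 1) := hK.prod (isCompact_sphere _ _)
  have hcont : ContinuousOn (fun p : X × V => Φ p.1 p.2) (K ×ˢ Metric.sphere (0 : V) 1) :=
    hΦ.mono (Set.prod_mono subset_rfl (Set.subset_univ _))
  obtain ⟨c, hc, hcS⟩ : ∃ c > 0, ∀ p ∈ K ×ˢ Metric.sphere (0 : V) 1, c ≤ Φ p.1 p.2 := by
    rcases (K ×ˢ Metric.sphere (0 : V) 1).eq_empty_or_nonempty with h | h
    · exact ⟨1, one_pos, fun p hp => by simp [h] at hp⟩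
    · obtain ⟨p, hp, hmin⟩ := hS.exists_isMinOn h hcont
      refine ⟨_, hpos p.1 hp.1 p.2 fun h0 => ?_, fun p' hp' => hmin hp'⟩
      have := hp.2
      simp [h0] at this
  refine ⟨c, hc, fun z hz v => ?_⟩
  rcases eq_or_ne v 0 with rfl | hv
  · have := hhom z hz 0 0
    simp at this
    simp [this]
  · have hv' : ‖v‖ ≠ 0 := norm_ne_zero_iff.2 hv
    have h1 := hcS (z, ‖v‖⁻¹ • v) ⟨hz, by simp [norm_smul, hv']⟩
    simp only [hhom z hz] at h1
    calc c * ‖v‖ ^ 2 ≤ (‖v‖⁻¹ ^ 2 * Φ z v) * ‖v‖ ^ 2 := by gcongr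
      _ = Φ z v := by field_simp

theorem bilin_le_of_norm_le {Φ : V →L[ℝ] V →L[ℝ] ℝ} {C : ℝ} (h : ‖Φ‖ ≤ C) (v : V) :
    Φ v v ≤ C * ‖v‖ ^ 2 := by
  refine (le_abs_self _).trans ((Φ.le_opNorm₂ v v).trans ?_)
  rw [mul_assoc, ← sq]
  gcongr

end Calculus

/-! ### Inverting definite bilinear forms. -/

section Nondegenerate

variable {V : Type*} [NormedAddCommGroup V] [NormedSpace ℝ V] [FiniteDimensional ℝ V]

/-- A form which is definite on the diagonal is an isomorphism onto the dual. -/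
theorem exists_equiv_of_definite (Γ : V →L[ℝ] V →L[ℝ] ℝ) (h : ∀ v, v ≠ 0 → 0 < Γ v v) :
    ∃ e : V ≃L[ℝ] (V →L[ℝ] ℝ), (e : V →L[ℝ] (V →L[ℝ] ℝ)) = Γ := by
  have hinj : Function.Injective (Γ : V →ₗ[ℝ] (V →L[ℝ] ℝ)) := by
    rw [← LinearMap.ker_eq_bot, LinearMap.ker_eq_bot']
    intro v hv
    by_contra hv0
    have h1 := h v hv0
    have h2 : Γ v = 0 := hv
    simp [h2] at h1
  have hdim : Module.finrank ℝ V = Module.finrank ℝ (V →L[ℝ] ℝ) := by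
    rw [← (LinearMap.toContinuousLinearMap (𝕜 := ℝ) (E := V) (F' := ℝ)).finrank_eq]
    exact Subspace.dual_finrank_eq.symm
  exact ⟨(LinearMap.linearEquivOfInjective _ hinj hdim).toContinuousLinearEquiv, by ext; rfl⟩

theorem definite_apply_inverse {Γ : V →L[ℝ] V →L[ℝ] ℝ} (h : ∀ v, v ≠ 0 → 0 < Γ v v)
    (c : V →L[ℝ] ℝ) : Γ (Γ.inverse c) = c := by
  obtain ⟨e, rfl⟩ := exists_equiv_of_definite Γ h
  simp

theorem definite_inverse_apply {Γ : V →L[ℝ] V →L[ℝ] ℝ} (h : ∀ v, v ≠ 0 → 0 < Γ v v)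
    (v : V) : Γ.inverse (Γ v) = v := by
  obtain ⟨e, rfl⟩ := exists_equiv_of_definite Γ h
  simp

/-- Inversion is smooth at every invertible map, and definiteness in finite dimension makes `Γ z`
invertible. -/
theorem contDiffOn_inverse_of_definite {F : Type*} [NormedAddCommGroup F] [NormedSpace ℝ F]
    {Γ : F → V →L[ℝ] V →L[ℝ] ℝ} {O : Set F} {m : WithTop ℕ∞} (hΓ : ContDiffOn ℝ m Γ O)
    (h : ∀ z ∈ O, ∀ v, v ≠ 0 → 0 < Γ z v v) : ContDiffOn ℝ m (fun z => (Γ z).inverse) O := by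
  intro z hz
  obtain ⟨e, he⟩ := exists_equiv_of_definite (Γ z) (h z hz)
  have : CompleteSpace V := FiniteDimensional.complete ℝ V
  have h1 := contDiffAt_map_inverse (n := m) e
  rw [he] at h1
  exact h1.comp_contDiffWithinAt z (hΓ z hz)

end Nondegenerate

/-! ### Coordinate metrics and their codifferential. -/

/-- The coordinate expression of a Riemannian metric and its density on an open subset of `ℝⁿ`:
`B` is the matrix of the metric on covectors and `ρ` the density. -/
structure LocalMetric (n : ℕ) where
  O : Set (Model n)
  isOpen : IsOpen O
  B : Model n → Matrix (Fin n) (Fin n) ℝ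
  ρ : Model n → ℝ
  contDiffOn_B : ∀ i j, ContDiffOn ℝ ∞ (fun z => B z i j) O
  posDef : ∀ z ∈ O, (B z).PosDef
  contDiffOn_ρ : ContDiffOn ℝ ∞ ρ O
  ρ_pos : ∀ z ∈ O, 0 < ρ z

namespace LocalMetric

variable {n : ℕ} (G : LocalMetric n) (q : ℕ)

/-- The metric on `q`-forms. -/
noncomputable def pair (z : Model n) : Alt n q →L[ℝ] Alt n q →L[ℝ] ℝ := covPair q (G.B z)

theorem contDiffOn_pair : ContDiffOn ℝ ∞ (G.pair q) G.O := by
  unfold pair covPair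
  refine ContDiffOn.sum fun i _ => ContDiffOn.sum fun j _ => ?_
  have h : ContDiffOn ℝ ∞ (fun z => ((q.factorial : ℝ))⁻¹ * ∏ k, G.B z (i k) (j k)) G.O :=
    contDiffOn_const.mul (contDiffOn_prod fun k _ => G.contDiffOn_B _ _)
  exact h.smul (contDiffOn_const (c := ContinuousLinearMap.smulRight (altComp i) (altComp j)))

theorem pair_pos {z : Model n} (hz : z ∈ G.O) (a : Alt n q) (ha : a ≠ 0) : 0 < G.pair q z a a :=
  covPair_self_pos (G.posDef z hz) ha

theorem pair_nonneg {z : Model n} (hz : z ∈ G.O) (a : Alt n q) : 0 ≤ G.pair q z a a :=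
  covPair_self_nonneg (G.posDef z hz) a

theorem pair_comm {z : Model n} (hz : z ∈ G.O) (a b : Alt n q) :
    G.pair q z a b = G.pair q z b a :=
  covPair_comm (G.posDef z hz) a b

/-- The coefficient of `∂ᵢ a` in `ρ ⟨da, b⟩`. -/
noncomputable def flux (i : Fin n) (z : Model n) : Alt n (q + 1) →L[ℝ] Alt n q →L[ℝ] ℝ :=
  G.ρ z • ∑ j, G.B z i j • (G.pair q z).comp (covContract q (stdVec j))

theorem contDiffOn_flux (i : Fin n) : ContDiffOn ℝ ∞ (G.flux q i) G.O := by
  unfold flux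
  refine G.contDiffOn_ρ.smul (ContDiffOn.sum fun j _ => (G.contDiffOn_B i j).smul ?_)
  exact (G.contDiffOn_pair q).clm_comp contDiffOn_const

/-- The coordinate expression of the codifferential. -/
noncomputable def codiff (b : Model n → Alt n (q + 1)) (z : Model n) : Alt n q :=
  (G.pair q z).inverse
    (-((G.ρ z)⁻¹ • ∑ i, fderiv ℝ (fun y => G.flux q i y (b y)) z (stdVec i)))

/-- The zeroth order part of the codifferential. -/
noncomputable def codiffZero (z : Model n) : Alt n (q + 1) →L[ℝ] Alt n q :=
  (G.pair q z).inverse.comp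
    (-((G.ρ z)⁻¹ • ∑ i, fderiv ℝ (G.flux q i) z (stdVec i)))

variable {q}

theorem contDiffOn_codiff {b : Model n → Alt n (q + 1)} (hb : ContDiffOn ℝ ∞ b G.O) :
    ContDiffOn ℝ ∞ (G.codiff q b) G.O := by
  unfold codiff
  refine (contDiffOn_inverse_of_definite (G.contDiffOn_pair q) fun z hz => G.pair_pos q hz).clm_apply
    (((G.contDiffOn_ρ.inv fun z hz => (G.ρ_pos z hz).ne').smul
      (ContDiffOn.sum fun i _ => ?_)).neg)
  exact (((G.contDiffOn_flux q i).clm_apply hb).fderiv_of_isOpen G.isOpen (m := ∞) le_rfl).clm_apply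
    contDiffOn_const

theorem continuousOn_codiffZero : ContinuousOn (G.codiffZero q) G.O := by
  unfold codiffZero
  have h1 := (contDiffOn_inverse_of_definite (G.contDiffOn_pair q)
    fun z hz => G.pair_pos q hz).continuousOn
  have h2 : ContinuousOn (fun z => ∑ i, fderiv ℝ (G.flux q i) z (stdVec i)) G.O :=
    continuousOn_finsetSum _ fun i _ =>
      ((G.contDiffOn_flux q i).continuousOn_fderiv_of_isOpen G.isOpen (by simp)).clm_apply
        continuousOn_const
  exact h1.clm_comp (((G.contDiffOn_ρ.continuousOn.inv₀ fun z hz => (G.ρ_pos z hz).ne').smul h2).neg)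

/-- Product rule for `flux` applied to `b`: where the derivative falls on `b`, the density and the
pairing cancel and leave the principal part `-covDiv`; where it falls on the coefficients, it gives
`codiffZero`. -/
theorem codiff_eq {b : Model n → Alt n (q + 1)} {z : Model n} (hz : z ∈ G.O)
    (hb : DifferentiableAt ℝ b z) :
    G.codiff q b z = -covDiv q (G.B z) (fderiv ℝ b z) + G.codiffZero q z (b z) := by
  have hfl : ∀ i, DifferentiableAt ℝ (G.flux q i) z := fun i =>
    ((G.contDiffOn_flux q i).contDiffAt (G.isOpen.mem_nhds hz)).differentiableAt (by simp)
  have h1 : ∀ i, fderiv ℝ (fun y => G.flux q i y (b y)) z (stdVec i) =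
      G.flux q i z (fderiv ℝ b z (stdVec i)) + (fderiv ℝ (G.flux q i) z (stdVec i)) (b z) :=
    fun i => by
      rw [((hfl i).hasFDerivAt.clm_apply hb.hasFDerivAt).fderiv]
      simp
  have h2 : ∑ i, G.flux q i z (fderiv ℝ b z (stdVec i)) =
      G.ρ z • G.pair q z (covDiv q (G.B z) (fderiv ℝ b z)) := by
    simp only [covDiv_apply, flux, map_sum, map_smul, smul_apply, sum_apply,
      ContinuousLinearMap.comp_apply, Finset.smul_sum]
  have hρ := (G.ρ_pos z hz).ne'
  unfold codiff codiffZero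
  simp only [h1, Finset.sum_add_distrib, h2, smul_add, smul_smul, inv_mul_cancel₀ hρ, one_smul,
    neg_add, map_add, map_neg, definite_inverse_apply (G.pair_pos q hz)]
  simp

/-- Integration by parts: `codiff` is adjoint to the exterior derivative. -/
theorem integral_pair_covD {a : Model n → Alt n q} {b : Model n → Alt n (q + 1)}
    {K : Set (Model n)} (hK : IsCompact K) (hKO : K ⊆ G.O) (ha : ContDiff ℝ ∞ a)
    (h0 : ∀ z ∉ K, a z = 0) (hb : ContDiffOn ℝ ∞ b G.O) :
    ∫ z, G.ρ z * G.pair (q + 1) z (covD q (fderiv ℝ a z)) (b z) =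
      ∫ z, G.ρ z * G.pair q z (a z) (G.codiff q b z) := by
  have hd0 := fderiv_eq_zero_of_zero hK h0
  have hfb : ∀ i, ContDiffOn ℝ ∞ (fun y => G.flux q i y (b y)) G.O := fun i =>
    (G.contDiffOn_flux q i).clm_apply hb
  -- Once the integrand is written through `flux`, each coordinate direction is an ordinary
  -- integration by parts, and `codiff` is by construction what results.
  have h1 : ∀ z, G.ρ z * G.pair (q + 1) z (covD q (fderiv ℝ a z)) (b z) =
      ∑ i, G.flux q i z (b z) (fderiv ℝ a z (stdVec i)) := by
    intro z
    by_cases hz : z ∈ G.O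
    · unfold pair flux
      rw [covPair_covD, Finset.mul_sum]
      simp only [smul_apply, sum_apply, ContinuousLinearMap.comp_apply, smul_eq_mul, Finset.mul_sum]
      refine Finset.sum_congr rfl fun i _ => Finset.sum_congr rfl fun j _ => ?_
      rw [G.pair_comm q hz, pair]
    · simp [hd0 z fun h => hz (hKO h)]
  have h2 : ∀ z, G.ρ z * G.pair q z (a z) (G.codiff q b z) =
      -∑ i, (fderiv ℝ (fun y => G.flux q i y (b y)) z (stdVec i)) (a z) := by
    intro z
    by_cases hz : z ∈ G.O
    · rw [G.pair_comm q hz, codiff, definite_apply_inverse (G.pair_pos q hz)]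
      have hρ := (G.ρ_pos z hz).ne'
      simp only [neg_apply, smul_apply, sum_apply, smul_eq_mul]
      field_simp
    · simp [h0 z fun h => hz (hKO h)]
  simp only [h1, h2]
  rw [integral_neg, integral_finsetSum, integral_finsetSum, ← Finset.sum_neg_distrib]
  · refine Finset.sum_congr rfl fun i _ => ?_
    exact integral_apply_fderiv G.isOpen hK hKO ((hfb i).of_le (by simp)) (ha.of_le (by simp)) h0 _
  · intro i _
    refine integrable_of_continuousOn (O := G.O) ?_ hK hKO fun z hz => by simp [h0 z hz]
    exact (((hfb i).continuousOn_fderiv_of_isOpen G.isOpen (by simp)).clm_apply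
      continuousOn_const).clm_apply ha.continuous.continuousOn
  · intro i _
    refine integrable_of_continuousOn (O := G.O) ?_ hK hKO fun z hz => by simp [hd0 z hz]
    exact (hfb i).continuousOn.clm_apply
      ((ha.continuous_fderiv (by simp)).clm_apply continuous_const).continuousOn

variable (q)

/-- The squared length of the first derivative of a `q`-form. -/
noncomputable def gradSq (z : Model n) (L : Model n →L[ℝ] Alt n q) : ℝ :=
  ∑ i, ∑ j, G.B z i j * G.pair q z (L (stdVec i)) (L (stdVec j))

theorem continuousOn_gradSq :
    ContinuousOn (fun p : Model n × (Model n →L[ℝ] Alt n q) => G.gradSq q p.1 p.2)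
      (G.O ×ˢ Set.univ) := by
  unfold gradSq
  have h1 : Set.MapsTo Prod.fst (G.O ×ˢ (Set.univ : Set (Model n →L[ℝ] Alt n q))) G.O :=
    fun p hp => hp.1
  have h2 : ∀ v, ContinuousOn (fun p : Model n × (Model n →L[ℝ] Alt n q) => p.2 v)
      (G.O ×ˢ Set.univ) := fun v => (continuous_snd.clm_apply continuous_const).continuousOn
  refine continuousOn_finsetSum _ fun i _ => continuousOn_finsetSum _ fun j _ => ?_
  exact ((G.contDiffOn_B i j).continuousOn.comp continuousOn_fst h1).mul
    ((((G.contDiffOn_pair q).continuousOn.comp continuousOn_fst h1).clm_apply (h2 _)).clm_apply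
      (h2 _))

theorem gradSq_smul (z : Model n) (r : ℝ) (L : Model n →L[ℝ] Alt n q) :
    G.gradSq q z (r • L) = r ^ 2 * G.gradSq q z L := by
  simp only [gradSq, smul_apply, map_smul, smul_eq_mul, Finset.mul_sum]
  refine Finset.sum_congr rfl fun i _ => Finset.sum_congr rfl fun j _ => ?_
  ring

/-- With `B = P Pᵀ` the quantity becomes `∑ |L (P e_m)|²`, and `P` is surjective, so it vanishes
only for `L = 0`. -/
theorem gradSq_pos {z : Model n} (hz : z ∈ G.O) (L : Model n →L[ℝ] Alt n q) (hL : L ≠ 0) :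
    0 < G.gradSq q z L := by
  obtain ⟨P, Q, hP, hPQ⟩ := exists_eq_mul_transpose (G.posDef z hz)
  have h1 : G.gradSq q z L = ∑ m, G.pair q z (L (P (stdVec m))) (L (P (stdVec m))) := by
    have hv : ∀ m, L (P (stdVec m)) = ∑ i, clmMatrix P i m • L (stdVec i) := fun m => by
      conv_lhs => rw [← sum_coord_smul_stdVec (P (stdVec m))]
      simp [clmMatrix]
    have hB : ∀ i j, G.B z i j = ∑ m, clmMatrix P i m * clmMatrix P j m := fun i j => by
      rw [hP]
      simp [Matrix.mul_apply]
    rw [gradSq]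
    simp only [hv, hB, map_sum, map_smul, sum_apply, smul_apply, smul_eq_mul, Finset.mul_sum,
      Finset.sum_mul]
    symm
    rw [Finset.sum_comm]
    conv_rhs => rw [Finset.sum_comm]
    refine Finset.sum_congr rfl fun i _ => ?_
    rw [Finset.sum_comm]
    refine Finset.sum_congr rfl fun j _ => Finset.sum_congr rfl fun m _ => ?_
    rw [G.pair_comm q hz]
    ring
  rw [h1]
  by_contra hcon
  refine hL ?_
  have h2 : ∀ m, L (P (stdVec m)) = 0 := by
    intro m
    by_contra hm
    refine hcon (Finset.sum_pos' (fun m _ => G.pair_nonneg q hz _) ⟨m, Finset.mem_univ m, ?_⟩)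
    exact G.pair_pos q hz _ hm
  have h3 : ∀ x, L (P x) = 0 := fun x => by
    rw [← sum_coord_smul_stdVec x]
    simp [h2]
  refine ContinuousLinearMap.ext fun x => ?_
  rw [← hPQ x, h3]
  rfl

end LocalMetric

theorem exists_bilin_bound {V X : Type*} [NormedAddCommGroup V] [NormedSpace ℝ V]
    [TopologicalSpace X] {Φ : X → V →L[ℝ] V →L[ℝ] ℝ} {K : Set X} (hK : IsCompact K)
    (hΦ : ContinuousOn Φ K) : ∃ C, 0 ≤ C ∧ ∀ z ∈ K, ∀ v, Φ z v v ≤ C * ‖v‖ ^ 2 := by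
  obtain ⟨C, hC⟩ := hK.exists_bound_of_continuousOn hΦ
  exact ⟨max C 0, le_max_right _ _, fun z hz v =>
    bilin_le_of_norm_le ((hC z hz).trans (le_max_left _ _)) v⟩

@[simp] theorem norm_stdVec {n : ℕ} (i : Fin n) : ‖(stdVec i : Model n)‖ = 1 := by
  simp [stdVec]

/-! ### Gårding's inequality in coordinates. -/

namespace LocalMetric

variable {n : ℕ} (G : LocalMetric n) {q : ℕ}

/-- The coefficients of the cross terms. -/
noncomputable def cross (q : ℕ) (i j k l : Fin n) (z : Model n) :
    Alt n (q + 1) →L[ℝ] Alt n (q + 1) →L[ℝ] ℝ :=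
  (G.ρ z * (G.B z i j * G.B z k l)) • (ContinuousLinearMap.precomp ℝ
    (covContract q (stdVec l))).comp ((G.pair q z).comp (covContract q (stdVec j)))

theorem cross_apply (i j k l : Fin n) (z : Model n) (a b : Alt n (q + 1)) :
    G.cross q i j k l z a b = G.ρ z * (G.B z i j * G.B z k l *
      G.pair q z (covContract q (stdVec j) a) (covContract q (stdVec l) b)) := by
  simp [cross, mul_assoc]

theorem contDiffOn_cross (i j k l : Fin n) : ContDiffOn ℝ ∞ (G.cross q i j k l) G.O := by
  unfold cross
  have h : ContDiffOn ℝ ∞ (fun z => G.ρ z * (G.B z i j * G.B z k l)) G.O :=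
    G.contDiffOn_ρ.mul ((G.contDiffOn_B i j).mul (G.contDiffOn_B k l))
  exact h.smul (contDiffOn_const.clm_comp ((G.contDiffOn_pair q).clm_comp contDiffOn_const))

theorem continuousOn_covDiv : ContinuousOn (fun z => covDiv q (G.B z)) G.O := by
  unfold covDiv
  exact continuousOn_finsetSum _ fun i _ => continuousOn_finsetSum _ fun j _ =>
    (G.contDiffOn_B i j).continuousOn.smul continuousOn_const

/-- `covPair_covD_succ` times the density, with the remainder in the antisymmetrised shape to which
`integral_cross_term` applies for the directions `i` and `k`. -/
theorem cross_identity {z : Model n} (hz : z ∈ G.O) (L : Model n →L[ℝ] Alt n (q + 1)) :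
    G.ρ z * G.pair (q + 2) z (covD (q + 1) L) (covD (q + 1) L) +
      G.ρ z * G.pair q z (covDiv q (G.B z) L) (covDiv q (G.B z) L) =
    G.ρ z * G.gradSq (q + 1) z L + ∑ i, ∑ j, ∑ k, ∑ l,
      (G.cross q i j k l z (L (stdVec i)) (L (stdVec k)) -
        G.cross q i j k l z (L (stdVec k)) (L (stdVec i))) := by
  rw [← mul_add]
  have h := covPair_covD_succ (G.posDef z hz) L
  unfold pair gradSq
  rw [h, mul_add]
  congr 1
  simp only [cross_apply, Finset.mul_sum, mul_sub]
  rfl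

theorem exists_pair_bound (q : ℕ) {K : Set (Model n)} (hK : IsCompact K) (hKO : K ⊆ G.O) :
    ∃ C, 0 ≤ C ∧ ∀ z ∈ K, ∀ a : Alt n q, G.ρ z * G.pair q z a a ≤ C * ‖a‖ ^ 2 :=
  exists_bilin_bound (Φ := fun z => G.ρ z • G.pair q z) hK
    ((G.contDiffOn_ρ.smul (G.contDiffOn_pair q)).continuousOn.mono hKO)

theorem exists_gradSq_coercive (q : ℕ) {K : Set (Model n)} (hK : IsCompact K) (hKO : K ⊆ G.O) :
    ∃ c > 0, ∀ z ∈ K, ∀ L : Model n →L[ℝ] Alt n q, c * ‖L‖ ^ 2 ≤ G.ρ z * G.gradSq q z L := by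
  refine exists_coercive_const (Φ := fun z L => G.ρ z * G.gradSq q z L) hK ?_ ?_ ?_
  · have h1 : Set.MapsTo Prod.fst (G.O ×ˢ (Set.univ : Set (Model n →L[ℝ] Alt n q))) G.O :=
      fun p hp => hp.1
    exact ((G.contDiffOn_ρ.continuousOn.comp continuousOn_fst h1).mul
      (G.continuousOn_gradSq q)).mono (Set.prod_mono hKO subset_rfl)
  · intro z _ r L
    rw [G.gradSq_smul]
    ring
  · exact fun z hz L hL => mul_pos (G.ρ_pos z (hKO hz)) (G.gradSq_pos q (hKO hz) L hL)

theorem exists_pair_coercive (q : ℕ) {K : Set (Model n)} (hK : IsCompact K) (hKO : K ⊆ G.O) :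
    ∃ c > 0, ∀ z ∈ K, ∀ a : Alt n q, c * ‖a‖ ^ 2 ≤ G.ρ z * G.pair q z a a := by
  refine exists_coercive_const (Φ := fun z a => G.ρ z * G.pair q z a a) hK ?_ ?_ ?_
  · have h1 : Set.MapsTo Prod.fst (G.O ×ˢ (Set.univ : Set (Alt n q))) G.O := fun p hp => hp.1
    exact ((G.contDiffOn_ρ.continuousOn.comp continuousOn_fst h1).mul
      ((((G.contDiffOn_pair q).continuousOn.comp continuousOn_fst h1).clm_apply
        continuousOn_snd).clm_apply continuousOn_snd)).mono (Set.prod_mono hKO subset_rfl)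
  · intro z _ r a
    simp only [map_smul, smul_apply, smul_eq_mul]
    ring
  · exact fun z hz a ha => mul_pos (G.ρ_pos z (hKO hz)) (G.pair_pos q (hKO hz) a ha)

/-- Gårding's inequality for functions. -/
theorem garding_zero {K : Set (Model n)} (hK : IsCompact K) (hKO : K ⊆ G.O) :
    ∃ C, 0 ≤ C ∧ ∀ w : Model n → Alt n 0, ContDiff ℝ ∞ w → (∀ z ∉ K, w z = 0) →
      (∫ z, ‖fderiv ℝ w z‖ ^ 2) ≤ C * ∫ z, ‖covD 0 (fderiv ℝ w z)‖ ^ 2 := by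
  obtain ⟨c, hc, hcK⟩ := G.exists_gradSq_coercive 0 hK hKO
  obtain ⟨C, hC, hCK⟩ := G.exists_pair_bound 1 hK hKO
  refine ⟨c⁻¹ * C, by positivity, fun w hw h0 => ?_⟩
  have hd0 := fderiv_eq_zero_of_zero hK h0
  have hdw : Continuous (fderiv ℝ w) := hw.continuous_fderiv (by simp)
  rw [← integral_const_mul]
  refine integral_mono ?_ ?_ fun z => ?_
  · exact integrable_of_continuousOn (O := Set.univ) (hdw.norm.pow 2).continuousOn hK
      (Set.subset_univ _) fun z hz => by simp [hd0 z hz]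
  · refine integrable_of_continuousOn (O := Set.univ) (continuous_const.mul
      (((covD 0).continuous.comp hdw).norm.pow 2)).continuousOn hK
      (Set.subset_univ _) fun z hz => by simp [hd0 z hz]
  · by_cases hz : z ∈ K
    · have h1 := hcK z hz (fderiv ℝ w z)
      have h2 := hCK z hz (covD 0 (fderiv ℝ w z))
      have h3 : G.gradSq 0 z (fderiv ℝ w z) =
          G.pair 1 z (covD 0 (fderiv ℝ w z)) (covD 0 (fderiv ℝ w z)) :=
        (covPair_covD_zero _ _).symm
      rw [h3] at h1
      have h4 := h1.trans h2
      simp only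
      rw [mul_assoc, ← div_eq_inv_mul, le_div_iff₀ hc]
      linarith
    · simp [hd0 z hz]

set_option maxHeartbeats 1000000 in
/-- Gårding's inequality for forms of positive degree. -/
theorem garding_succ (q : ℕ) {K : Set (Model n)} (hK : IsCompact K) (hKO : K ⊆ G.O) :
    ∃ C, 0 ≤ C ∧ ∀ w : Model n → Alt n (q + 1), ContDiff ℝ ∞ w → (∀ z ∉ K, w z = 0) →
      (∫ z, ‖fderiv ℝ w z‖ ^ 2) ≤ C * ((∫ z, ‖covD (q + 1) (fderiv ℝ w z)‖ ^ 2) +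
        (∫ z, ‖covDiv q (G.B z) (fderiv ℝ w z)‖ ^ 2) + (∫ z, ‖w z‖ ^ 2)) := by
  obtain ⟨c, hc, hcK⟩ := G.exists_gradSq_coercive (q + 1) hK hKO
  obtain ⟨C1, hC1, hCK1⟩ := G.exists_pair_bound (q + 2) hK hKO
  obtain ⟨C2, hC2, hCK2⟩ := G.exists_pair_bound q hK hKO
  have hM : ∀ i j k l, ∃ M, 0 ≤ M ∧ ∀ z ∈ K, ‖fderiv ℝ (G.cross q i j k l) z‖ ≤ M := by
    intro i j k l
    obtain ⟨M, hM⟩ := hK.exists_bound_of_continuousOn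
      (((G.contDiffOn_cross i j k l).continuousOn_fderiv_of_isOpen G.isOpen (by simp)).mono hKO)
    exact ⟨max M 0, le_max_right _ _, fun z hz => (hM z hz).trans (le_max_left _ _)⟩
  choose M hM0 hMK using hM
  -- Each integrated cross term consists of two terms, each containing one first derivative of a
  -- coefficient bounded by `M`.
  set N : ℝ := ∑ i, ∑ j, ∑ k, ∑ l, 2 * M i j k l with hN
  have hN0 : 0 ≤ N := Finset.sum_nonneg fun i _ => Finset.sum_nonneg fun j _ =>
    Finset.sum_nonneg fun k _ => Finset.sum_nonneg fun l _ => mul_nonneg zero_le_two (hM0 i j k l)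
  have hconst : 0 ≤ 2 / c * (C1 + C2 + N ^ 2 / (2 * c)) :=
    mul_nonneg (div_nonneg zero_le_two hc.le) (add_nonneg (add_nonneg hC1 hC2)
      (div_nonneg (sq_nonneg N) (mul_nonneg zero_le_two hc.le)))
  clear_value N
  refine ⟨2 / c * (C1 + C2 + N ^ 2 / (2 * c)), hconst, fun w hw h0 => ?_⟩
  have hd0 := fderiv_eq_zero_of_zero hK h0
  have hdw : Continuous (fderiv ℝ w) := hw.continuous_fderiv (by simp)
  have hw1 : ContDiff ℝ 1 w := hw.of_le (by simp)
  have hw2 : ContDiff ℝ 2 w := contDiff_infty.1 hw 2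
  have int_of : ∀ F : Model n → ℝ, ContinuousOn F G.O → (∀ z ∉ K, F z = 0) → Integrable F :=
    fun F hF h => integrable_of_continuousOn hF hK hKO h
  have cdw : ∀ v, ContinuousOn (fun z => fderiv ℝ w z v) G.O := fun v =>
    (hdw.clm_apply continuous_const).continuousOn
  have iX : Integrable fun z => ‖fderiv ℝ w z‖ ^ 2 :=
    int_of _ (hdw.norm.pow 2).continuousOn fun z hz => by simp [hd0 z hz]
  have iW : Integrable fun z => ‖w z‖ ^ 2 :=
    int_of _ (hw.continuous.norm.pow 2).continuousOn fun z hz => by simp [h0 z hz]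
  have iD : Integrable fun z => ‖covD (q + 1) (fderiv ℝ w z)‖ ^ 2 :=
    int_of _ (((covD (q + 1)).continuous.comp hdw).norm.pow 2).continuousOn
      fun z hz => by simp [hd0 z hz]
  have iS : Integrable fun z => ‖covDiv q (G.B z) (fderiv ℝ w z)‖ ^ 2 :=
    int_of _ ((G.continuousOn_covDiv.clm_apply hdw.continuousOn).norm.pow 2)
      fun z hz => by simp [hd0 z hz]
  have iWX : Integrable fun z => ‖w z‖ * ‖fderiv ℝ w z‖ :=
    int_of _ (hw.continuous.norm.mul hdw.norm).continuousOn fun z hz => by simp [h0 z hz]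
  have icr : ∀ i j k l, Integrable fun z =>
      (G.cross q i j k l z (fderiv ℝ w z (stdVec i)) (fderiv ℝ w z (stdVec k)) -
        G.cross q i j k l z (fderiv ℝ w z (stdVec k)) (fderiv ℝ w z (stdVec i))) :=
    fun i j k l => int_of _ ((((G.contDiffOn_cross i j k l).continuousOn.clm_apply (cdw _)).clm_apply
      (cdw _)).sub (((G.contDiffOn_cross i j k l).continuousOn.clm_apply (cdw _)).clm_apply
      (cdw _))) fun z hz => by simp [hd0 z hz]
  -- After integration by parts one factor `w` is undifferentiated, so the term is of lower order.
  have hcross : ∀ i j k l, -∫ z,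
      (G.cross q i j k l z (fderiv ℝ w z (stdVec i)) (fderiv ℝ w z (stdVec k)) -
        G.cross q i j k l z (fderiv ℝ w z (stdVec k)) (fderiv ℝ w z (stdVec i))) ≤
      2 * M i j k l * ∫ z, ‖w z‖ * ‖fderiv ℝ w z‖ := by
    intro i j k l
    rw [integral_cross_term G.isOpen hK hKO ((G.contDiffOn_cross i j k l).of_le (by simp)) hw2 h0,
      ← integral_neg, ← integral_const_mul]
    have cfd := ((G.contDiffOn_cross (q := q) i j k l).continuousOn_fderiv_of_isOpen G.isOpen
      (by simp))
    refine integral_mono (int_of _ ((((((cfd.clm_apply continuousOn_const).clm_apply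
      hw.continuous.continuousOn).clm_apply (cdw _)).sub
      (((cfd.clm_apply continuousOn_const).clm_apply
      hw.continuous.continuousOn).clm_apply (cdw _)))).neg)
      fun z hz => by simp [h0 z hz]) (iWX.const_mul _) fun z => ?_
    by_cases hz : z ∈ K
    · have hb : ∀ u v : Fin n, |(fderiv ℝ (G.cross q i j k l) z (stdVec u)) (w z)
          (fderiv ℝ w z (stdVec v))| ≤ M i j k l * (‖w z‖ * ‖fderiv ℝ w z‖) := by
        intro u v
        have h1 : ‖fderiv ℝ (G.cross q i j k l) z (stdVec u)‖ ≤ M i j k l := by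
          refine ((fderiv ℝ (G.cross q i j k l) z).le_opNorm _).trans ?_
          rw [norm_stdVec, mul_one]
          exact hMK i j k l z hz
        have h2 : ‖fderiv ℝ w z (stdVec v)‖ ≤ ‖fderiv ℝ w z‖ := by
          refine ((fderiv ℝ w z).le_opNorm _).trans ?_
          rw [norm_stdVec, mul_one]
        refine ((fderiv ℝ (G.cross q i j k l) z (stdVec u)).le_opNorm₂ _ _).trans ?_
        rw [mul_assoc]
        have := hM0 i j k l
        gcongr
      have h1 := abs_le.1 (hb k i)
      have h2 := abs_le.1 (hb i k)
      simp only
      linarith [h1.1, h2.2]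
    · simp [h0 z hz]
  have hpt : ∀ z, c * ‖fderiv ℝ w z‖ ^ 2 ≤ C1 * ‖covD (q + 1) (fderiv ℝ w z)‖ ^ 2 +
      C2 * ‖covDiv q (G.B z) (fderiv ℝ w z)‖ ^ 2 - ∑ i, ∑ j, ∑ k, ∑ l,
      (G.cross q i j k l z (fderiv ℝ w z (stdVec i)) (fderiv ℝ w z (stdVec k)) -
        G.cross q i j k l z (fderiv ℝ w z (stdVec k)) (fderiv ℝ w z (stdVec i))) := by
    intro z
    by_cases hz : z ∈ K
    · have h1 := hcK z hz (fderiv ℝ w z)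
      have h2 := hCK1 z hz (covD (q + 1) (fderiv ℝ w z))
      have h3 := hCK2 z hz (covDiv q (G.B z) (fderiv ℝ w z))
      have h4 := G.cross_identity (hKO hz) (fderiv ℝ w z)
      linarith
    · simp [hd0 z hz]
  have hint := integral_mono (iX.const_mul c) (((iD.const_mul C1).add (iS.const_mul C2)).sub
    (integrable_finsetSum _ fun i _ => integrable_finsetSum _ fun j _ =>
      integrable_finsetSum _ fun k _ => integrable_finsetSum _ fun l _ => icr i j k l)) hpt
  rw [integral_const_mul, integral_sub' ((iD.const_mul C1).add (iS.const_mul C2))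
    (integrable_finsetSum _ fun i _ => integrable_finsetSum _ fun j _ =>
      integrable_finsetSum _ fun k _ => integrable_finsetSum _ fun l _ => icr i j k l),
    integral_add' (iD.const_mul C1) (iS.const_mul C2), integral_const_mul, integral_const_mul] at hint
  have hsum : -∫ z, ∑ i, ∑ j, ∑ k, ∑ l,
      (G.cross q i j k l z (fderiv ℝ w z (stdVec i)) (fderiv ℝ w z (stdVec k)) -
        G.cross q i j k l z (fderiv ℝ w z (stdVec k)) (fderiv ℝ w z (stdVec i))) ≤
      N * ∫ z, ‖w z‖ * ‖fderiv ℝ w z‖ := by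
    rw [integral_finsetSum _ fun i _ => integrable_finsetSum _ fun j _ =>
      integrable_finsetSum _ fun k _ => integrable_finsetSum _ fun l _ => icr i j k l,
      ← Finset.sum_neg_distrib, hN, Finset.sum_mul]
    refine Finset.sum_le_sum fun i _ => ?_
    rw [integral_finsetSum _ fun j _ =>
      integrable_finsetSum _ fun k _ => integrable_finsetSum _ fun l _ => icr i j k l,
      ← Finset.sum_neg_distrib, Finset.sum_mul]
    refine Finset.sum_le_sum fun j _ => ?_
    rw [integral_finsetSum _ fun k _ => integrable_finsetSum _ fun l _ => icr i j k l,
      ← Finset.sum_neg_distrib, Finset.sum_mul]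
    refine Finset.sum_le_sum fun k _ => ?_
    rw [integral_finsetSum _ fun l _ => icr i j k l, ← Finset.sum_neg_distrib, Finset.sum_mul]
    exact Finset.sum_le_sum fun l _ => hcross i j k l
  -- Young's inequality, weighted so that exactly half of the coercive term `c ∫ ‖∇w‖²` absorbs the
  -- gradient part.
  have hyoung : N * ∫ z, ‖w z‖ * ‖fderiv ℝ w z‖ ≤
      c / 2 * (∫ z, ‖fderiv ℝ w z‖ ^ 2) + N ^ 2 / (2 * c) * (∫ z, ‖w z‖ ^ 2) := by
    rw [← integral_const_mul, ← integral_const_mul, ← integral_const_mul,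
      ← integral_add (iX.const_mul _) (iW.const_mul _)]
    refine integral_mono (iWX.const_mul _) ((iX.const_mul _).add (iW.const_mul _)) fun z => ?_
    have h1 : 0 ≤ (c * ‖fderiv ℝ w z‖ - N * ‖w z‖) ^ 2 / (2 * c) := by positivity
    have h2 : (c * ‖fderiv ℝ w z‖ - N * ‖w z‖) ^ 2 / (2 * c) = c / 2 * ‖fderiv ℝ w z‖ ^ 2 +
        N ^ 2 / (2 * c) * ‖w z‖ ^ 2 - N * (‖w z‖ * ‖fderiv ℝ w z‖) := by
      field_simp
      ring
    simp only
    linarith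
  have hfin : c / 2 * (∫ z, ‖fderiv ℝ w z‖ ^ 2) ≤ C1 * (∫ z, ‖covD (q + 1) (fderiv ℝ w z)‖ ^ 2) +
      C2 * (∫ z, ‖covDiv q (G.B z) (fderiv ℝ w z)‖ ^ 2) + N ^ 2 / (2 * c) * (∫ z, ‖w z‖ ^ 2) := by
    linarith
  have p1 : 0 ≤ (∫ z, ‖covD (q + 1) (fderiv ℝ w z)‖ ^ 2) := integral_nonneg fun z => by positivity
  have p2 : 0 ≤ (∫ z, ‖covDiv q (G.B z) (fderiv ℝ w z)‖ ^ 2) := integral_nonneg fun z => by positivity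
  have p3 : 0 ≤ (∫ z, ‖w z‖ ^ 2) := integral_nonneg fun z => by positivity
  have p4 : 0 ≤ N ^ 2 / (2 * c) := by positivity
  calc (∫ z, ‖fderiv ℝ w z‖ ^ 2) = 2 / c * (c / 2 * (∫ z, ‖fderiv ℝ w z‖ ^ 2)) := by field_simp
    _ ≤ 2 / c * ((C1 + C2 + N ^ 2 / (2 * c)) * ((∫ z, ‖covD (q + 1) (fderiv ℝ w z)‖ ^ 2) +
        (∫ z, ‖covDiv q (G.B z) (fderiv ℝ w z)‖ ^ 2) + (∫ z, ‖w z‖ ^ 2))) := by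
      refine mul_le_mul_of_nonneg_left (hfin.trans ?_) (div_nonneg zero_le_two hc.le)
      nlinarith [mul_nonneg hC1 p2, mul_nonneg hC1 p3, mul_nonneg hC2 p1, mul_nonneg hC2 p3,
        mul_nonneg p4 p1, mul_nonneg p4 p2]
    _ = _ := by ring

end LocalMetric

/-- Cauchy–Schwarz against the constant `1`: expand `0 ≤ ∫ (m f - I)²`, where `m` is the total mass
and `I` the integral of `f`, and divide by `m`. -/
theorem sq_integral_le {X : Type*} [MeasurableSpace X] {μ : Measure X} [IsFiniteMeasure μ]
    {f : X → ℝ} (hf : Integrable f μ) (hf2 : Integrable (fun x => f x ^ 2) μ) :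
    (∫ x, f x ∂μ) ^ 2 ≤ μ.real Set.univ * ∫ x, f x ^ 2 ∂μ := by
  set m := μ.real Set.univ with hm
  set I := ∫ x, f x ∂μ with hI
  have hm0 : 0 ≤ m := measureReal_nonneg
  have h1 : 0 ≤ ∫ x, (m * f x - I) ^ 2 ∂μ := integral_nonneg fun x => sq_nonneg _
  have h2 : ∫ x, (m * f x - I) ^ 2 ∂μ = m ^ 2 * (∫ x, f x ^ 2 ∂μ) - m * I ^ 2 := by
    have : ∀ x, (m * f x - I) ^ 2 = m ^ 2 * f x ^ 2 - 2 * m * I * f x + I ^ 2 := fun x => by ring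
    simp only [this]
    have hi : Integrable (fun x => m ^ 2 * f x ^ 2 - 2 * m * I * f x) μ :=
      (hf2.const_mul _).sub (hf.const_mul _)
    rw [integral_add hi (integrable_const _),
      integral_sub (hf2.const_mul _) (hf.const_mul _), integral_const_mul, integral_const_mul,
      integral_const, ← hI, ← hm, smul_eq_mul]
    ring
  rcases hm0.eq_or_lt with h0 | h0
  · have hμ : μ = 0 := by
      rw [← Measure.measure_univ_eq_zero]
      rw [eq_comm, hm, measureReal_def, ENNReal.toReal_eq_zero_iff] at h0
      exact h0.resolve_right (measure_ne_top _ _)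
    simp [hI, hμ]
  · rw [h2] at h1
    have : 0 ≤ m * (m * (∫ x, f x ^ 2 ∂μ) - I ^ 2) := by linarith
    linarith [nonneg_of_mul_nonneg_right this h0]

/-! ### Poincaré's inequality on small cubes. -/

section Poincare

variable {n : ℕ} {V : Type*} [NormedAddCommGroup V] [NormedSpace ℝ V] [CompleteSpace V]

/-- The fundamental theorem of calculus along the segment from `y` to `x`, followed by
Cauchy–Schwarz. Extended nonnegative integrals prepare for Tonelli's theorem. -/
theorem norm_sub_sq_le_integral {w : Model n → V} (hw : ContDiff ℝ 1 w) (x y : Model n) :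
    ENNReal.ofReal (‖w x - w y‖ ^ 2) ≤ ENNReal.ofReal (‖x - y‖ ^ 2) *
      ∫⁻ s in Set.Ioc (0 : ℝ) 1, ENNReal.ofReal (‖fderiv ℝ w (y + s • (x - y))‖ ^ 2) := by
  have hline : ∀ s : ℝ, HasDerivAt (fun s : ℝ => y + s • (x - y)) (x - y) s := fun s => by
    simpa using ((hasDerivAt_id s).smul_const (x - y)).const_add y
  have hd : ∀ s : ℝ, HasDerivAt (fun s : ℝ => w (y + s • (x - y)))
      (fderiv ℝ w (y + s • (x - y)) (x - y)) s := fun s =>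
    (hw.contDiffAt.differentiableAt one_ne_zero).hasFDerivAt.comp_hasDerivAt s (hline s)
  have hcl : Continuous fun s : ℝ => y + s • (x - y) := by fun_prop
  have hcf : Continuous fun s : ℝ => fderiv ℝ w (y + s • (x - y)) :=
    (hw.continuous_fderiv one_ne_zero).comp hcl
  have h1 : ∫ s in (0 : ℝ)..1, fderiv ℝ w (y + s • (x - y)) (x - y) = w x - w y := by
    rw [intervalIntegral.integral_eq_sub_of_hasDerivAt (fun s _ => hd s)
      ((hcf.clm_apply continuous_const).intervalIntegrable _ _)]
    simp
  have hi1 : IntegrableOn (fun s : ℝ => ‖fderiv ℝ w (y + s • (x - y))‖) (Set.Ioc 0 1) :=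
    (hcf.norm.integrableOn_Icc).mono_set Set.Ioc_subset_Icc_self
  have hi2 : IntegrableOn (fun s : ℝ => ‖fderiv ℝ w (y + s • (x - y))‖ ^ 2) (Set.Ioc 0 1) :=
    ((hcf.norm.pow 2).integrableOn_Icc).mono_set Set.Ioc_subset_Icc_self
  have h2 : ‖w x - w y‖ ≤ ‖x - y‖ * ∫ s in Set.Ioc (0 : ℝ) 1, ‖fderiv ℝ w (y + s • (x - y))‖ := by
    rw [← h1, intervalIntegral.integral_of_le zero_le_one, ← integral_const_mul]
    refine norm_integral_le_of_norm_le (hi1.const_mul _) (Filter.Eventually.of_forall fun s => ?_)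
    rw [mul_comm]
    exact (fderiv ℝ w (y + s • (x - y))).le_opNorm _
  have h3 := sq_integral_le hi1 hi2
  rw [measureReal_restrict_apply_univ, Real.volume_real_Ioc_of_le zero_le_one, sub_zero, one_mul] at h3
  have h4 : ‖w x - w y‖ ^ 2 ≤ ‖x - y‖ ^ 2 *
      ∫ s in Set.Ioc (0 : ℝ) 1, ‖fderiv ℝ w (y + s • (x - y))‖ ^ 2 := by
    calc ‖w x - w y‖ ^ 2 ≤ (‖x - y‖ * ∫ s in Set.Ioc (0 : ℝ) 1,
          ‖fderiv ℝ w (y + s • (x - y))‖) ^ 2 := by gcongr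
      _ = ‖x - y‖ ^ 2 * (∫ s in Set.Ioc (0 : ℝ) 1, ‖fderiv ℝ w (y + s • (x - y))‖) ^ 2 := by ring
      _ ≤ _ := by gcongr
  refine (ENNReal.ofReal_le_ofReal h4).trans ?_
  rw [ENNReal.ofReal_mul (by positivity), ofReal_integral_eq_lintegral_ofReal hi2
    (Filter.Eventually.of_forall fun s => by positivity)]

theorem lintegral_comp_add_smul {H : Model n → ENNReal} (hH : Measurable H) (c : Model n) {r : ℝ}
    (hr : r ≠ 0) :
    ∫⁻ x, H (c + r • x) = ENNReal.ofReal |(r ^ n)⁻¹| * ∫⁻ x, H x := by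
  have h1 : ∫⁻ x, H (c + r • x) = ∫⁻ u, H (c + u) ∂(Measure.map (r • ·) (volume : Measure (Model n))) :=
    (lintegral_map (hH.comp (measurable_const_add c)) (measurable_const_smul r)).symm
  rw [h1, Measure.map_addHaar_smul _ hr, lintegral_smul_measure, lintegral_add_left_eq_self]
  simp

/-- The homothety with centre `y` and ratio `r` maps the convex set into itself, and its Jacobian
costs `r⁻ⁿ ≤ 2ⁿ`. -/
theorem setLIntegral_contract_le {Q : Set (Model n)} (hQ : MeasurableSet Q) (hconv : Convex ℝ Q)
    {H : Model n → ENNReal} (hH : Measurable H) {y : Model n} (hy : y ∈ Q) {r : ℝ}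
    (hr : 1 / 2 ≤ r) (hr1 : r ≤ 1) :
    ∫⁻ x in Q, H ((1 - r) • y + r • x) ≤ 2 ^ n * ∫⁻ x in Q, H x := by
  have hr0 : 0 < r := by linarith
  calc ∫⁻ x in Q, H ((1 - r) • y + r • x)
      ≤ ∫⁻ x in Q, Q.indicator H ((1 - r) • y + r • x) := by
        refine setLIntegral_mono' hQ fun x hx => ?_
        rw [Set.indicator_of_mem (hconv hy hx (by linarith) hr0.le (by ring))]
    _ ≤ ∫⁻ x, Q.indicator H ((1 - r) • y + r • x) := setLIntegral_le_lintegral _ _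
    _ = ENNReal.ofReal |(r ^ n)⁻¹| * ∫⁻ x, Q.indicator H x :=
        lintegral_comp_add_smul (hH.indicator hQ) _ hr0.ne'
    _ ≤ 2 ^ n * ∫⁻ x in Q, H x := by
        rw [lintegral_indicator hQ]
        gcongr
        have h2 : |(r ^ n)⁻¹| ≤ 2 ^ n := by
          rw [abs_of_pos (by positivity), ← inv_pow]
          gcongr
          rw [inv_le_comm₀ hr0 two_pos]
          linarith
        calc ENNReal.ofReal |(r ^ n)⁻¹| ≤ ENNReal.ofReal (2 ^ n) := ENNReal.ofReal_le_ofReal h2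
          _ = 2 ^ n := by rw [ENNReal.ofReal_pow zero_le_two]; simp

/-- One of `s` and `1 - s` is at least `1/2`. Integrating first in the variable with that
coefficient keeps the Jacobian bounded uniformly in `s`. -/
theorem double_lintegral_le {Q : Set (Model n)} (hQ : MeasurableSet Q) (hconv : Convex ℝ Q)
    {H : Model n → ENNReal} (hH : Measurable H) {s : ℝ} (hs : s ∈ Set.Ioc (0 : ℝ) 1) :
    ∫⁻ x in Q, ∫⁻ y in Q, H (y + s • (x - y)) ≤ 2 ^ n * (∫⁻ x in Q, H x) * volume Q := by
  have hbound : ∀ F : Model n → ENNReal, (∀ x ∈ Q, F x ≤ 2 ^ n * ∫⁻ x in Q, H x) →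
      ∫⁻ x in Q, F x ≤ 2 ^ n * (∫⁻ x in Q, H x) * volume Q := fun F hF =>
    (setLIntegral_mono' hQ hF).trans (by rw [setLIntegral_const])
  rcases le_total s (1 / 2) with h | h
  · refine hbound _ fun x hx => ?_
    have := setLIntegral_contract_le hQ hconv hH hx (r := 1 - s) (by linarith) (by linarith [hs.1])
    refine le_trans (le_of_eq ?_) this
    refine lintegral_congr fun y => ?_
    congr 1
    module
  · have hmeas : Measurable (Function.uncurry fun x y : Model n => H (y + s • (x - y))) := by
      refine hH.comp ?_
      fun_prop
    rw [lintegral_lintegral_swap hmeas.aemeasurable]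
    refine hbound _ fun y hy => ?_
    have := setLIntegral_contract_le hQ hconv hH hy (r := s) h hs.2
    refine le_trans (le_of_eq ?_) this
    refine lintegral_congr fun x => ?_
    congr 1
    module

/-- Poincaré's inequality on a bounded convex set. -/
theorem poincare_convex {Q : Set (Model n)} (hQ : MeasurableSet Q) (hconv : Convex ℝ Q)
    (hfin : volume Q ≠ ⊤) {D : ℝ} (hD : ∀ x ∈ Q, ∀ y ∈ Q, ‖x - y‖ ≤ D)
    {w : Model n → V} (hw : ContDiff ℝ 1 w) (hwb : ∃ C, ∀ x, ‖w x‖ ≤ C) (h0 : ∫ x in Q, w x = 0) :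
    ∫⁻ x in Q, ENNReal.ofReal (‖w x‖ ^ 2) ≤
      ENNReal.ofReal (D ^ 2) * 2 ^ n * ∫⁻ x in Q, ENNReal.ofReal (‖fderiv ℝ w x‖ ^ 2) := by
  rcases eq_or_ne (volume Q) 0 with hQ0 | hQ0
  · rw [Measure.restrict_eq_zero.2 hQ0]
    simp
  have hfinite : IsFiniteMeasure (volume.restrict Q) := ⟨by
    rw [Measure.restrict_apply_univ]; exact hfin.lt_top⟩
  obtain ⟨C, hC⟩ := hwb
  have hm : 0 < (volume Q).toReal := ENNReal.toReal_pos hQ0 hfin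
  have hint : IntegrableOn w Q := by
    refine Integrable.of_bound hw.continuous.aestronglyMeasurable C
      (Filter.Eventually.of_forall hC)
  have hbdd : ∀ x y, ‖w x - w y‖ ≤ 2 * C := fun x y =>
    (norm_sub_le _ _).trans (by linarith [hC x, hC y])
  have hi1 : ∀ x, IntegrableOn (fun y => ‖w x - w y‖) Q := fun x => by
    refine Integrable.of_bound (continuous_const.sub hw.continuous).norm.aestronglyMeasurable (2 * C)
      (Filter.Eventually.of_forall fun y => by simpa using hbdd x y)
  have hi2 : ∀ x, IntegrableOn (fun y => ‖w x - w y‖ ^ 2) Q := fun x => by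
    refine Integrable.of_bound
      ((continuous_const.sub hw.continuous).norm.pow 2).aestronglyMeasurable ((2 * C) ^ 2)
      (Filter.Eventually.of_forall fun y => ?_)
    rw [Real.norm_of_nonneg (by positivity)]
    gcongr
    exact hbdd x y
  -- Vanishing mean gives `|Q| w(x) = ∫ (w(x) - w(y)) dy`; Cauchy–Schwarz and division by `|Q|` do
  -- the rest.
  have hx : ∀ x, volume Q * ENNReal.ofReal (‖w x‖ ^ 2) ≤
      ∫⁻ y in Q, ENNReal.ofReal (‖w x - w y‖ ^ 2) := by
    intro x
    have h1 : (volume Q).toReal • w x = ∫ y in Q, (w x - w y) := by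
      rw [integral_sub (integrable_const _) hint, h0, sub_zero, setIntegral_const]
      rfl
    have h2 : ((volume Q).toReal * ‖w x‖) ^ 2 ≤
        (volume Q).toReal * ∫ y in Q, ‖w x - w y‖ ^ 2 := by
      have h3 := sq_integral_le (hi1 x) (hi2 x)
      rw [measureReal_restrict_apply_univ] at h3
      refine le_trans ?_ h3
      gcongr
      calc (volume Q).toReal * ‖w x‖ = ‖(volume Q).toReal • w x‖ := by
            rw [norm_smul, Real.norm_of_nonneg hm.le]
        _ ≤ _ := by rw [h1]; exact norm_integral_le_integral_norm _
    have h4 : (volume Q).toReal * ‖w x‖ ^ 2 ≤ ∫ y in Q, ‖w x - w y‖ ^ 2 := by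
      have : (volume Q).toReal * ((volume Q).toReal * ‖w x‖ ^ 2) ≤
        (volume Q).toReal * ∫ y in Q, ‖w x - w y‖ ^ 2 := by linarith
      exact le_of_mul_le_mul_left this hm
    have h5 := ENNReal.ofReal_le_ofReal h4
    rw [ENNReal.ofReal_mul hm.le, ENNReal.ofReal_toReal hfin,
      ofReal_integral_eq_lintegral_ofReal (hi2 x)
      (Filter.Eventually.of_forall fun y => by positivity)] at h5
    exact h5
  have hG : Measurable fun z => ENNReal.ofReal (‖fderiv ℝ w z‖ ^ 2) :=
    ((hw.continuous_fderiv one_ne_zero).norm.pow 2).measurable.ennreal_ofReal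
  -- Integrate over `x`, bound the difference along the segment by `D` and the gradient, and make
  -- the segment parameter the outermost variable. The bound of `double_lintegral_le` carries a
  -- factor `|Q|` that cancels at the end.
  have hmain : volume Q * ∫⁻ x in Q, ENNReal.ofReal (‖w x‖ ^ 2) ≤
      volume Q * (ENNReal.ofReal (D ^ 2) * 2 ^ n *
        ∫⁻ x in Q, ENNReal.ofReal (‖fderiv ℝ w x‖ ^ 2)) := by
    calc volume Q * ∫⁻ x in Q, ENNReal.ofReal (‖w x‖ ^ 2)
        = ∫⁻ x in Q, volume Q * ENNReal.ofReal (‖w x‖ ^ 2) :=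
          (lintegral_const_mul' _ _ hfin).symm
      _ ≤ ∫⁻ x in Q, ∫⁻ y in Q, ENNReal.ofReal (‖w x - w y‖ ^ 2) := lintegral_mono hx
      _ ≤ ∫⁻ x in Q, ∫⁻ y in Q, ENNReal.ofReal (D ^ 2) * ∫⁻ s in Set.Ioc (0 : ℝ) 1,
            ENNReal.ofReal (‖fderiv ℝ w (y + s • (x - y))‖ ^ 2) := by
          refine setLIntegral_mono' hQ fun x hx => setLIntegral_mono' hQ fun y hy => ?_
          refine (norm_sub_sq_le_integral hw x y).trans ?_
          gcongr
          exact hD x hx y hy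
      _ = ENNReal.ofReal (D ^ 2) * ∫⁻ s in Set.Ioc (0 : ℝ) 1, ∫⁻ x in Q, ∫⁻ y in Q,
            ENNReal.ofReal (‖fderiv ℝ w (y + s • (x - y))‖ ^ 2) := by
          have hm3 : Measurable fun p : (Model n × Model n) × ℝ =>
              ENNReal.ofReal (‖fderiv ℝ w (p.1.2 + p.2 • (p.1.1 - p.1.2))‖ ^ 2) :=
            hG.comp (by fun_prop)
          have e1 : ∀ x, ∫⁻ y in Q, ENNReal.ofReal (D ^ 2) * ∫⁻ s in Set.Ioc (0 : ℝ) 1,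
              ENNReal.ofReal (‖fderiv ℝ w (y + s • (x - y))‖ ^ 2) =
              ENNReal.ofReal (D ^ 2) * ∫⁻ s in Set.Ioc (0 : ℝ) 1, ∫⁻ y in Q,
              ENNReal.ofReal (‖fderiv ℝ w (y + s • (x - y))‖ ^ 2) := fun x => by
            rw [lintegral_const_mul' _ _ ENNReal.ofReal_ne_top, lintegral_lintegral_swap]
            exact (hm3.comp (by fun_prop : Measurable fun q : Model n × ℝ => ((x, q.1), q.2))).aemeasurable
          simp only [e1]
          rw [lintegral_const_mul' _ _ ENNReal.ofReal_ne_top, lintegral_lintegral_swap]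
          have hm4 : Measurable fun p : (Model n × ℝ) × Model n =>
              ENNReal.ofReal (‖fderiv ℝ w (p.2 + p.1.2 • (p.1.1 - p.2))‖ ^ 2) :=
            hG.comp (by fun_prop)
          exact (hm4.lintegral_prod_right' (ν := volume.restrict Q)).aemeasurable
      _ ≤ ENNReal.ofReal (D ^ 2) * ∫⁻ s in Set.Ioc (0 : ℝ) 1,
            2 ^ n * (∫⁻ x in Q, ENNReal.ofReal (‖fderiv ℝ w x‖ ^ 2)) * volume Q := by
          refine mul_le_mul' le_rfl ?_
          exact setLIntegral_mono' measurableSet_Ioc fun s hs => double_lintegral_le hQ hconv hG hs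
      _ = _ := by
          rw [setLIntegral_const, Real.volume_Ioc]
          simp only [sub_zero, ENNReal.ofReal_one, mul_one]
          ring
  exact (ENNReal.mul_le_mul_iff_right hQ0 hfin).1 hmain

/-- The cubes of a grid. -/
def gridCube (n : ℕ) (δ : ℝ) (k : Fin n → ℤ) : Set (Model n) := {z | ∀ i, ⌊z i / δ⌋ = k i}

theorem measurableSet_gridCube (δ : ℝ) (k : Fin n → ℤ) : MeasurableSet (gridCube n δ k) := by
  have : gridCube n δ k = ⋂ i, {z : Model n | ⌊z i / δ⌋ = k i} := by
    ext; simp [gridCube]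
  rw [this]
  refine MeasurableSet.iInter fun i => ?_
  have h : Measurable fun z : Model n => ⌊z i / δ⌋ := by
    refine Int.measurable_floor.comp ?_
    fun_prop
  exact h (measurableSet_singleton (k i))

theorem convex_gridCube {δ : ℝ} (hδ : 0 < δ) (k : Fin n → ℤ) : Convex ℝ (gridCube n δ k) := by
  intro x hx y hy a b ha hb hab i
  have h1 := Int.floor_eq_iff.1 (hx i)
  have h2 := Int.floor_eq_iff.1 (hy i)
  rw [Int.floor_eq_iff]
  rw [le_div_iff₀ hδ, div_lt_iff₀ hδ] at *
  simp only [PiLp.add_apply, PiLp.smul_apply, smul_eq_mul]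
  obtain rfl : b = 1 - a := by linarith
  constructor
  · nlinarith [h1.1, h2.1]
  · rcases ha.eq_or_lt with rfl | ha
    · simpa using h2.2
    · nlinarith [h1.2, h2.2, mul_lt_mul_of_pos_left h1.2 ha, mul_le_mul_of_nonneg_left h2.2.le hb]

theorem norm_sub_le_gridCube {δ : ℝ} (hδ : 0 < δ) {k : Fin n → ℤ} {x y : Model n}
    (hx : x ∈ gridCube n δ k) (hy : y ∈ gridCube n δ k) : ‖x - y‖ ≤ √n * δ := by
  rw [EuclideanSpace.norm_eq]
  have h : ∀ i, ‖(x - y) i‖ ^ 2 ≤ δ ^ 2 := fun i => by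
    have h1 := Int.floor_eq_iff.1 (hx i)
    have h2 := Int.floor_eq_iff.1 (hy i)
    rw [le_div_iff₀ hδ, div_lt_iff₀ hδ] at *
    rw [Real.norm_eq_abs]
    have : |(x - y) i| ≤ δ := by
      rw [abs_le, PiLp.sub_apply]
      constructor <;> nlinarith [h1.1, h1.2, h2.1, h2.2]
    gcongr
  calc √(∑ i, ‖(x - y) i‖ ^ 2) ≤ √(∑ _i : Fin n, δ ^ 2) := Real.sqrt_le_sqrt (Finset.sum_le_sum fun i _ => h i)
    _ = √n * δ := by
      rw [Finset.sum_const, Finset.card_univ, Fintype.card_fin, nsmul_eq_mul,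
        Real.sqrt_mul (Nat.cast_nonneg n), Real.sqrt_sq hδ.le]

theorem exists_finset_gridCube {δ : ℝ} (hδ : 0 < δ) {K : Set (Model n)} (hK : IsCompact K) :
    ∃ S : Finset (Fin n → ℤ), K ⊆ ⋃ k ∈ S, gridCube n δ k := by
  obtain ⟨R, hR⟩ := hK.isBounded.exists_norm_le
  refine ⟨Fintype.piFinset fun _ => Finset.Icc ⌊-R / δ⌋ ⌊R / δ⌋, fun z hz => ?_⟩
  simp only [Set.mem_iUnion]
  refine ⟨fun i => ⌊z i / δ⌋, ?_, fun i => rfl⟩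
  rw [Fintype.mem_piFinset]
  intro i
  have h := abs_le.1 ((PiLp.norm_apply_le z i).trans (hR z hz))
  rw [Finset.mem_Icc]
  exact ⟨Int.floor_le_floor (by gcongr; exact h.1), Int.floor_le_floor (by gcongr; exact h.2)⟩

/-- Functions supported in a compact set with vanishing means over finitely many suitable cubes
satisfy a Poincaré inequality with small constant. -/
theorem exists_poincare_cubes {K : Set (Model n)} (hK : IsCompact K) {ε : ℝ} (hε : 0 < ε) :
    ∃ (δ : ℝ) (S : Finset (Fin n → ℤ)), ∀ w : Model n → V, ContDiff ℝ 1 w → (∀ z ∉ K, w z = 0) →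
      (∀ k ∈ S, ∫ z in gridCube n δ k, w z = 0) →
      ∫ z, ‖w z‖ ^ 2 ≤ ε * ∫ z, ‖fderiv ℝ w z‖ ^ 2 := by
  -- This is the constant of `poincare_convex` for a cube of side `δ`, whose diameter is at most `√n
  -- δ`.
  obtain ⟨δ, hδ, hδε⟩ : ∃ δ : ℝ, 0 < δ ∧ (√n * δ) ^ 2 * 2 ^ n ≤ ε := by
    have hlim : Filter.Tendsto (fun δ : ℝ => (√n * δ) ^ 2 * 2 ^ n) (𝓝[>] 0) (𝓝 0) := by
      have : Continuous fun δ : ℝ => (√n * δ) ^ 2 * 2 ^ n := by fun_prop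
      have h := (this.tendsto 0).mono_left (nhdsWithin_le_nhds (s := Set.Ioi 0))
      simpa using h
    obtain ⟨δ, h1, h2⟩ := ((hlim.eventually (Iio_mem_nhds hε)).and self_mem_nhdsWithin).exists
    exact ⟨δ, h2, (Set.mem_Iio.1 h1).le⟩
  -- Cubes may stick out of `K`: `w` is defined and smooth on all of `ℝⁿ` and zero outside `K`, so
  -- nothing is lost by summing over whole cubes.
  obtain ⟨S, hS⟩ := exists_finset_gridCube hδ hK
  refine ⟨δ, S, fun w hw h0 hmean => ?_⟩
  have hwc : Continuous w := hw.continuous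
  have hd0 := fderiv_eq_zero_of_zero hK h0
  have hdw := hw.continuous_fderiv one_ne_zero
  have iW : Integrable fun z => ‖w z‖ ^ 2 := integrable_of_continuousOn (O := Set.univ)
    (hwc.norm.pow 2).continuousOn hK (Set.subset_univ _) fun z hz => by simp [h0 z hz]
  have iX : Integrable fun z => ‖fderiv ℝ w z‖ ^ 2 := integrable_of_continuousOn (O := Set.univ)
    (hdw.norm.pow 2).continuousOn hK (Set.subset_univ _) fun z hz => by simp [hd0 z hz]
  have hbd : ∃ C, ∀ x, ‖w x‖ ≤ C := by
    obtain ⟨C, hC⟩ := hK.exists_bound_of_continuousOn hwc.continuousOn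
    refine ⟨max C 0, fun x => ?_⟩
    by_cases hx : x ∈ K
    · exact (hC x hx).trans (le_max_left _ _)
    · simp [h0 x hx]
  have hpair : Set.PairwiseDisjoint (S : Set (Fin n → ℤ)) (gridCube n δ) := by
    intro k _ l _ hkl
    refine Set.disjoint_left.2 fun z hz hz' => hkl (funext fun i => ?_)
    rw [← hz i, hz' i]
  have hfin : ∀ k, volume (gridCube n δ k) ≠ ⊤ := fun k => by
    have : Bornology.IsBounded (gridCube n δ k) := by
      rw [Metric.isBounded_iff]
      exact ⟨√n * δ, fun x hx y hy => by rw [dist_eq_norm]; exact norm_sub_le_gridCube hδ hx hy⟩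
    exact this.measure_lt_top.ne
  have key : ENNReal.ofReal (∫ z, ‖w z‖ ^ 2) ≤
      ENNReal.ofReal (ε * ∫ z, ‖fderiv ℝ w z‖ ^ 2) := by
    rw [ENNReal.ofReal_mul hε.le, ofReal_integral_eq_lintegral_ofReal iW
      (Filter.Eventually.of_forall fun z => by positivity), ofReal_integral_eq_lintegral_ofReal iX
      (Filter.Eventually.of_forall fun z => by positivity)]
    calc ∫⁻ z, ENNReal.ofReal (‖w z‖ ^ 2)
        = ∫⁻ z in ⋃ k ∈ S, gridCube n δ k, ENNReal.ofReal (‖w z‖ ^ 2) := by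
          rw [← lintegral_indicator (S.measurableSet_biUnion fun k _ => measurableSet_gridCube δ k)]
          refine lintegral_congr fun z => ?_
          by_cases hz : z ∈ ⋃ k ∈ S, gridCube n δ k
          · rw [Set.indicator_of_mem hz]
          · rw [Set.indicator_of_notMem hz, h0 z fun h => hz (hS h)]
            simp
      _ = ∑ k ∈ S, ∫⁻ z in gridCube n δ k, ENNReal.ofReal (‖w z‖ ^ 2) :=
          lintegral_biUnion_finset hpair (fun k _ => measurableSet_gridCube δ k) _
      _ ≤ ∑ k ∈ S, ENNReal.ofReal ε *
            ∫⁻ z in gridCube n δ k, ENNReal.ofReal (‖fderiv ℝ w z‖ ^ 2) := by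
          refine Finset.sum_le_sum fun k hk => ?_
          refine (poincare_convex (measurableSet_gridCube δ k) (convex_gridCube hδ k) (hfin k)
            (fun x hx y hy => norm_sub_le_gridCube hδ hx hy) hw hbd (hmean k hk)).trans ?_
          gcongr
          calc ENNReal.ofReal ((√n * δ) ^ 2) * 2 ^ n
              = ENNReal.ofReal ((√n * δ) ^ 2 * 2 ^ n) := by
                rw [ENNReal.ofReal_mul (by positivity), ENNReal.ofReal_pow zero_le_two]
                simp
            _ ≤ _ := ENNReal.ofReal_le_ofReal hδε
      _ = ENNReal.ofReal ε * ∫⁻ z in ⋃ k ∈ S, gridCube n δ k,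
            ENNReal.ofReal (‖fderiv ℝ w z‖ ^ 2) := by
          rw [lintegral_biUnion_finset hpair (fun k _ => measurableSet_gridCube δ k),
            Finset.mul_sum]
      _ ≤ _ := by
          gcongr
          exact Measure.restrict_le_self
  exact (ENNReal.ofReal_le_ofReal_iff
    (mul_nonneg hε.le (integral_nonneg fun z => by positivity))).1 key

end Poincare

/-! ### Transition maps and the metric in charts. -/

section ChartGeometry

variable {n : ℕ} {M : Type*} [TopologicalSpace M] [ChartedSpace (Model n) M]

/-- The transition map from the chart at `x₀` to the chart at `y`. -/
noncomputable def transition (x₀ y : M) : Model n → Model n :=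
  extChartAt (𝓡 n) y ∘ (extChartAt (𝓡 n) x₀).symm

/-- The domain of the transition map from the chart at `x₀` to the chart at `y`. -/
def overlap (x₀ y : M) : Set (Model n) :=
  (extChartAt (𝓡 n) x₀).target ∩ (extChartAt (𝓡 n) x₀).symm ⁻¹' (extChartAt (𝓡 n) y).source

theorem isOpen_overlap (x₀ y : M) : IsOpen (overlap x₀ y : Set (Model n)) :=
  (continuousOn_extChartAt_symm x₀).isOpen_inter_preimage (isOpen_extChartAt_target x₀)
    (isOpen_extChartAt_source y)

theorem transition_mem_overlap {x₀ y : M} {z : Model n} (hz : z ∈ overlap x₀ y) :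
    transition x₀ y z ∈ (overlap y x₀ : Set (Model n)) :=
  ⟨(extChartAt (𝓡 n) y).map_source hz.2, by
    change (extChartAt (𝓡 n) y).symm (extChartAt (𝓡 n) y ((extChartAt (𝓡 n) x₀).symm z)) ∈
      (extChartAt (𝓡 n) x₀).source
    rw [(extChartAt (𝓡 n) y).left_inv hz.2]
    exact (extChartAt (𝓡 n) x₀).map_target hz.1⟩

theorem transition_transition {x₀ y : M} {z : Model n} (hz : z ∈ overlap x₀ y) :
    transition y x₀ (transition x₀ y z) = z := by
  simp only [transition, Function.comp_apply, (extChartAt (𝓡 n) y).left_inv hz.2,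
    (extChartAt (𝓡 n) x₀).right_inv hz.1]

theorem symm_transition {x₀ y : M} {z : Model n} (hz : z ∈ overlap x₀ y) :
    (extChartAt (𝓡 n) y).symm (transition x₀ y z) = (extChartAt (𝓡 n) x₀).symm z :=
  (extChartAt (𝓡 n) y).left_inv hz.2

variable [IsManifold (𝓡 n) ∞ M]

theorem contDiffOn_transition (x₀ y : M) :
    ContDiffOn ℝ ∞ (transition x₀ y : Model n → Model n) (overlap x₀ y) := by
  refine contMDiffOn_iff_contDiffOn.1 ?_
  exact (contMDiffOn_extChartAt (n := ∞) (x := y)).comp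
    ((contMDiffOn_extChartAt_symm (n := ∞) x₀).mono Set.inter_subset_left)
    fun z hz => by simpa using hz.2

theorem differentiableAt_transition {x₀ y : M} {z : Model n} (hz : z ∈ overlap x₀ y) :
    DifferentiableAt ℝ (transition x₀ y : Model n → Model n) z :=
  ((contDiffOn_transition x₀ y).contDiffAt ((isOpen_overlap x₀ y).mem_nhds hz)).differentiableAt
    (by simp)

theorem chartInvDeriv_eq {x₀ y : M} {z : Model n} (hz : z ∈ overlap x₀ y) :
    (chartInvDeriv x₀ z : Model n →L[ℝ] Model n) =
      (chartInvDeriv y (transition x₀ y z) : Model n →L[ℝ] Model n).comp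
        (fderiv ℝ (transition x₀ y) z) := by
  have hd : MDifferentiableAt 𝓘(ℝ, Model n) 𝓘(ℝ, Model n)
      (extChartAt (𝓡 n) y ∘ (extChartAt (𝓡 n) x₀).symm) z :=
    (chart_mdiff hz.2).comp z (inv_mdiff hz.1)
  have h1 := mfderiv_comp z (f := extChartAt (𝓡 n) y ∘ (extChartAt (𝓡 n) x₀).symm)
    (g := (extChartAt (𝓡 n) y).symm) (inv_mdiff ((extChartAt (𝓡 n) y).map_source hz.2)) hd
  rw [mfderiv_eq_fderiv] at h1
  refine Eq.trans ?_ h1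
  refine Filter.EventuallyEq.mfderiv_eq ?_
  filter_upwards [(isOpen_overlap x₀ y).mem_nhds hz] with w hw
  exact ((extChartAt (𝓡 n) y).left_inv hw.2).symm

theorem mfderiv_chartInvDeriv {x₀ : M} {z : Model n} (hz : z ∈ (extChartAt (𝓡 n) x₀).target)
    (v : Model n) : mfderiv (𝓡 n) 𝓘(ℝ, Model n) (extChartAt (𝓡 n) x₀)
      ((extChartAt (𝓡 n) x₀).symm z) (chartInvDeriv x₀ z v) = v := by
  have h1 := mfderiv_comp z (f := (extChartAt (𝓡 n) x₀).symm) (g := extChartAt (𝓡 n) x₀)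
    (chart_mdiff ((extChartAt (𝓡 n) x₀).map_target hz)) (inv_mdiff hz)
  have h2 : mfderiv 𝓘(ℝ, Model n) 𝓘(ℝ, Model n)
      (extChartAt (𝓡 n) x₀ ∘ (extChartAt (𝓡 n) x₀).symm) z = ContinuousLinearMap.id ℝ _ := by
    rw [← mfderiv_id (I := 𝓘(ℝ, Model n)) (x := z)]
    refine Filter.EventuallyEq.mfderiv_eq ?_
    filter_upwards [(isOpen_extChartAt_target x₀).mem_nhds hz] with w hw
    exact (extChartAt (𝓡 n) x₀).right_inv hw
  exact (congrArg (fun A : Model n →L[ℝ] Model n => A v) (h1.symm.trans h2))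

theorem chartInvDeriv_injective {x₀ : M} {z : Model n} (hz : z ∈ (extChartAt (𝓡 n) x₀).target) :
    Function.Injective (chartInvDeriv x₀ z) := fun v w h =>
  (mfderiv_chartInvDeriv hz v).symm.trans ((congrArg _ h).trans (mfderiv_chartInvDeriv hz w))

/-- The Gram matrix of the images of the standard basis vectors in the tangent space at `p`. -/
noncomputable def gramAt (g : Metric n M) (p : M) (J : Model n →L[ℝ] TangentSpace (𝓡 n) p) :
    Matrix (Fin n) (Fin n) ℝ :=
  Matrix.of fun i j => g.inner p (J (stdVec i)) (J (stdVec j))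

theorem gramAt_comp (g : Metric n M) (p : M) (J : Model n →L[ℝ] TangentSpace (𝓡 n) p)
    (P : Model n →L[ℝ] Model n) :
    gramAt g p (J.comp P) = (clmMatrix P).transpose * gramAt g p J * clmMatrix P := by
  ext i j
  have h : ∀ i, J (P (stdVec i)) = ∑ k, clmMatrix P k i • J (stdVec k) := fun i => by
    conv_lhs => rw [← sum_coord_smul_stdVec (P (stdVec i)), map_sum]
    exact Finset.sum_congr rfl fun k _ => map_smul _ _ _
  simp only [gramAt, Matrix.of_apply, ContinuousLinearMap.comp_apply, h, Matrix.mul_apply,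
    Matrix.transpose_apply, map_sum, map_smul, sum_apply,
    smul_apply, smul_eq_mul, Finset.sum_mul, Finset.mul_sum]
  exact Finset.sum_congr rfl fun k _ => Finset.sum_congr rfl fun l _ => by ring

theorem gramAt_posDef (g : Metric n M) (p : M) {J : Model n →L[ℝ] TangentSpace (𝓡 n) p}
    (hJ : Function.Injective J) : (gramAt g p J).PosDef := by
  refine Matrix.PosDef.of_dotProduct_mulVec_pos ?_ fun x hx => ?_
  · ext i j
    simpa [gramAt] using g.symm p _ _
  · set v : Model n := WithLp.toLp 2 x with hv
    have hJv : J v = ∑ i, x i • J (stdVec i) := by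
      conv_lhs => rw [← sum_coord_smul_stdVec v, map_sum]
      exact Finset.sum_congr rfl fun k _ => map_smul _ _ _
    have hne : J v ≠ 0 := fun h => hx (by
      have h0 : v = 0 := hJ (h.trans (map_zero J).symm)
      funext i
      exact congrArg (fun u : Model n => u i) h0)
    have hpos := g.pos p _ hne
    rw [hJv] at hpos
    refine lt_of_lt_of_eq hpos ?_
    simp only [map_sum, map_smul, sum_apply, smul_apply, smul_eq_mul, dotProduct, Matrix.mulVec,
      gramAt, Matrix.of_apply, Finset.mul_sum, star_trivial]
    rw [Finset.sum_comm]
    exact Finset.sum_congr rfl fun k _ => Finset.sum_congr rfl fun l _ => by ring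

theorem gram_posDef (g : Metric n M) {x₀ : M} {z : Model n}
    (hz : z ∈ (extChartAt (𝓡 n) x₀).target) : (gram g x₀ z).PosDef :=
  gramAt_posDef g _ (chartInvDeriv_injective hz)

theorem gram_eq (g : Metric n M) {x₀ y : M} {z : Model n} (hz : z ∈ overlap x₀ y) :
    gram g x₀ z = (clmMatrix (fderiv ℝ (transition x₀ y) z)).transpose *
      gram g y (transition x₀ y z) * clmMatrix (fderiv ℝ (transition x₀ y) z) := by
  -- The two base points are equal only propositionally, which a rewrite inside dependent tangent
  -- spaces cannot use; with a free `p` the equality is eliminated.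
  have h : ∀ p : M, p = (extChartAt (𝓡 n) x₀).symm z → ∀ A B : Model n →L[ℝ] Model n, A = B →
      gramAt g ((extChartAt (𝓡 n) x₀).symm z) A = gramAt g p B := by
    rintro p rfl A B rfl; rfl
  rw [show gram g y (transition x₀ y z) = gramAt g _ (chartInvDeriv y (transition x₀ y z)) from rfl,
    ← gramAt_comp]
  exact h _ (symm_transition hz) _ _ (chartInvDeriv_eq hz)

/-- The Gram matrix changes by `Pᵀ · P` and pulling back forms acts on the cometric by `P · Pᵀ`,
with `P` the Jacobian of the transition map, so the two changes cancel. -/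
theorem altInner_gram_eq (g : Metric n M) {x₀ y : M} {z : Model n} (hz : z ∈ overlap x₀ y) {q : ℕ}
    (α β : ∀ x : M, TangentSpace (𝓡 n) x [⋀^Fin q]→L[ℝ] ℝ) :
    altInner (gram g x₀ z)⁻¹ (inChart α x₀ z) (inChart β x₀ z) =
      altInner (gram g y (transition x₀ y z))⁻¹ (inChart α y (transition x₀ y z))
        (inChart β y (transition x₀ y z)) := by
  rw [inChart_eq α hz.1 hz.2, inChart_eq β hz.1 hz.2]
  refine (altInner_comp _ _ _ _).trans ?_
  congr 1
  have hG := gram_eq g hz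
  set P := clmMatrix (fderiv ℝ (transition x₀ y) z) with hP
  -- A singular Jacobian would make the positive determinant of the Gram matrix vanish.
  have hdet : IsUnit P.det := by
    refine isUnit_iff_ne_zero.2 fun h0 => ?_
    have := (gram_posDef g hz.1).det_pos
    rw [hG, Matrix.det_mul, h0, mul_zero] at this
    exact lt_irrefl _ this
  have hdet' : IsUnit P.transpose.det := by rwa [Matrix.det_transpose]
  change P * (gram g x₀ z)⁻¹ * P.transpose = _
  rw [hG, Matrix.mul_inv_rev, Matrix.mul_inv_rev, ← mul_assoc, Matrix.mul_nonsing_inv _ hdet,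
    one_mul, mul_assoc, Matrix.nonsing_inv_mul _ hdet', mul_one]

/-- Frees the pointwise inner product from the chart at the point itself, so that one fixed chart
serves a whole neighbourhood. -/
theorem formInner_eq (g : Metric n M) {q : ℕ}
    (α β : ∀ x : M, TangentSpace (𝓡 n) x [⋀^Fin q]→L[ℝ] ℝ) {x₀ x : M}
    (hx : x ∈ (extChartAt (𝓡 n) x₀).source) :
    formInner g α β x = altInner (gram g x₀ (extChartAt (𝓡 n) x₀ x))⁻¹
      (inChart α x₀ (extChartAt (𝓡 n) x₀ x)) (inChart β x₀ (extChartAt (𝓡 n) x₀ x)) := by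
  have hz : extChartAt (𝓡 n) x x ∈ (overlap x x₀ : Set (Model n)) :=
    ⟨mem_extChartAt_target x, by simpa [extChartAt_to_inv] using hx⟩
  have h := altInner_gram_eq g hz α β
  have ht : transition x x₀ (extChartAt (𝓡 n) x x) = extChartAt (𝓡 n) x₀ x := by
    simp only [transition, Function.comp_apply, extChartAt_to_inv]
  rw [ht] at h
  exact h

/-- The coordinate vector fields are smooth into the tangent bundle, being the tangent map of the
inverse chart applied to constant fields; the smooth metric is then evaluated on them. -/
theorem contDiffOn_gram (g : Metric n M) (x₀ : M) (i j : Fin n) :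
    ContDiffOn ℝ ∞ (fun z => gram g x₀ z i j) (extChartAt (𝓡 n) x₀).target := by
  have hV : ∀ i : Fin n, ContMDiffOn 𝓘(ℝ, Model n) ((𝓡 n).prod 𝓘(ℝ, Model n)) ∞
      (fun z => (⟨(extChartAt (𝓡 n) x₀).symm z, chartInvDeriv x₀ z (stdVec i)⟩ :
        TangentBundle (𝓡 n) M)) (extChartAt (𝓡 n) x₀).target := by
    intro i
    have h1 := (contMDiffOn_extChartAt_symm (I := 𝓡 n) (n := ∞) x₀).contMDiffOn_tangentMapWithin
      (m := ∞) le_rfl (isOpen_extChartAt_target x₀).uniqueMDiffOn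
    have h2 : ContMDiffOn 𝓘(ℝ, Model n) (𝓘(ℝ, Model n).prod 𝓘(ℝ, Model n)) ∞
        (fun z => (⟨z, stdVec i⟩ : TangentBundle 𝓘(ℝ, Model n) (Model n)))
        (extChartAt (𝓡 n) x₀).target :=
      contMDiffOn_vectorSpace_iff_contDiffOn.2 contDiffOn_const
    refine (h1.comp h2 fun z hz => hz).congr fun z hz => ?_
    simp only [Function.comp_apply, tangentMapWithin]
    congr 1
    rw [mfderivWithin_of_isOpen (isOpen_extChartAt_target x₀) hz]
    rfl
  refine contMDiffOn_iff_contDiffOn.1 fun z hz => ?_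
  have : ContMDiffWithinAt 𝓘(ℝ, Model n) ((𝓡 n).prod 𝓘(ℝ)) ∞
      (fun z => Bundle.TotalSpace.mk' ℝ (E := Bundle.Trivial M ℝ) ((extChartAt (𝓡 n) x₀).symm z)
        (g.inner ((extChartAt (𝓡 n) x₀).symm z) (chartInvDeriv x₀ z (stdVec i))
          (chartInvDeriv x₀ z (stdVec j)))) (extChartAt (𝓡 n) x₀).target z := by
    apply ContMDiffWithinAt.clm_bundle_apply₂ (F₁ := Model n) (F₂ := Model n)
    · exact ContMDiffAt.comp_contMDiffWithinAt z g.contMDiff.contMDiffAt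
        (contMDiffOn_extChartAt_symm (n := ∞) x₀ z hz)
    · exact hV i z hz
    · exact hV j z hz
  rw [Bundle.contMDiffWithinAt_totalSpace] at this
  exact this.2

theorem contDiffOn_det {F ι : Type*} [NormedAddCommGroup F] [NormedSpace ℝ F] [Fintype ι]
    [DecidableEq ι] {s : Set F} {A : F → Matrix ι ι ℝ}
    (hA : ∀ i j, ContDiffOn ℝ ∞ (fun z => A z i j) s) :
    ContDiffOn ℝ ∞ (fun z => (A z).det) s := by
  simp only [Matrix.det_apply]
  refine ContDiffOn.sum fun σ _ => ?_
  exact (contDiffOn_prod fun i _ => hA _ _).const_smul _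

/-- Cramer's rule: the entries of the inverse are cofactors divided by the determinant. -/
theorem contDiffOn_inv {F ι : Type*} [NormedAddCommGroup F] [NormedSpace ℝ F] [Fintype ι]
    [DecidableEq ι] {s : Set F} {A : F → Matrix ι ι ℝ}
    (hA : ∀ i j, ContDiffOn ℝ ∞ (fun z => A z i j) s) (h0 : ∀ z ∈ s, (A z).det ≠ 0) (i j : ι) :
    ContDiffOn ℝ ∞ (fun z => (A z)⁻¹ i j) s := by
  simp only [Matrix.inv_def, Ring.inverse_eq_inv', Matrix.smul_apply, Matrix.adjugate_apply,
    smul_eq_mul]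
  refine ((contDiffOn_det hA).inv h0).mul (contDiffOn_det fun k l => ?_)
  simp only [Matrix.updateRow_apply]
  split_ifs
  · exact contDiffOn_const
  · exact hA k l

/-- The metric in the chart at `x₀`. -/
noncomputable def chartMetric (g : Metric n M) (x₀ : M) : LocalMetric n where
  O := (extChartAt (𝓡 n) x₀).target
  isOpen := isOpen_extChartAt_target x₀
  B z := (gram g x₀ z)⁻¹
  ρ z := Real.sqrt (gram g x₀ z).det
  contDiffOn_B := contDiffOn_inv (contDiffOn_gram g x₀) fun _ hz => (gram_posDef g hz).det_pos.ne'
  posDef _ hz := (gram_posDef g hz).inv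
  contDiffOn_ρ := (contDiffOn_det (contDiffOn_gram g x₀)).sqrt
    fun _ hz => (gram_posDef g hz).det_pos.ne'
  ρ_pos _ hz := Real.sqrt_pos.2 (gram_posDef g hz).det_pos

end ChartGeometry

/-! ### Gluing compatible measures. -/

section Gluing

variable {X ι : Type*} [MeasurableSpace X]

/-- Induction on the cover: keep the measure already built on the part covered so far, and use the
measure of the new index on the rest. -/
theorem exists_measure_eq_of_compatible (μ : ι → Measure X) (U : ι → Set X)
    (hU : ∀ i, MeasurableSet (U i))
    (hμ : ∀ i j, ∀ S ⊆ U i ∩ U j, MeasurableSet S → μ i S = μ j S) (t : Finset ι) :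
    ∃ ν : Measure X, ∀ i, ∀ S ⊆ U i ∩ ⋃ j ∈ t, U j, MeasurableSet S → ν S = μ i S := by
  classical
  induction t using Finset.induction_on with
  | empty =>
    refine ⟨0, fun i S hS _ => ?_⟩
    have : S = ∅ := by simpa using hS
    simp [this]
  | insert j t _ ih =>
    obtain ⟨ν, hν⟩ := ih
    set T := ⋃ j ∈ t, U j with hT
    have hTm : MeasurableSet T := t.measurableSet_biUnion fun i _ => hU i
    refine ⟨ν.restrict T + (μ j).restrict Tᶜ, fun i S hS hSm => ?_⟩
    rw [Measure.add_apply, Measure.restrict_apply hSm, Measure.restrict_apply hSm,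
      hν i (S ∩ T) (fun x hx => ⟨(hS hx.1).1, hx.2⟩) (hSm.inter hTm),
      hμ j i (S ∩ Tᶜ) (fun x hx => ⟨?_, (hS hx.1).1⟩) (hSm.inter hTm.compl)]
    · exact measure_inter_add_sdiff S hTm
    · have h := (hS hx.1).2
      rw [Finset.set_biUnion_insert] at h
      exact h.resolve_right hx.2

/-- Every `μ j` is concentrated on `U j`, where it equals the glued measure, so the glued measure
dominates the supremum; on subsets of `U i` it coincides with `μ i`. -/
theorem iSup_measure_apply_of_compatible (μ : ι → Measure X) (U : ι → Set X)
    (hU : ∀ i, MeasurableSet (U i)) (hc : ∀ i, μ i (U i)ᶜ = 0)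
    (hμ : ∀ i j, ∀ S ⊆ U i ∩ U j, MeasurableSet S → μ i S = μ j S) {t : Finset ι}
    (ht : ⋃ j ∈ t, U j = Set.univ) (i : ι) {S : Set X} (hS : S ⊆ U i) (hSm : MeasurableSet S) :
    (⨆ j, μ j) S = μ i S := by
  obtain ⟨ν, hν⟩ := exists_measure_eq_of_compatible μ U hU hμ t
  rw [ht] at hν
  simp only [Set.inter_univ] at hν
  refine le_antisymm ?_ (le_iSup μ i S)
  rw [← hν i S hS hSm]
  refine iSup_le (fun j => Measure.le_iff.2 fun R hR => ?_) S
  calc μ j R = μ j (R ∩ U j) := (measure_inter_conull (hc j)).symm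
    _ = ν (R ∩ U j) := (hν j _ Set.inter_subset_right (hR.inter (hU j))).symm
    _ ≤ ν R := measure_mono Set.inter_subset_left

end Gluing

/-! ### The Riemannian measure. -/

section Volume

variable {n : ℕ} {M : Type*} [TopologicalSpace M] [ChartedSpace (Model n) M]

theorem measurableSet_target (x₀ : M) : MeasurableSet (extChartAt (𝓡 n) x₀).target :=
  (isOpen_extChartAt_target x₀).measurableSet

variable [IsManifold (𝓡 n) ∞ M]

theorem det_clmMatrix (P : Model n →L[ℝ] Model n) : (clmMatrix P).det = P.det := by
  rw [ContinuousLinearMap.det, ← LinearMap.det_toMatrix (EuclideanSpace.basisFun (Fin n) ℝ).toBasis]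
  congr 1

theorem chartMetric_ρ_eq (g : Metric n M) {x₀ y : M} {z : Model n} (hz : z ∈ overlap x₀ y) :
    (chartMetric g x₀).ρ z = |(fderiv ℝ (transition x₀ y) z).det| *
      (chartMetric g y).ρ (transition x₀ y z) := by
  simp only [chartMetric, gram_eq g hz, Matrix.det_mul, Matrix.det_transpose, det_clmMatrix]
  rw [mul_right_comm, ← sq, Real.sqrt_mul (sq_nonneg _), Real.sqrt_sq_eq_abs]

variable [MeasurableSpace M] [BorelSpace M]

theorem aemeasurable_symm (g : Metric n M) (x₀ : M) :
    AEMeasurable (extChartAt (𝓡 n) x₀).symm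
      ((volume.restrict (extChartAt (𝓡 n) x₀).target).withDensity
        fun z => ENNReal.ofReal (Real.sqrt (gram g x₀ z).det)) :=
  ((continuousOn_extChartAt_symm x₀).aemeasurable (measurableSet_target x₀)).mono_ac
    (withDensity_absolutelyContinuous _ _)

theorem chartVolume_apply (g : Metric n M) (x₀ : M) {S : Set M} (hS : MeasurableSet S) :
    chartVolume g x₀ S =
      ∫⁻ z in (extChartAt (𝓡 n) x₀).target ∩ (extChartAt (𝓡 n) x₀).symm ⁻¹' S,
        ENNReal.ofReal ((chartMetric g x₀).ρ z) := by
  rw [chartVolume, Measure.map_apply_of_aemeasurable (aemeasurable_symm g x₀) hS,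
    withDensity_apply', Measure.restrict_restrict' (measurableSet_target x₀), Set.inter_comm]
  rfl

theorem chartVolume_compl_source (g : Metric n M) (x₀ : M) :
    chartVolume g x₀ (extChartAt (𝓡 n) x₀).sourceᶜ = 0 := by
  rw [chartVolume_apply g x₀ (isOpen_extChartAt_source x₀).measurableSet.compl]
  convert lintegral_zero_measure _
  rw [Measure.restrict_eq_zero]
  convert measure_empty (μ := (volume : Measure (Model n)))
  ext z
  simp only [Set.mem_inter_iff, Set.mem_preimage, Set.mem_compl_iff, Set.mem_empty_iff_false,
    iff_false, not_and, not_not]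
  exact (extChartAt (𝓡 n) x₀).map_target

/-- Change of variables along the transition map: the factor `|det|` is exactly the one by which
`√(det g_{ij})` transforms. -/
theorem chartVolume_compatible (g : Metric n M) (x₀ y : M) {S : Set M}
    (hS : S ⊆ (extChartAt (𝓡 n) x₀).source ∩ (extChartAt (𝓡 n) y).source)
    (hSm : MeasurableSet S) : chartVolume g x₀ S = chartVolume g y S := by
  rw [chartVolume_apply g x₀ hSm, chartVolume_apply g y hSm]
  set A := (extChartAt (𝓡 n) x₀).target ∩ (extChartAt (𝓡 n) x₀).symm ⁻¹' S with hA
  have hsub : ∀ z ∈ A, z ∈ (overlap x₀ y : Set (Model n)) := fun z hz => ⟨hz.1, (hS hz.2).2⟩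
  -- The inverse chart is continuous only on its target, so measurability is obtained on the subtype
  -- and transported.
  have hAm : MeasurableSet A := by
    have h1 := (continuousOn_iff_continuous_domRestrict.1
      (continuousOn_extChartAt_symm (I := 𝓡 n) x₀)).measurable
    convert (measurableSet_target x₀).subtype_image (h1 hSm)
    ext z
    simp [hA, and_comm]
  have himage : transition x₀ y '' A =
      (extChartAt (𝓡 n) y).target ∩ (extChartAt (𝓡 n) y).symm ⁻¹' S := by
    ext w
    constructor
    · rintro ⟨z, hz, rfl⟩
      refine ⟨(transition_mem_overlap (hsub z hz)).1, ?_⟩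
      rw [Set.mem_preimage, symm_transition (hsub z hz)]
      exact hz.2
    · rintro ⟨hw, hw'⟩
      have hwo : w ∈ (overlap y x₀ : Set (Model n)) := ⟨hw, (hS hw').1⟩
      refine ⟨transition y x₀ w, ⟨(transition_mem_overlap hwo).1, ?_⟩, transition_transition hwo⟩
      rw [Set.mem_preimage, symm_transition hwo]
      exact hw'
  have hinj : Set.InjOn (transition x₀ y) A := fun z hz w hw h => by
    rw [← transition_transition (hsub z hz), h, transition_transition (hsub w hw)]
  rw [← himage, lintegral_image_eq_lintegral_abs_det_fderiv_mul volume hAm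
    (fun z hz => (differentiableAt_transition (hsub z hz)).hasFDerivAt.hasFDerivWithinAt) hinj]
  refine setLIntegral_congr_fun hAm fun z hz => ?_
  rw [chartMetric_ρ_eq g (hsub z hz), ENNReal.ofReal_mul (abs_nonneg _)]

variable [CompactSpace M]

theorem riemVolume_apply (g : Metric n M) (x₀ : M) {S : Set M}
    (hS : S ⊆ (extChartAt (𝓡 n) x₀).source) (hSm : MeasurableSet S) :
    riemVolume g S = chartVolume g x₀ S := by
  obtain ⟨t, -, ht⟩ := (isCompact_univ : IsCompact (Set.univ : Set M)).elim_nhds_subcover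
    (fun x => (extChartAt (𝓡 n) x).source) fun x _ => extChartAt_source_mem_nhds x
  exact iSup_measure_apply_of_compatible (chartVolume g) (fun x => (extChartAt (𝓡 n) x).source)
    (fun x => (isOpen_extChartAt_source x).measurableSet) (chartVolume_compl_source g)
    (fun i j S hS hSm => chartVolume_compatible g i j hS hSm) (Set.univ_subset_iff.1 ht) x₀ hS hSm

theorem riemVolume_restrict (g : Metric n M) (x₀ : M) :
    (riemVolume g).restrict (extChartAt (𝓡 n) x₀).source = chartVolume g x₀ := by
  have hm := (isOpen_extChartAt_source (I := 𝓡 n) x₀).measurableSet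
  ext S hS
  rw [Measure.restrict_apply hS, riemVolume_apply g x₀ Set.inter_subset_right (hS.inter hm)]
  exact measure_inter_conull (chartVolume_compl_source g x₀)

/-- The density is bounded on a closed coordinate ball, so the measure is locally finite, and `M` is
compact. -/
instance isFiniteMeasure_riemVolume (g : Metric n M) : IsFiniteMeasure (riemVolume g) := by
  have : IsLocallyFiniteMeasure (riemVolume g) := by
    refine ⟨fun x => ?_⟩
    obtain ⟨r, hr, hball⟩ := Metric.nhds_basis_closedBall.mem_iff.1
      (extChartAt_target_mem_nhds (I := 𝓡 n) x)
    set W : Set M := (extChartAt (𝓡 n) x).source ∩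
      extChartAt (𝓡 n) x ⁻¹' Metric.ball (extChartAt (𝓡 n) x x) r with hW
    have hWo : IsOpen W := (continuousOn_extChartAt x).isOpen_inter_preimage
      (isOpen_extChartAt_source x) Metric.isOpen_ball
    refine ⟨W, hWo.mem_nhds ⟨mem_extChartAt_source x, Metric.mem_ball_self hr⟩, ?_⟩
    rw [riemVolume_apply g x Set.inter_subset_left hWo.measurableSet,
      chartVolume_apply g x hWo.measurableSet]
    refine lt_of_le_of_lt (lintegral_mono_set (t := Metric.closedBall (extChartAt (𝓡 n) x x) r)
      fun z hz => Metric.ball_subset_closedBall ?_) ?_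
    · have h := hz.2.2
      rwa [Set.mem_preimage, (extChartAt (𝓡 n) x).right_inv hz.1] at h
    · have hc : ContinuousOn (chartMetric g x).ρ (Metric.closedBall (extChartAt (𝓡 n) x x) r) :=
        (chartMetric g x).contDiffOn_ρ.continuousOn.mono hball
      exact ((hc.integrableOn_compact (isCompact_closedBall _ _)).lintegral_lt_top)
  infer_instance

theorem integral_riemVolume (g : Metric n M) (x₀ : M) {F : M → ℝ} (hF : Continuous F)
    (h0 : ∀ x ∉ (extChartAt (𝓡 n) x₀).source, F x = 0) :
    ∫ x, F x ∂(riemVolume g) = ∫ z in (extChartAt (𝓡 n) x₀).target,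
      (chartMetric g x₀).ρ z * F ((extChartAt (𝓡 n) x₀).symm z) := by
  rw [← setIntegral_eq_integral_of_forall_compl_eq_zero h0, riemVolume_restrict, chartVolume,
    integral_map (aemeasurable_symm g x₀) hF.aestronglyMeasurable,
    integral_withDensity_eq_integral_toReal_smul₀ ?_ (by simp)]
  · refine setIntegral_congr_fun (measurableSet_target x₀) fun z hz => ?_
    simp only [smul_eq_mul]
    rw [ENNReal.toReal_ofReal (Real.sqrt_nonneg _)]
    rfl
  · exact ((chartMetric g x₀).contDiffOn_ρ.continuousOn.aemeasurable
      (measurableSet_target x₀)).ennreal_ofReal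

/-- The density is strictly positive in every chart. Definiteness of the `L²` product on smooth
forms depends on this. -/
instance isOpenPosMeasure_riemVolume (g : Metric n M) : (riemVolume g).IsOpenPosMeasure := by
  refine ⟨fun U hU ⟨x, hx⟩ h0 => ?_⟩
  have hV : IsOpen (U ∩ (extChartAt (𝓡 n) x).source) := hU.inter (isOpen_extChartAt_source x)
  have h1 : riemVolume g (U ∩ (extChartAt (𝓡 n) x).source) = 0 :=
    measure_mono_null Set.inter_subset_left h0
  rw [riemVolume_apply g x Set.inter_subset_right hV.measurableSet,
    chartVolume_apply g x hV.measurableSet] at h1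
  set A := (extChartAt (𝓡 n) x).target ∩
    (extChartAt (𝓡 n) x).symm ⁻¹' (U ∩ (extChartAt (𝓡 n) x).source) with hA
  have hAo : IsOpen A := (continuousOn_extChartAt_symm x).isOpen_inter_preimage
    (isOpen_extChartAt_target x) hV
  have hAne : A.Nonempty := ⟨extChartAt (𝓡 n) x x, mem_extChartAt_target x, by
    simpa [extChartAt_to_inv] using hx⟩
  have hρ : AEMeasurable (fun z => ENNReal.ofReal ((chartMetric g x).ρ z)) (volume.restrict A) :=
    (((chartMetric g x).contDiffOn_ρ.continuousOn.mono Set.inter_subset_left).aemeasurable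
      hAo.measurableSet).ennreal_ofReal
  rw [lintegral_eq_zero_iff' hρ] at h1
  have h2 := (ae_restrict_iff' hAo.measurableSet).1 h1
  refine (hAo.measure_pos volume hAne).ne' ?_
  refine measure_mono_null (fun z hz => ?_) h2
  simp only [Set.mem_compl_iff, Set.mem_ofPred_eq, not_forall]
  refine ⟨hz, ?_⟩
  simpa using (chartMetric g x).ρ_pos z hz.1

end Volume

/-! ### Cutoffs and extension by zero in `ℝⁿ`. -/

section Cutoff

variable {n : ℕ} {V : Type*}

theorem indicator_eq_zero_of_notMem [Zero V] {O K : Set (Model n)} {a : Model n → V}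
    (h0 : ∀ z ∈ O, z ∉ K → a z = 0) {z : Model n} (hz : z ∉ K) : O.indicator a z = 0 := by
  by_cases h : z ∈ O
  · rw [Set.indicator_of_mem h, h0 z h hz]
  · exact Set.indicator_of_notMem h _

variable [NormedAddCommGroup V] [NormedSpace ℝ V]

theorem contDiff_indicator {O K : Set (Model n)} (hO : IsOpen O) (hK : IsCompact K) (hKO : K ⊆ O)
    {a : Model n → V} (ha : ContDiffOn ℝ ∞ a O) (h0 : ∀ z ∈ O, z ∉ K → a z = 0) :
    ContDiff ℝ ∞ (O.indicator a) := by
  refine contDiff_iff_contDiffAt.2 fun z => ?_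
  by_cases hz : z ∈ O
  · refine (ha.contDiffAt (hO.mem_nhds hz)).congr_of_eventuallyEq ?_
    filter_upwards [hO.mem_nhds hz] with w hw using Set.indicator_of_mem hw _
  · refine (contDiffAt_const (c := (0 : V))).congr_of_eventuallyEq ?_
    filter_upwards [hK.isClosed.isOpen_compl.mem_nhds fun h => hz (hKO h)] with w hw
    exact indicator_eq_zero_of_notMem h0 hw

theorem exists_cutoff {O K : Set (Model n)} (hO : IsOpen O) (hK : IsCompact K) (hKO : K ⊆ O) :
    ∃ ψ : Model n → ℝ, ContDiff ℝ ∞ ψ ∧ (∀ᶠ z in 𝓝ˢ K, ψ z = 1) ∧ (∀ z, 0 ≤ ψ z) ∧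
      ∃ K' ⊆ O, IsCompact K' ∧ ∀ z ∉ K', ψ z = 0 := by
  obtain ⟨K', hK', hKK', hK'O⟩ := exists_compact_between hK hO hKO
  obtain ⟨ψ, h1, h2, h3⟩ := exists_contMDiffMap_one_nhds_of_subset_interior (n := ⊤)
    𝓘(ℝ, Model n) hK.isClosed hKK'
  exact ⟨ψ, contMDiff_iff_contDiff.1 ψ.contMDiff, h1, fun z => (h3 z).1, K', hK'O, hK', h2⟩

theorem LocalMetric.codiff_eq_zero (G : LocalMetric n) (q : ℕ) {K : Set (Model n)}
    (hK : IsCompact K) {b : Model n → Alt n (q + 1)} (h0 : ∀ z ∉ K, b z = 0) {z : Model n}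
    (hz : z ∉ K) : G.codiff q b z = 0 := by
  have hf : ∀ i, fderiv ℝ (fun y => G.flux q i y (b y)) z = 0 := fun i =>
    fderiv_eq_zero_of_zero hK (fun w hw => by rw [h0 w hw, map_zero]) z hz
  simp [LocalMetric.codiff, hf]

/-- Here `b` carries the compact support and `a` lives only on the chart. Replacing `a` by `ψ a`
with `ψ = 1` near the support of `b` changes neither integrand. -/
theorem LocalMetric.integral_pair_covD_right (G : LocalMetric n) (q : ℕ) {a : Model n → Alt n q}
    {b : Model n → Alt n (q + 1)} {K : Set (Model n)} (hK : IsCompact K) (hKO : K ⊆ G.O)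
    (ha : ContDiffOn ℝ ∞ a G.O) (hb : ContDiff ℝ ∞ b) (h0 : ∀ z ∉ K, b z = 0) :
    ∫ z, G.ρ z * G.pair (q + 1) z (covD q (fderiv ℝ a z)) (b z) =
      ∫ z, G.ρ z * G.pair q z (a z) (G.codiff q b z) := by
  obtain ⟨ψ, hψ, h1, -, K', hK'O, hK', hψ0⟩ := exists_cutoff G.isOpen hK hKO
  have hsm : ContDiffOn ℝ ∞ (fun z => ψ z • a z) G.O := hψ.contDiffOn.smul ha
  have hz0 : ∀ z ∈ G.O, z ∉ K' → ψ z • a z = 0 := fun z _ hz => by rw [hψ0 z hz, zero_smul]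
  have h := G.integral_pair_covD hK' hK'O (contDiff_indicator G.isOpen hK' hK'O hsm hz0)
    (fun z => indicator_eq_zero_of_notMem hz0) hb.contDiffOn
  have hev : ∀ z ∈ K, G.O.indicator (fun z => ψ z • a z) =ᶠ[𝓝 z] a := fun z hz => by
    filter_upwards [Filter.Eventually.filter_mono (nhds_le_nhdsSet hz) h1,
      G.isOpen.mem_nhds (hKO hz)] with w hw hwO
    rw [Set.indicator_of_mem hwO, hw, one_smul]
  convert h using 1
  · refine integral_congr_ae (Filter.Eventually.of_forall fun z => ?_)
    by_cases hz : z ∈ K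
    · simp only [(hev z hz).fderiv_eq]
    · simp only [h0 z hz, map_zero, mul_zero]
  · refine integral_congr_ae (Filter.Eventually.of_forall fun z => ?_)
    by_cases hz : z ∈ K
    · simp only [(hev z hz).eq_of_nhds]
    · simp only [G.codiff_eq_zero q hK h0 hz, map_zero, mul_zero]

end Cutoff

/-! ### Smooth forms in charts. -/

section Forms

variable {n q : ℕ} {M : Type*} [TopologicalSpace M] [ChartedSpace (Model n) M]

/-- The expression of a form in the chart at `x₀`. -/
noncomputable def Form.chart (x₀ : M) : Form n M q →ₗ[ℝ] (Model n → Alt n q) where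
  toFun α := inChart α.1 x₀
  map_add' _ _ := rfl
  map_smul' _ _ := rfl

theorem Form.contDiffOn_chart (x₀ : M) (α : Form n M q) :
    ContDiffOn ℝ ∞ (Form.chart x₀ α) (extChartAt (𝓡 n) x₀).target := α.2 x₀

/-- The form `α` vanishes outside `C`. -/
def Form.SuppIn (α : Form n M q) (C : Set M) : Prop := ∀ x ∉ C, α.1 x = 0

theorem Form.chart_eq_zero {x₀ : M} {α : Form n M q} {C : Set M} (h : α.SuppIn C) {z : Model n}
    (hz : (extChartAt (𝓡 n) x₀).symm z ∉ C) : Form.chart x₀ α z = 0 := by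
  change (α.1 ((extChartAt (𝓡 n) x₀).symm z)).compContinuousLinearMap (chartInvDeriv x₀ z) = 0
  rw [h _ hz]
  rfl

/-- The expression of a form in the chart at `x₀`, extended by zero to the whole of `ℝⁿ`. -/
noncomputable def Form.rep (x₀ : M) : Form n M q →ₗ[ℝ] (Model n → Alt n q) where
  toFun α := (extChartAt (𝓡 n) x₀).target.indicator (Form.chart x₀ α)
  map_add' α β := by rw [map_add]; exact Set.indicator_add _ _ _
  map_smul' c α := by rw [map_smul]; exact Set.indicator_const_smul _ c (Form.chart x₀ α)

theorem Form.rep_apply {x₀ : M} (α : Form n M q) {z : Model n}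
    (hz : z ∈ (extChartAt (𝓡 n) x₀).target) : Form.rep x₀ α z = Form.chart x₀ α z :=
  Set.indicator_of_mem hz _

theorem isCompact_chart_image {x₀ : M} {C : Set M} (hC : IsCompact C)
    (hCs : C ⊆ (extChartAt (𝓡 n) x₀).source) : IsCompact (extChartAt (𝓡 n) x₀ '' C) :=
  hC.image_of_continuousOn ((continuousOn_extChartAt x₀).mono hCs)

theorem chart_image_subset {x₀ : M} {C : Set M} (hCs : C ⊆ (extChartAt (𝓡 n) x₀).source) :
    extChartAt (𝓡 n) x₀ '' C ⊆ (extChartAt (𝓡 n) x₀).target := by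
  rintro _ ⟨x, hx, rfl⟩
  exact (extChartAt (𝓡 n) x₀).map_source (hCs hx)

theorem Form.chart_eq_zero_of_notMem {x₀ : M} {α : Form n M q} {C : Set M} (h : α.SuppIn C)
    (z : Model n) (hz : z ∈ (extChartAt (𝓡 n) x₀).target) (hzC : z ∉ extChartAt (𝓡 n) x₀ '' C) :
    Form.chart x₀ α z = 0 :=
  Form.chart_eq_zero h fun hC => hzC ⟨_, hC, (extChartAt (𝓡 n) x₀).right_inv hz⟩

theorem Form.rep_eq_zero {x₀ : M} {α : Form n M q} {C : Set M} (h : α.SuppIn C)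
    (z : Model n) (hzC : z ∉ extChartAt (𝓡 n) x₀ '' C) : Form.rep x₀ α z = 0 :=
  indicator_eq_zero_of_notMem (Form.chart_eq_zero_of_notMem h) hzC

open Classical in
/-- The section of `Λ^q T^*M` that is `a` in the chart at `x₀` and zero outside of the chart. -/
noncomputable def extendByZero (x₀ : M) (a : Model n → Alt n q) :
    ∀ x : M, TangentSpace (𝓡 n) x [⋀^Fin q]→L[ℝ] ℝ := fun x =>
  if x ∈ (extChartAt (𝓡 n) x₀).source then (a (extChartAt (𝓡 n) x₀ x)).compContinuousLinearMap
    (mfderiv (𝓡 n) 𝓘(ℝ, Model n) (extChartAt (𝓡 n) x₀) x) else 0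

theorem inChart_extendByZero_eq_zero (x₀ : M) {a : Model n → Alt n q} {K : Set (Model n)}
    (h0 : ∀ z ∈ (extChartAt (𝓡 n) x₀).target, z ∉ K → a z = 0) {y : M} {z : Model n}
    (hz : (extChartAt (𝓡 n) y).symm z ∉ (extChartAt (𝓡 n) x₀).symm '' K) :
    inChart (extendByZero x₀ a) y z = 0 := by
  have : extendByZero x₀ a ((extChartAt (𝓡 n) y).symm z) = 0 := by
    unfold extendByZero
    split_ifs with h
    · rw [h0 _ ((extChartAt (𝓡 n) x₀).map_source h)
        fun hK => hz ⟨_, hK, (extChartAt (𝓡 n) x₀).left_inv h⟩]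
      rfl
    · rfl
  unfold inChart
  rw [this]
  rfl

theorem Form.contDiff_rep {x₀ : M} {α : Form n M q} {C : Set M} (hC : IsCompact C)
    (hCs : C ⊆ (extChartAt (𝓡 n) x₀).source) (h : α.SuppIn C) : ContDiff ℝ ∞ (Form.rep x₀ α) :=
  contDiff_indicator (isOpen_extChartAt_target x₀) (isCompact_chart_image hC hCs)
    (chart_image_subset hCs) (Form.contDiffOn_chart x₀ α) (Form.chart_eq_zero_of_notMem h)

variable [IsManifold (𝓡 n) ∞ M]

/-- The derivative of the inverse chart is injective, hence surjective by equality of dimensions, so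
coordinate vectors exhaust the tangent space. -/
theorem eq_zero_of_inChart_eq_zero {α : ∀ x : M, TangentSpace (𝓡 n) x [⋀^Fin q]→L[ℝ] ℝ} {x₀ x : M}
    (hx : x ∈ (extChartAt (𝓡 n) x₀).source) (h : inChart α x₀ (extChartAt (𝓡 n) x₀ x) = 0) :
    α x = 0 := by
  have key : ∀ p : M, p = x → α p = 0 → α x = 0 := by rintro p rfl h; exact h
  refine key _ ((extChartAt (𝓡 n) x₀).left_inv hx) ?_
  have hinj := chartInvDeriv_injective ((extChartAt (𝓡 n) x₀).map_source hx)
  have hsurj : Function.Surjective (chartInvDeriv x₀ (extChartAt (𝓡 n) x₀ x) :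
      Model n →L[ℝ] Model n) :=
    LinearMap.injective_iff_surjective (f := ContinuousLinearMap.toLinearMap
      (M := Model n) (M₂ := Model n) (chartInvDeriv x₀ (extChartAt (𝓡 n) x₀ x))).1 hinj
  ext v
  choose w hw using fun i => hsurj (v i)
  have h1 := congrArg (fun a : Alt n q => a w) h
  have h2 : v = fun i => chartInvDeriv x₀ (extChartAt (𝓡 n) x₀ x) (w i) :=
    funext fun i => (hw i).symm
  rw [h2]
  exact h1

theorem Form.ext_chart {α β : Form n M q} (h : ∀ x₀ : M, ∀ z ∈ (extChartAt (𝓡 n) x₀).target,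
    Form.chart x₀ α z = Form.chart x₀ β z) : α = β := by
  refine sub_eq_zero.1 (Subtype.ext (funext fun x => ?_))
  refine eq_zero_of_inChart_eq_zero (mem_extChartAt_source x) ?_
  change Form.chart x (α - β) _ = 0
  rw [map_sub, Pi.sub_apply, h x _ (mem_extChartAt_target x), sub_self]

theorem Form.chart_mul (x₀ : M) (h : C^∞⟮𝓡 n, M; ℝ⟯) (α : Form n M q) (z : Model n) :
    Form.chart x₀ (Form.mul h q α) z = h ((extChartAt (𝓡 n) x₀).symm z) • Form.chart x₀ α z := rfl

theorem Form.chart_extD {x₀ : M} (α : Form n M q) {z : Model n}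
    (hz : z ∈ (extChartAt (𝓡 n) x₀).target) :
    Form.chart x₀ (extD n M q α) z = covD q (fderiv ℝ (Form.chart x₀ α) z) :=
  inChart_extDerivAt α hz

theorem Form.SuppIn.mul {α : Form n M q} (h : C^∞⟮𝓡 n, M; ℝ⟯) :
    (Form.mul h q α).SuppIn (tsupport h) := fun x hx => by
  change h x • α.1 x = 0
  rw [image_eq_zero_of_notMem_tsupport hx, zero_smul]

theorem Form.SuppIn.extD {α : Form n M q} {C : Set M} (hC : IsClosed C) (h : α.SuppIn C) :
    (extD n M q α).SuppIn C := fun x hx => by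
  refine eq_zero_of_inChart_eq_zero (mem_extChartAt_source x) ?_
  refine (Form.chart_extD α (mem_extChartAt_target x)).trans ?_
  have hev : Form.chart x α =ᶠ[𝓝 (extChartAt (𝓡 n) x x)] fun _ => 0 := by
    have hc : ContinuousAt (extChartAt (𝓡 n) x).symm (extChartAt (𝓡 n) x x) :=
      continuousAt_extChartAt_symm x
    have : Cᶜ ∈ 𝓝 ((extChartAt (𝓡 n) x).symm (extChartAt (𝓡 n) x x)) :=
      hC.isOpen_compl.mem_nhds (by rwa [extChartAt_to_inv])
    filter_upwards [hc this] with w hw using Form.chart_eq_zero h hw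
  rw [hev.fderiv_eq]
  simp

theorem contDiffOn_compContinuousLinearMap {F : Type*} [NormedAddCommGroup F] [NormedSpace ℝ F]
    {s : Set F} {a : F → Alt n q} {P : F → Model n →L[ℝ] Model n} (ha : ContDiffOn ℝ ∞ a s)
    (hP : ContDiffOn ℝ ∞ P s) :
    ContDiffOn ℝ ∞ (fun z => (a z).compContinuousLinearMap (P z)) s := by
  refine contDiffOn_alt_iff.2 fun I => ?_
  have h : ∀ z, altComp I ((a z).compContinuousLinearMap (P z)) =
      ∑ K : Fin q → Fin n, (∏ k, (P z (stdVec (I k))) (K k)) * altComp K (a z) := fun z => by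
    rw [altComp_apply]
    exact alt_apply_eq_sum_comp (a z) fun k => P z (stdVec (I k))
  simp only [h]
  refine ContDiffOn.sum fun K _ => ContDiffOn.mul (contDiffOn_prod fun k _ => ?_)
    ((altComp K).contDiff.comp_contDiffOn ha)
  have hPk : ContDiffOn ℝ ∞ (fun z => P z (stdVec (I k))) s := hP.clm_apply contDiffOn_const
  exact (EuclideanSpace.proj (𝕜 := ℝ) (K k)).contDiff.comp_contDiffOn hPk

theorem inChart_extendByZero (x₀ : M) (a : Model n → Alt n q) {z : Model n}
    (hz : z ∈ (extChartAt (𝓡 n) x₀).target) : inChart (extendByZero x₀ a) x₀ z = a z := by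
  unfold inChart extendByZero
  rw [if_pos ((extChartAt (𝓡 n) x₀).map_target hz), (extChartAt (𝓡 n) x₀).right_inv hz]
  ext v
  change a z (fun i => mfderiv (𝓡 n) 𝓘(ℝ, Model n) (extChartAt (𝓡 n) x₀)
      ((extChartAt (𝓡 n) x₀).symm z) (chartInvDeriv x₀ z (v i))) = a z v
  congr 1
  exact funext fun i => mfderiv_chartInvDeriv hz (v i)

variable [T2Space M]

/-- Seen from another chart, the extension by zero is a smooth pullback where the charts overlap.
Elsewhere it vanishes near the point, because the compact support is closed in the Hausdorff space
`M`. -/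
theorem exists_form_of_chart (x₀ : M) {a : Model n → Alt n q} {K : Set (Model n)}
    (ha : ContDiffOn ℝ ∞ a (extChartAt (𝓡 n) x₀).target) (hK : IsCompact K)
    (hKO : K ⊆ (extChartAt (𝓡 n) x₀).target)
    (h0 : ∀ z ∈ (extChartAt (𝓡 n) x₀).target, z ∉ K → a z = 0) :
    ∃ α : Form n M q, α.SuppIn ((extChartAt (𝓡 n) x₀).symm '' K) ∧
      ∀ z ∈ (extChartAt (𝓡 n) x₀).target, Form.chart x₀ α z = a z := by
  have hC : IsCompact ((extChartAt (𝓡 n) x₀).symm '' K) :=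
    hK.image_of_continuousOn ((continuousOn_extChartAt_symm x₀).mono hKO)
  refine ⟨⟨extendByZero x₀ a, fun y z hz => ContDiffAt.contDiffWithinAt ?_⟩, fun x hx => ?_,
    fun z hz => inChart_extendByZero x₀ a hz⟩
  · by_cases hzs : (extChartAt (𝓡 n) y).symm z ∈ (extChartAt (𝓡 n) x₀).source
    · have hzo : z ∈ (overlap y x₀ : Set (Model n)) := ⟨hz, hzs⟩
      have hsm : ContDiffOn ℝ ∞ (fun z => (a (transition y x₀ z)).compContinuousLinearMap
          (fderiv ℝ (transition y x₀) z)) (overlap y x₀) :=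
        contDiffOn_compContinuousLinearMap
          (ha.comp (contDiffOn_transition y x₀) fun w hw => (transition_mem_overlap hw).1)
          ((contDiffOn_transition y x₀).fderiv_of_isOpen (isOpen_overlap y x₀) (by simp))
      refine (hsm.contDiffAt ((isOpen_overlap y x₀).mem_nhds hzo)).congr_of_eventuallyEq ?_
      filter_upwards [(isOpen_overlap y x₀).mem_nhds hzo] with w hw
      rw [inChart_eq _ hw.1 hw.2]
      congr 1
      exact inChart_extendByZero x₀ a (transition_mem_overlap hw).1
    · refine (contDiffAt_const (c := (0 : Alt n q))).congr_of_eventuallyEq ?_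
      have hc : ContinuousAt (extChartAt (𝓡 n) y).symm z :=
        (continuousOn_extChartAt_symm y).continuousAt ((isOpen_extChartAt_target y).mem_nhds hz)
      have hne : (extChartAt (𝓡 n) y).symm z ∉ (extChartAt (𝓡 n) x₀).symm '' K := by
        rintro ⟨w, hw, hwz⟩
        exact hzs (hwz ▸ (extChartAt (𝓡 n) x₀).map_target (hKO hw))
      filter_upwards [hc (hC.isClosed.isOpen_compl.mem_nhds hne)] with w hw
      exact inChart_extendByZero_eq_zero x₀ h0 hw
  · refine eq_zero_of_inChart_eq_zero (mem_extChartAt_source x)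
      (inChart_extendByZero_eq_zero x₀ h0 ?_)
    rwa [extChartAt_to_inv]

theorem exists_partition (n : ℕ) (M : Type*) [TopologicalSpace M] [ChartedSpace (Model n) M]
    [IsManifold (𝓡 n) ∞ M] [T2Space M] [CompactSpace M] :
    ∃ (t : Finset M) (χ : t → C^∞⟮𝓡 n, M; ℝ⟯),
      (∀ i : t, tsupport (χ i) ⊆ (extChartAt (𝓡 n) (i : M)).source) ∧ ∀ x, ∑ i, χ i x = 1 := by
  obtain ⟨t, -, ht⟩ := (isCompact_univ : IsCompact (Set.univ : Set M)).elim_nhds_subcover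
    (fun x => (extChartAt (𝓡 n) x).source) fun x _ => extChartAt_source_mem_nhds x
  obtain ⟨χ, hχ⟩ := SmoothPartitionOfUnity.exists_isSubordinate (𝓡 n) (isClosed_univ (X := M))
    (fun i : t => (extChartAt (𝓡 n) (i : M)).source) (fun i => isOpen_extChartAt_source _)
    (fun x hx => by simpa using ht hx)
  refine ⟨t, fun i => χ i, hχ, fun x => ?_⟩
  rw [← finsum_eq_sum_of_fintype]
  exact χ.sum_eq_one (Set.mem_univ x)

end Forms

/-! ### The `L²` inner product and local adjoints. -/

section InnerProduct

variable {n q : ℕ} {M : Type*} [TopologicalSpace M] [ChartedSpace (Model n) M]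
  [IsManifold (𝓡 n) ∞ M]

theorem formInner_chart (g : Metric n M) (α β : Form n M q) {x₀ x : M}
    (hx : x ∈ (extChartAt (𝓡 n) x₀).source) :
    formInner g α.1 β.1 x = (chartMetric g x₀).pair q (extChartAt (𝓡 n) x₀ x)
      (Form.chart x₀ α (extChartAt (𝓡 n) x₀ x)) (Form.chart x₀ β (extChartAt (𝓡 n) x₀ x)) :=
  (formInner_eq g _ _ hx).trans (covPair_apply _ _ _).symm

theorem continuous_formInner (g : Metric n M) (α β : Form n M q) :
    Continuous (formInner g α.1 β.1) := by
  refine continuous_iff_continuousAt.2 fun x => ?_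
  have h : ContinuousOn (fun z => (chartMetric g x).pair q z (Form.chart x α z) (Form.chart x β z))
      (extChartAt (𝓡 n) x).target :=
    (((chartMetric g x).contDiffOn_pair q).continuousOn.clm_apply
      (Form.contDiffOn_chart x α).continuousOn).clm_apply (Form.contDiffOn_chart x β).continuousOn
  have h2 := (h.comp (continuousOn_extChartAt (I := 𝓡 n) x) (extChartAt (𝓡 n) x).mapsTo).continuousAt
    (extChartAt_source_mem_nhds (I := 𝓡 n) x)
  refine h2.congr ?_
  filter_upwards [extChartAt_source_mem_nhds (I := 𝓡 n) x] with y hy using (formInner_chart g α β hy).symm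

theorem formInner_self_nonneg (g : Metric n M) (α : Form n M q) (x : M) :
    0 ≤ formInner g α.1 α.1 x := by
  rw [formInner_chart g α α (mem_extChartAt_source x)]
  exact (chartMetric g x).pair_nonneg q (mem_extChartAt_target x) _

theorem formInner_mul_left (g : Metric n M) (h : C^∞⟮𝓡 n, M; ℝ⟯) (α β : Form n M q) (x : M) :
    formInner g (Form.mul h q α).1 β.1 x = h x * formInner g α.1 β.1 x := by
  rw [formInner_chart g _ _ (mem_extChartAt_source x), formInner_chart g _ _ (mem_extChartAt_source x),
    Form.chart_mul, extChartAt_to_inv, map_smul, smul_apply, smul_eq_mul]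

theorem formInner_comm (g : Metric n M) (α β : Form n M q) (x : M) :
    formInner g α.1 β.1 x = formInner g β.1 α.1 x := by
  rw [formInner_chart g _ _ (mem_extChartAt_source x), formInner_chart g _ _ (mem_extChartAt_source x)]
  exact (chartMetric g x).pair_comm q (mem_extChartAt_target x) _ _

theorem formInner_eq_zero (g : Metric n M) {α : Form n M q} {C : Set M} (hα : α.SuppIn C)
    (β : Form n M q) {x : M} (hx : x ∉ C) : formInner g α.1 β.1 x = 0 := by
  rw [formInner_chart g _ _ (mem_extChartAt_source x),
    Form.chart_eq_zero hα (by rwa [extChartAt_to_inv]), map_zero, zero_apply]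

variable [MeasurableSpace M] [BorelSpace M] [CompactSpace M]

theorem integrable_formInner (g : Metric n M) (α β : Form n M q) :
    Integrable (formInner g α.1 β.1) (riemVolume g) :=
  (continuous_formInner g α β).integrable_of_hasCompactSupport
    (HasCompactSupport.of_compactSpace _)

/-- The `L²` inner product as a bilinear form. -/
noncomputable def l2 (g : Metric n M) : Form n M q →ₗ[ℝ] Form n M q →ₗ[ℝ] ℝ :=
  LinearMap.mk₂ ℝ (l2Inner g)
    (fun α α' β => by
      refine Eq.trans ?_ (integral_add (integrable_formInner g α β) (integrable_formInner g α' β))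
      refine congrArg _ (funext fun x => ?_)
      simp only [formInner_chart g _ _ (mem_extChartAt_source x), map_add, Pi.add_apply, add_apply])
    (fun c α β => by
      refine Eq.trans ?_ (integral_const_mul c _)
      refine congrArg _ (funext fun x => ?_)
      simp only [formInner_chart g _ _ (mem_extChartAt_source x), map_smul, Pi.smul_apply,
        smul_apply, smul_eq_mul])
    (fun α β β' => by
      refine Eq.trans ?_ (integral_add (integrable_formInner g α β) (integrable_formInner g α β'))
      refine congrArg _ (funext fun x => ?_)
      simp only [formInner_chart g _ _ (mem_extChartAt_source x), map_add, Pi.add_apply])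
    (fun c α β => by
      refine Eq.trans ?_ (integral_const_mul c _)
      refine congrArg _ (funext fun x => ?_)
      simp only [formInner_chart g _ _ (mem_extChartAt_source x), map_smul, Pi.smul_apply,
        smul_eq_mul])

theorem l2_apply (g : Metric n M) (α β : Form n M q) : l2 g α β = l2Inner g α β := rfl

theorem l2_comm (g : Metric n M) (α β : Form n M q) : l2 g α β = l2 g β α :=
  congrArg _ (funext fun x => formInner_comm g α β x)

theorem l2_self_nonneg (g : Metric n M) (α : Form n M q) : 0 ≤ l2 g α α :=
  integral_nonneg fun x => formInner_self_nonneg g α x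

/-- A continuous nonnegative function with integral zero vanishes almost everywhere, and hence
everywhere since open sets have positive measure. -/
theorem eq_zero_of_l2_self (g : Metric n M) {α : Form n M q} (h : l2 g α α = 0) : α = 0 := by
  have h1 := (integral_eq_zero_iff_of_nonneg (fun x => formInner_self_nonneg g α x)
    (integrable_formInner g α α)).1 h
  have h2 := (Continuous.ae_eq_iff_eq (riemVolume g) (continuous_formInner g α α)
    continuous_zero).1 h1
  refine Subtype.ext (funext fun x => ?_)
  refine eq_zero_of_inChart_eq_zero (mem_extChartAt_source x) (by_contra fun hne => ?_)
  have h3 := (chartMetric g x).pair_pos q (mem_extChartAt_target x) _ hne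
  exact h3.ne' ((formInner_chart g α α (mem_extChartAt_source x)).symm.trans (congrFun h2 x))

theorem eq_of_l2_eq (g : Metric n M) {α β : Form n M q} (h : ∀ u, l2 g u α = l2 g u β) : α = β := by
  refine sub_eq_zero.1 (eq_zero_of_l2_self g ?_)
  rw [map_sub, h, sub_self]

theorem l2_mul_left (g : Metric n M) (h : C^∞⟮𝓡 n, M; ℝ⟯) (α β : Form n M q) :
    l2 g (Form.mul h q α) β = l2 g α (Form.mul h q β) :=
  congrArg _ (funext fun x => by
    rw [formInner_mul_left, formInner_comm g α (Form.mul h q β), formInner_mul_left,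
      formInner_comm g β])

theorem l2_add_self_le (g : Metric n M) (α β : Form n M q) :
    l2 g (α + β) (α + β) ≤ 2 * l2 g α α + 2 * l2 g β β := by
  have h := l2_self_nonneg g (α - β)
  simp only [map_sub, map_add, LinearMap.add_apply, LinearMap.sub_apply] at h ⊢
  linarith

theorem l2_sum_self_le (g : Metric n M) {ι : Type*} (s : Finset ι) (α : ι → Form n M q) :
    l2 g (∑ i ∈ s, α i) (∑ i ∈ s, α i) ≤ s.card * ∑ i ∈ s, l2 g (α i) (α i) := by
  have h : ∀ i j, l2 g (α i) (α j) ≤ (l2 g (α i) (α i) + l2 g (α j) (α j)) / 2 := fun i j => by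
    have h := l2_self_nonneg g (α i - α j)
    simp only [map_sub, LinearMap.sub_apply, l2_comm g (α j) (α i)] at h
    linarith
  simp only [map_sum, LinearMap.sum_apply]
  calc ∑ i ∈ s, ∑ j ∈ s, l2 g (α j) (α i)
      ≤ ∑ i ∈ s, ∑ j ∈ s, (l2 g (α j) (α j) + l2 g (α i) (α i)) / 2 :=
        Finset.sum_le_sum fun i _ => Finset.sum_le_sum fun j _ => h j i
    _ = _ := by
        simp only [add_div, Finset.sum_add_distrib, Finset.sum_const, nsmul_eq_mul, ← Finset.mul_sum,
          ← Finset.sum_div]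
        ring

theorem l2_eq_integral_rep (g : Metric n M) {x₀ : M} {α : Form n M q} {C : Set M}
    (hCs : C ⊆ (extChartAt (𝓡 n) x₀).source) (hα : α.SuppIn C) (β : Form n M q) :
    l2 g α β = ∫ z, (chartMetric g x₀).ρ z *
      (chartMetric g x₀).pair q z (Form.rep x₀ α z) (Form.chart x₀ β z) := by
  have h := integral_riemVolume g x₀ (continuous_formInner g α β) fun x hx =>
    formInner_eq_zero g hα β fun hC => hx (hCs hC)
  refine h.trans ?_
  refine Eq.trans ?_ (setIntegral_eq_integral_of_forall_compl_eq_zero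
    (s := (extChartAt (𝓡 n) x₀).target) fun z hz => ?_)
  · refine setIntegral_congr_fun (measurableSet_target x₀) fun z hz => ?_
    rw [Form.rep_apply α hz]
    simp only [formInner_chart g _ _ ((extChartAt (𝓡 n) x₀).map_target hz),
      (extChartAt (𝓡 n) x₀).right_inv hz]
  · have h0 : Form.rep x₀ α z = 0 := Set.indicator_of_notMem hz _
    rw [h0, map_zero, zero_apply, mul_zero]

/-- Definiteness makes the representing form unique, so any choice of it is automatically linear in
`v`. -/
theorem exists_linear_adjoint (g : Metric n M) {p : ℕ} (D : Form n M q →ₗ[ℝ] Form n M p)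
    (h : ∀ v, ∃ w, ∀ u, l2 g (D u) v = l2 g u w) :
    ∃ δ : Form n M p →ₗ[ℝ] Form n M q, ∀ u v, l2 g (D u) v = l2 g u (δ v) := by
  choose δ hδ using h
  refine ⟨⟨⟨δ, fun v v' => ?_⟩, fun c v => ?_⟩, fun u v => hδ v u⟩
  · exact eq_of_l2_eq g fun u => by rw [← hδ, map_add, map_add, hδ, hδ]
  · refine eq_of_l2_eq g fun u => ?_
    rw [← hδ, map_smul, RingHom.id_apply, map_smul, hδ]

variable [T2Space M]

/-- The coordinate codifferential of `v` vanishes outside the image of `C`, so it extends by zero to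
`M`; the test form `u` is arbitrary because only `v` has to be supported in the chart. -/
theorem exists_codifferential_of_suppIn (g : Metric n M) {x₀ : M} {v : Form n M (q + 1)} {C : Set M}
    (hC : IsCompact C) (hCs : C ⊆ (extChartAt (𝓡 n) x₀).source) (hv : v.SuppIn C) :
    ∃ w : Form n M q, (∀ u, l2 g (extD n M q u) v = l2 g u w) ∧ w.SuppIn C ∧
      ∀ z ∈ (extChartAt (𝓡 n) x₀).target,
        Form.chart x₀ w z = (chartMetric g x₀).codiff q (Form.rep x₀ v) z := by
  have hK := isCompact_chart_image hC hCs
  have hKO := chart_image_subset hCs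
  have hb := Form.contDiff_rep hC hCs hv
  have hb0 := Form.rep_eq_zero hv (x₀ := x₀)
  obtain ⟨w, hw, hwc⟩ := exists_form_of_chart x₀ (a := (chartMetric g x₀).codiff q (Form.rep x₀ v))
    ((chartMetric g x₀).contDiffOn_codiff hb.contDiffOn) hK hKO
    (fun z _ hzK => (chartMetric g x₀).codiff_eq_zero q hK hb0 hzK)
  have himage : (extChartAt (𝓡 n) x₀).symm '' (extChartAt (𝓡 n) x₀ '' C) = C := by
    rw [Set.image_image]
    exact (Set.image_congr fun x hx => (extChartAt (𝓡 n) x₀).left_inv (hCs hx)).trans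
      (Set.image_id' C)
  rw [himage] at hw
  refine ⟨w, fun u => ?_, hw, hwc⟩
  rw [l2_comm, l2_eq_integral_rep g hCs hv, l2_comm, l2_eq_integral_rep g hCs hw]
  have h := (chartMetric g x₀).integral_pair_covD_right q hK hKO (Form.contDiffOn_chart x₀ u) hb hb0
  refine Eq.trans ?_ (h.trans ?_)
  · refine integral_congr_ae (Filter.Eventually.of_forall fun z => ?_)
    by_cases hz : z ∈ (extChartAt (𝓡 n) x₀).target
    · simp only [Form.chart_extD u hz]
      rw [(chartMetric g x₀).pair_comm (q + 1) hz]
    · simp [hb0 z fun h => hz (hKO h)]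
  · refine integral_congr_ae (Filter.Eventually.of_forall fun z => ?_)
    by_cases hz : z ∈ (extChartAt (𝓡 n) x₀).target
    · simp only [Form.rep_apply w hz, hwc z hz]
      rw [(chartMetric g x₀).pair_comm q hz]
    · have h0 : Form.rep x₀ w z = 0 := Set.indicator_of_notMem hz _
      simp [h0, (chartMetric g x₀).codiff_eq_zero q hK hb0 fun h => hz (hKO h)]

end InnerProduct

/-! ### Bounded perturbations, the codifferential and the adjoint of `d_t`. -/

section Operators

variable {n q p r : ℕ} {M : Type*} [TopologicalSpace M] [ChartedSpace (Model n) M]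
  [IsManifold (𝓡 n) ∞ M]

theorem Form.sum_mul {ι : Type*} [Fintype ι] {χ : ι → C^∞⟮𝓡 n, M; ℝ⟯} (h : ∀ x, ∑ i, χ i x = 1)
    (v : Form n M q) : ∑ i, Form.mul (χ i) q v = v := by
  refine Form.ext_chart fun x₀ z _ => ?_
  rw [map_sum, Finset.sum_apply]
  simp only [Form.chart_mul]
  rw [← Finset.sum_smul, h, one_smul]

theorem Form.mul_expMul_neg (f : C^∞⟮𝓡 n, M; ℝ⟯) (t : ℝ) (v : Form n M q) :
    Form.mul (expMul f (-t)) q (Form.mul (expMul f t) q v) = v := by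
  refine Form.ext_chart fun x₀ z _ => ?_
  simp only [Form.chart_mul, smul_smul]
  have h : ∀ x : M, expMul f (-t) x * expMul f t x = 1 := fun x => by
    change Real.exp (-t * f x) * Real.exp (t * f x) = 1
    rw [← Real.exp_add]
    simp
  rw [h, one_smul]

theorem Form.mul_expMul_neg' (f : C^∞⟮𝓡 n, M; ℝ⟯) (t : ℝ) (v : Form n M q) :
    Form.mul (expMul f t) q (Form.mul (expMul f (-t)) q v) = v := by
  simpa using Form.mul_expMul_neg f (-t) v

theorem extD_extD (v : Form n M q) : extD n M (q + 1) (extD n M q v) = 0 := by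
  refine Form.ext_chart fun x₀ z hz => ?_
  rw [Form.chart_extD _ hz]
  have hev : Form.chart x₀ (extD n M q v) =ᶠ[𝓝 z] fun w => extDeriv (Form.chart x₀ v) w := by
    filter_upwards [(isOpen_extChartAt_target x₀).mem_nhds hz] with w hw using
      Form.chart_extD v hw
  rw [hev.fderiv_eq, map_zero]
  exact extDeriv_extDeriv_apply (r := ∞) (((Form.contDiffOn_chart x₀ v).contDiffAt
    ((isOpen_extChartAt_target x₀).mem_nhds hz)))
    (by simpa using (WithTop.coe_le_coe.2 le_top : ((2 : ℕ∞) : WithTop ℕ∞) ≤ ∞))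

theorem dt_dt (f : C^∞⟮𝓡 n, M; ℝ⟯) (t : ℝ) (v : Form n M q) : dt f t (q + 1) (dt f t q v) = 0 := by
  simp only [dt, LinearMap.comp_apply, Form.mul_expMul_neg', extD_extD, map_zero]

/-- The commutator of the exterior derivative with the multiplication by `h`. -/
noncomputable def extDComm (q : ℕ) (h : C^∞⟮𝓡 n, M; ℝ⟯) : Form n M q →ₗ[ℝ] Form n M (q + 1) :=
  extD n M q ∘ₗ Form.mul h q - Form.mul h (q + 1) ∘ₗ extD n M q

theorem contDiffOn_comp_symm (h : C^∞⟮𝓡 n, M; ℝ⟯) (x₀ : M) :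
    ContDiffOn ℝ ∞ (fun z => h ((extChartAt (𝓡 n) x₀).symm z)) (extChartAt (𝓡 n) x₀).target :=
  contMDiffOn_iff_contDiffOn.1 (h.contMDiff.comp_contMDiffOn (contMDiffOn_extChartAt_symm x₀))

/-- By the Leibniz rule the derivatives of `u` cancel and `dh ∧ u` remains, an operator of order
zero. -/
theorem chart_extDComm (h : C^∞⟮𝓡 n, M; ℝ⟯) (u : Form n M q) {x₀ : M} {z : Model n}
    (hz : z ∈ (extChartAt (𝓡 n) x₀).target) :
    Form.chart x₀ (extDComm q h u) z = covD q ((fderiv ℝ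
      (fun z => h ((extChartAt (𝓡 n) x₀).symm z)) z).smulRight (Form.chart x₀ u z)) := by
  have hn := (isOpen_extChartAt_target (I := 𝓡 n) x₀).mem_nhds hz
  have h1 := ((contDiffOn_comp_symm h x₀).contDiffAt hn).differentiableAt (by simp)
  have h2 := ((Form.contDiffOn_chart x₀ u).contDiffAt hn).differentiableAt (by simp)
  change Form.chart x₀ (extD n M q (Form.mul h q u)) z -
    Form.chart x₀ (Form.mul h (q + 1) (extD n M q u)) z = _
  rw [Form.chart_extD _ hz, Form.chart_mul, Form.chart_extD _ hz, ← map_smul, ← map_sub]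
  congr 1
  have h3 : Form.chart x₀ (Form.mul h q u) =
    fun z => h ((extChartAt (𝓡 n) x₀).symm z) • Form.chart x₀ u z := rfl
  rw [h3, fderiv_fun_smul h1 h2, add_sub_cancel_left]

variable [MeasurableSpace M] [BorelSpace M] [CompactSpace M]

/-- `A` is bounded for the `L²` norms. -/
def L2Bounded (g : Metric n M) (A : Form n M q →ₗ[ℝ] Form n M p) : Prop :=
  ∃ C, 0 ≤ C ∧ ∀ u, l2 g (A u) (A u) ≤ C * l2 g u u

theorem L2Bounded.add {g : Metric n M} {A B : Form n M q →ₗ[ℝ] Form n M p} (hA : L2Bounded g A)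
    (hB : L2Bounded g B) : L2Bounded g (A + B) := by
  obtain ⟨C, hC, hA⟩ := hA
  obtain ⟨D, hD, hB⟩ := hB
  refine ⟨2 * C + 2 * D, by positivity, fun u => ?_⟩
  have h := l2_add_self_le g (A u) (B u)
  have h1 := hA u
  have h2 := hB u
  rw [LinearMap.add_apply]
  linarith

theorem L2Bounded.neg {g : Metric n M} {A : Form n M q →ₗ[ℝ] Form n M p} (hA : L2Bounded g A) :
    L2Bounded g (-A) := by
  obtain ⟨C, hC, hA⟩ := hA
  refine ⟨C, hC, fun u => ?_⟩
  simpa using hA u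

theorem L2Bounded.comp {g : Metric n M} {A : Form n M p →ₗ[ℝ] Form n M r}
    {B : Form n M q →ₗ[ℝ] Form n M p} (hA : L2Bounded g A) (hB : L2Bounded g B) :
    L2Bounded g (A ∘ₗ B) := by
  obtain ⟨C, hC, hA⟩ := hA
  obtain ⟨D, hD, hB⟩ := hB
  refine ⟨C * D, by positivity, fun u => ?_⟩
  rw [LinearMap.comp_apply, mul_assoc]
  exact (hA _).trans (mul_le_mul_of_nonneg_left (hB u) hC)

/-- Expand `0 ≤ ‖A B v - (C + 1) v‖²` and use `⟨A B v, v⟩ = ‖B v‖²`. The constant `C + 1` instead of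
`C` keeps the final divisor positive. -/
theorem L2Bounded.adjoint {g : Metric n M} {A : Form n M q →ₗ[ℝ] Form n M p}
    {B : Form n M p →ₗ[ℝ] Form n M q} (hA : L2Bounded g A)
    (h : ∀ u v, l2 g (A u) v = l2 g u (B v)) : L2Bounded g B := by
  obtain ⟨C, hC, hA⟩ := hA
  refine ⟨C + 1, by positivity, fun v => ?_⟩
  have h1 := l2_self_nonneg g (A (B v) - (C + 1) • v)
  have h2 := hA (B v)
  have h3 := h (B v) v
  have h4 := l2_self_nonneg g (B v)
  simp only [map_sub, map_smul, LinearMap.sub_apply, LinearMap.smul_apply, smul_eq_mul,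
    l2_comm g v (A (B v)), h3] at h1
  have h5 : (C + 1) * l2 g (B v) (B v) ≤ (C + 1) * ((C + 1) * l2 g v v) := by nlinarith
  exact le_of_mul_le_mul_left h5 (by positivity)

/-- By compactness finitely many of the neighbourhoods suffice, and the sum of the `|C i|` dominates
every local constant. -/
theorem l2Bounded_of_local {g : Metric n M} {A : Form n M q →ₗ[ℝ] Form n M p}
    (h : ∀ x₀ : M, ∃ U ∈ 𝓝 x₀, ∃ C : ℝ, ∀ x ∈ U, ∀ u : Form n M q,
      formInner g (A u).1 (A u).1 x ≤ C * formInner g u.1 u.1 x) : L2Bounded g A := by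
  choose U hU C hC using h
  obtain ⟨t, -, ht⟩ := (isCompact_univ : IsCompact (Set.univ : Set M)).elim_nhds_subcover U
    fun x _ => hU x
  refine ⟨∑ i ∈ t, |C i|, Finset.sum_nonneg fun i _ => abs_nonneg _, fun u => ?_⟩
  calc l2 g (A u) (A u) ≤ ∫ x, (∑ i ∈ t, |C i|) * formInner g u.1 u.1 x ∂(riemVolume g) := by
        refine integral_mono (integrable_formInner g _ _)
          ((integrable_formInner g u u).const_mul _) fun x => ?_
        obtain ⟨i, hi, hx⟩ := Set.mem_iUnion₂.1 (ht (Set.mem_univ x))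
        refine (hC i x hx u).trans (mul_le_mul_of_nonneg_right ?_ (formInner_self_nonneg g u x))
        exact (le_abs_self _).trans
          (Finset.single_le_sum (f := fun i => |C i|) (fun i _ => abs_nonneg _) hi)
    _ = _ := integral_const_mul _ _

theorem l2Bounded_mul (g : Metric n M) (h : C^∞⟮𝓡 n, M; ℝ⟯) : L2Bounded g (Form.mul h q) := by
  refine l2Bounded_of_local fun x₀ => ⟨{x | h x ^ 2 < h x₀ ^ 2 + 1}, ?_, h x₀ ^ 2 + 1,
    fun x hx u => ?_⟩
  · exact (isOpen_lt (h.contMDiff.continuous.pow 2) continuous_const).mem_nhds (by simp)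
  · rw [formInner_mul_left, formInner_comm g u (Form.mul h q u), formInner_mul_left, ← mul_assoc, ← sq]
    exact mul_le_mul_of_nonneg_right hx.le (formInner_self_nonneg g u x)

theorem l2Bounded_extDComm (g : Metric n M) (h : C^∞⟮𝓡 n, M; ℝ⟯) : L2Bounded g (extDComm q h) := by
  refine l2Bounded_of_local fun x₀ => ?_
  obtain ⟨R, hR, hball⟩ := Metric.nhds_basis_closedBall.mem_iff.1
    (extChartAt_target_mem_nhds (I := 𝓡 n) x₀)
  set K := Metric.closedBall (extChartAt (𝓡 n) x₀ x₀) R with hK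
  have hKc : IsCompact K := isCompact_closedBall _ _
  obtain ⟨C, hC, hC'⟩ := (chartMetric g x₀).exists_pair_bound (q + 1) hKc hball
  obtain ⟨c, hc, hc'⟩ := (chartMetric g x₀).exists_pair_coercive q hKc hball
  have hcont : ContinuousOn (fun z => fderiv ℝ (fun z => h ((extChartAt (𝓡 n) x₀).symm z)) z) K :=
    ((contDiffOn_comp_symm h x₀).continuousOn_fderiv_of_isOpen (isOpen_extChartAt_target x₀)
      (by simp)).mono hball
  obtain ⟨D, hD⟩ := hKc.exists_bound_of_continuousOn hcont
  have hD0 : 0 ≤ D := (norm_nonneg _).trans (hD _ (Metric.mem_closedBall_self hR.le))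
  refine ⟨(extChartAt (𝓡 n) x₀).source ∩ extChartAt (𝓡 n) x₀ ⁻¹' K, ?_,
    C * (‖covD (n := n) q‖ * D) ^ 2 / c, fun x hx u => ?_⟩
  · exact Filter.inter_mem (extChartAt_source_mem_nhds x₀)
      (continuousAt_extChartAt x₀ (Metric.closedBall_mem_nhds _ hR))
  · rw [formInner_chart g _ _ hx.1, formInner_chart g _ _ hx.1]
    set z := extChartAt (𝓡 n) x₀ x with hz
    have hzt : z ∈ (extChartAt (𝓡 n) x₀).target := hball hx.2
    rw [chart_extDComm h u hzt]
    set a := Form.chart x₀ u z with ha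
    set b := covD q ((fderiv ℝ (fun z => h ((extChartAt (𝓡 n) x₀).symm z)) z).smulRight a) with hb
    have hρ := (chartMetric g x₀).ρ_pos z hzt
    have hnorm : ‖b‖ ≤ ‖covD (n := n) q‖ * D * ‖a‖ := by
      refine ((covD q).le_opNorm _).trans ?_
      rw [mul_assoc, ContinuousLinearMap.norm_smulRight_apply]
      gcongr
      exact hD z hx.2
    have h1 := hC' z hx.2 b
    have h2 := hc' z hx.2 a
    have h3 : ‖b‖ ^ 2 ≤ (‖covD (n := n) q‖ * D) ^ 2 * ‖a‖ ^ 2 := by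
      rw [← mul_pow]
      exact pow_le_pow_left₀ (norm_nonneg _) hnorm 2
    -- The coordinate bounds concern the pairing times the density, which is positive and cancels.
    refine le_of_mul_le_mul_left ?_ hρ
    calc _ ≤ C * ‖b‖ ^ 2 := h1
      _ ≤ C * ((‖covD (n := n) q‖ * D) ^ 2 * ‖a‖ ^ 2) := mul_le_mul_of_nonneg_left h3 hC
      _ = C * (‖covD (n := n) q‖ * D) ^ 2 / c * (c * ‖a‖ ^ 2) := by field_simp
      _ ≤ C * (‖covD (n := n) q‖ * D) ^ 2 / c * _ := mul_le_mul_of_nonneg_left h2 (by positivity)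
      _ = _ := by ring

/-- The difference is `e^{-tf}` times the commutator of `d` with `e^{tf}`, that is, exterior
multiplication by `t df`. -/
theorem l2Bounded_dt_sub (g : Metric n M) (f : C^∞⟮𝓡 n, M; ℝ⟯) (t : ℝ) (q : ℕ) :
    L2Bounded g (dt f t q - extD n M q) := by
  have h : dt f t q - extD n M q = Form.mul (expMul f (-t)) (q + 1) ∘ₗ extDComm q (expMul f t) := by
    ext1 u
    simp only [dt, extDComm, LinearMap.sub_apply, LinearMap.comp_apply, map_sub, Form.mul_expMul_neg]
  rw [h]
  exact (l2Bounded_mul g _).comp (l2Bounded_extDComm g _)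

variable [T2Space M]

theorem exists_codifferential (g : Metric n M) (v : Form n M (q + 1)) :
    ∃ w : Form n M q, ∀ u, l2 g (extD n M q u) v = l2 g u w := by
  obtain ⟨t, χ, hχ, hsum⟩ := exists_partition n M
  choose w hw _ using fun i : t => exists_codifferential_of_suppIn g (v := Form.mul (χ i) (q + 1) v)
    (isClosed_tsupport (χ i)).isCompact (hχ i) (Form.SuppIn.mul (χ i))
  refine ⟨∑ i, w i, fun u => ?_⟩
  conv_lhs => rw [← Form.sum_mul hsum v]
  simp only [map_sum, hw]

/-- The codifferential. -/
noncomputable def codifferential (g : Metric n M) (q : ℕ) : Form n M (q + 1) →ₗ[ℝ] Form n M q :=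
  (exists_linear_adjoint g (extD n M q) (exists_codifferential g)).choose

theorem l2_extD (g : Metric n M) (u : Form n M q) (v : Form n M (q + 1)) :
    l2 g (extD n M q u) v = l2 g u (codifferential g q v) :=
  (exists_linear_adjoint g (extD n M q) (exists_codifferential g)).choose_spec u v

/-- Uniqueness of adjoints identifies the globally chosen codifferential with the one built in the
chart. -/
theorem codifferential_of_suppIn (g : Metric n M) {x₀ : M} {v : Form n M (q + 1)} {C : Set M}
    (hC : IsCompact C) (hCs : C ⊆ (extChartAt (𝓡 n) x₀).source) (hv : v.SuppIn C) :
    (codifferential g q v).SuppIn C ∧ ∀ z ∈ (extChartAt (𝓡 n) x₀).target,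
      Form.chart x₀ (codifferential g q v) z =
        (chartMetric g x₀).codiff q (Form.rep x₀ v) z := by
  obtain ⟨w, hw, h⟩ := exists_codifferential_of_suppIn g hC hCs hv
  have : codifferential g q v = w := eq_of_l2_eq g fun u => by rw [← l2_extD, hw]
  rwa [this]

/-- Multiplication by a function is symmetric, so the adjoint of `e^{-tf} d e^{tf}` is `e^{tf} d^*
e^{-tf}`. -/
theorem exists_isFormalAdjoint_dt (g : Metric n M) (f : C^∞⟮𝓡 n, M; ℝ⟯) (t : ℝ) (q : ℕ) :
    ∃ δ, IsFormalAdjoint g (dt f t q) δ :=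
  ⟨Form.mul (expMul f t) q ∘ₗ codifferential g q ∘ₗ Form.mul (expMul f (-t)) (q + 1), fun u v => by
    simp only [← l2_apply, dt, LinearMap.comp_apply, l2_mul_left, l2_extD]⟩

theorem isFormalAdjoint_dtStar (g : Metric n M) (f : C^∞⟮𝓡 n, M; ℝ⟯) (t : ℝ) (q : ℕ) :
    IsFormalAdjoint g (dt f t q) (dtStar g f t q) :=
  Classical.epsilon_spec (exists_isFormalAdjoint_dt g f t q)

theorem l2_dt (g : Metric n M) (f : C^∞⟮𝓡 n, M; ℝ⟯) (t : ℝ) (u : Form n M q)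
    (v : Form n M (q + 1)) : l2 g (dt f t q u) v = l2 g u (dtStar g f t q v) :=
  isFormalAdjoint_dtStar g f t q u v

theorem l2Bounded_dtStar_sub (g : Metric n M) (f : C^∞⟮𝓡 n, M; ℝ⟯) (t : ℝ) (q : ℕ) :
    L2Bounded g (dtStar g f t q - codifferential g q) :=
  (l2Bounded_dt_sub g f t q).adjoint fun u v => by
    simp only [LinearMap.sub_apply, map_sub, l2_dt, l2_extD]

/-- This commutator is minus the adjoint of the commutator of `d` with `h`, so its bound needs no
coordinate formula. -/
theorem l2Bounded_codifferential_comm (g : Metric n M) (h : C^∞⟮𝓡 n, M; ℝ⟯) (q : ℕ) :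
    L2Bounded g (codifferential g q ∘ₗ Form.mul h (q + 1) - Form.mul h q ∘ₗ codifferential g q) :=
  (l2Bounded_extDComm g h).neg.adjoint fun u v => by
    simp only [extDComm, LinearMap.neg_apply, LinearMap.sub_apply, LinearMap.comp_apply, map_sub,
      map_neg, l2_mul_left, l2_extD]
    ring

end Operators

/-! ### Gårding's inequality on `M` and the finite-codimension estimate. -/

section Garding

variable {n q : ℕ} {M : Type*} [TopologicalSpace M] [ChartedSpace (Model n) M]
  [IsManifold (𝓡 n) ∞ M]

theorem covD_fderiv_rep {x₀ : M} {v : Form n M q} {C : Set M} (hC : IsCompact C)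
    (hCs : C ⊆ (extChartAt (𝓡 n) x₀).source) (hv : v.SuppIn C) (z : Model n) :
    covD q (fderiv ℝ (Form.rep x₀ v) z) = Form.rep x₀ (extD n M q v) z := by
  by_cases hz : z ∈ (extChartAt (𝓡 n) x₀).target
  · rw [Form.rep_apply _ hz, Form.chart_extD v hz]
    have hev : Form.rep x₀ v =ᶠ[𝓝 z] Form.chart x₀ v := by
      filter_upwards [(isOpen_extChartAt_target x₀).mem_nhds hz] with w hw using Form.rep_apply v hw
    rw [hev.fderiv_eq]
  · rw [fderiv_eq_zero_of_zero (isCompact_chart_image hC hCs) (Form.rep_eq_zero hv) z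
      fun h => hz (chart_image_subset hCs h), map_zero]
    exact (Set.indicator_of_notMem hz _).symm

variable [CompactSpace M]

/-- `N` consists of the forms whose cutoff has mean zero over finitely many grid cubes. It is the
kernel of a linear map to a finite-dimensional space. -/
theorem exists_cofg_poincare {x₀ : M} {χ : C^∞⟮𝓡 n, M; ℝ⟯}
    (hχ : tsupport χ ⊆ (extChartAt (𝓡 n) x₀).source) (q : ℕ) {ε : ℝ} (hε : 0 < ε) :
    ∃ N : Submodule ℝ (Form n M q), N.CoFG ∧ ∀ u ∈ N,
      (∫ z, ‖Form.rep x₀ (Form.mul χ q u) z‖ ^ 2) ≤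
        ε * ∫ z, ‖fderiv ℝ (Form.rep x₀ (Form.mul χ q u)) z‖ ^ 2 := by
  have hC := (isClosed_tsupport χ).isCompact
  have hK := isCompact_chart_image hC hχ
  have hw : ∀ u : Form n M q, ContDiff ℝ ∞ (Form.rep x₀ (Form.mul χ q u)) := fun u =>
    Form.contDiff_rep hC hχ (Form.SuppIn.mul χ)
  have h0 : ∀ u : Form n M q, ∀ z ∉ extChartAt (𝓡 n) x₀ '' tsupport χ,
    Form.rep x₀ (Form.mul χ q u) z = 0 := fun u => Form.rep_eq_zero (Form.SuppIn.mul χ)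
  obtain ⟨δ, S, hS⟩ := exists_poincare_cubes (V := Alt n q) hK hε
  have hi : ∀ (u : Form n M q) (k : S), IntegrableOn (Form.rep x₀ (Form.mul χ q u))
      (gridCube n δ k) := fun u k => (integrable_of_continuousOn (hw u).continuous.continuousOn hK
    (chart_image_subset hχ) (h0 u)).integrableOn
  let T : Form n M q →ₗ[ℝ] (S → Alt n q) :=
    { toFun u k := ∫ z in gridCube n δ k, Form.rep x₀ (Form.mul χ q u) z
      map_add' u v := by
        funext k
        rw [Pi.add_apply, ← integral_add (hi u k) (hi v k), map_add, map_add]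
        rfl
      map_smul' c u := by
        funext k
        rw [Pi.smul_apply, RingHom.id_apply, ← integral_smul, map_smul, map_smul]
        rfl }
  refine ⟨LinearMap.ker T, Submodule.CoFG.ker T, fun u hu => ?_⟩
  exact hS _ ((hw u).of_le (by simp)) (h0 u) fun k hk => congrFun (LinearMap.mem_ker.1 hu) ⟨k, hk⟩

variable [MeasurableSpace M] [BorelSpace M]

/-- On a compact part of a chart the metric and its density are uniformly comparable with the flat
ones. -/
theorem exists_norm_rep_bounds (g : Metric n M) {x₀ : M} {C : Set M} (hC : IsCompact C)
    (hCs : C ⊆ (extChartAt (𝓡 n) x₀).source) (q : ℕ) :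
    ∃ c, 0 ≤ c ∧ ∀ v : Form n M q, v.SuppIn C →
      (∫ z, ‖Form.rep x₀ v z‖ ^ 2) ≤ c * l2 g v v ∧
      l2 g v v ≤ c * ∫ z, ‖Form.rep x₀ v z‖ ^ 2 := by
  have hK := isCompact_chart_image hC hCs
  have hKO := chart_image_subset hCs
  obtain ⟨b, hb, hb'⟩ := (chartMetric g x₀).exists_pair_bound q hK hKO
  obtain ⟨c, hc, hc'⟩ := (chartMetric g x₀).exists_pair_coercive q hK hKO
  refine ⟨c⁻¹ + b, by positivity, fun v hv => ?_⟩
  have hw := Form.contDiff_rep hC hCs hv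
  have h0 := Form.rep_eq_zero hv (x₀ := x₀)
  have hi1 : Integrable fun z => ‖Form.rep x₀ v z‖ ^ 2 :=
    integrable_of_continuousOn (hw.continuous.norm.pow 2).continuousOn hK hKO
      fun z hz => by simp [h0 z hz]
  have hi2 : Integrable fun z => (chartMetric g x₀).ρ z *
      (chartMetric g x₀).pair q z (Form.rep x₀ v z) (Form.rep x₀ v z) :=
    integrable_of_continuousOn ((chartMetric g x₀).contDiffOn_ρ.continuousOn.mul
      ((((chartMetric g x₀).contDiffOn_pair q).continuousOn.clm_apply
        hw.continuous.continuousOn).clm_apply hw.continuous.continuousOn)) hK hKO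
      fun z hz => by simp [h0 z hz]
  have hl : l2 g v v = ∫ z, (chartMetric g x₀).ρ z *
      (chartMetric g x₀).pair q z (Form.rep x₀ v z) (Form.rep x₀ v z) := by
    rw [l2_eq_integral_rep g hCs hv]
    refine integral_congr_ae (Filter.Eventually.of_forall fun z => ?_)
    by_cases hz : z ∈ extChartAt (𝓡 n) x₀ '' C
    · simp only [Form.rep_apply v (hKO hz)]
    · simp [h0 z hz]
  have h1 : c * (∫ z, ‖Form.rep x₀ v z‖ ^ 2) ≤ l2 g v v := by
    rw [hl, ← integral_const_mul]
    refine integral_mono (hi1.const_mul c) hi2 fun z => ?_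
    by_cases hz : z ∈ extChartAt (𝓡 n) x₀ '' C
    · exact hc' z hz _
    · simp [h0 z hz]
  have h2 : l2 g v v ≤ b * (∫ z, ‖Form.rep x₀ v z‖ ^ 2) := by
    rw [hl, ← integral_const_mul]
    refine integral_mono hi2 (hi1.const_mul b) fun z => ?_
    by_cases hz : z ∈ extChartAt (𝓡 n) x₀ '' C
    · exact hb' z hz _
    · simp [h0 z hz]
  have h3 : 0 ≤ ∫ z, ‖Form.rep x₀ v z‖ ^ 2 := integral_nonneg fun z => by positivity
  have h4 := l2_self_nonneg g v
  constructor
  · calc (∫ z, ‖Form.rep x₀ v z‖ ^ 2) ≤ c⁻¹ * l2 g v v := by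
          rw [← div_eq_inv_mul, le_div_iff₀ hc]; linarith
      _ ≤ (c⁻¹ + b) * l2 g v v := by gcongr; linarith
  · refine h2.trans ?_
    have : 0 ≤ c⁻¹ := by positivity
    gcongr
    linarith

/-- The quadratic form `‖D u‖² + ‖δ u‖²` on forms of degree `q`, without the second term if
`q = 0`. -/
noncomputable def energy (g : Metric n M) (D : ∀ q, Form n M q →ₗ[ℝ] Form n M (q + 1))
    (δ : ∀ q, Form n M (q + 1) →ₗ[ℝ] Form n M q) : ∀ q, Form n M q → ℝ
  | 0, u => l2 g (D 0 u) (D 0 u)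
  | q + 1, u => l2 g (D (q + 1) u) (D (q + 1) u) + l2 g (δ q u) (δ q u)

theorem energy_nonneg (g : Metric n M) (D : ∀ q, Form n M q →ₗ[ℝ] Form n M (q + 1))
    (δ : ∀ q, Form n M (q + 1) →ₗ[ℝ] Form n M q) (q : ℕ) (u : Form n M q) :
    0 ≤ energy g D δ q u := by
  cases q with
  | zero => exact l2_self_nonneg g _
  | succ q => exact add_nonneg (l2_self_nonneg g _) (l2_self_nonneg g _)

/-- Write `A h = h B + ([A, h] - h (B - A))`, where the bracket is bounded. The pair `(A, B)` will
be `(d, d_t)` or `(d^*, d_t^*)`. -/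
theorem exists_l2_le_of_l2Bounded (g : Metric n M) {p : ℕ} (h : C^∞⟮𝓡 n, M; ℝ⟯)
    {A B : Form n M q →ₗ[ℝ] Form n M p}
    (hAB : L2Bounded g (A ∘ₗ Form.mul h q - Form.mul h p ∘ₗ A)) (hB : L2Bounded g (B - A)) :
    ∃ C, 0 ≤ C ∧ ∀ u, l2 g (A (Form.mul h q u)) (A (Form.mul h q u)) ≤
      C * (l2 g (B u) (B u) + l2 g u u) := by
  obtain ⟨b, hb, hb'⟩ := hAB.add ((l2Bounded_mul g h).comp hB).neg
  obtain ⟨c, hc, hc'⟩ := l2Bounded_mul (q := p) g h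
  refine ⟨2 * b + 2 * c, by positivity, fun u => ?_⟩
  have h1 := l2_add_self_le g (Form.mul h p (B u))
    ((A ∘ₗ Form.mul h q - Form.mul h p ∘ₗ A + -(Form.mul h p ∘ₗ (B - A))) u)
  have h2 : Form.mul h p (B u) +
      (A ∘ₗ Form.mul h q - Form.mul h p ∘ₗ A + -(Form.mul h p ∘ₗ (B - A))) u =
      A (Form.mul h q u) := by
    simp only [LinearMap.add_apply, LinearMap.sub_apply, LinearMap.neg_apply, LinearMap.comp_apply,
      map_sub]
    abel
  rw [h2] at h1
  have h3 := hb' u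
  have h4 := hc' (B u)
  have h5 := l2_self_nonneg g u
  have h6 := l2_self_nonneg g (B u)
  nlinarith [mul_nonneg hb h6, mul_nonneg hc h5]

variable [T2Space M]

theorem covDiv_fderiv_rep (g : Metric n M) {x₀ : M} {v : Form n M (q + 1)} {C : Set M}
    (hC : IsCompact C) (hCs : C ⊆ (extChartAt (𝓡 n) x₀).source) (hv : v.SuppIn C) {z : Model n}
    (hz : z ∈ (extChartAt (𝓡 n) x₀).target) :
    covDiv q ((chartMetric g x₀).B z) (fderiv ℝ (Form.rep x₀ v) z) =
      (chartMetric g x₀).codiffZero q z (Form.rep x₀ v z) -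
        Form.rep x₀ (codifferential g q v) z := by
  rw [Form.rep_apply (codifferential g q v) hz, (codifferential_of_suppIn g hC hCs hv).2 z hz,
    (chartMetric g x₀).codiff_eq hz ((Form.contDiff_rep hC hCs hv).differentiable (by simp) z)]
  abel

/-- The coordinate inequality, with `covD` of the gradient read as `d v` and `covDiv` of the
gradient read as `-d^* v` up to the zeroth order term, which is bounded on the compact image of `C`.
-/
theorem exists_garding_chart (g : Metric n M) {x₀ : M} {C : Set M} (hC : IsCompact C)
    (hCs : C ⊆ (extChartAt (𝓡 n) x₀).source) (q : ℕ) :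
    ∃ c, 0 ≤ c ∧ ∀ v : Form n M q, v.SuppIn C →
      (∫ z, ‖fderiv ℝ (Form.rep x₀ v) z‖ ^ 2) ≤
        c * (energy g (extD n M) (codifferential g) q v + l2 g v v) := by
  have hK := isCompact_chart_image hC hCs
  have hKO := chart_image_subset hCs
  obtain ⟨b, hb, hb'⟩ := exists_norm_rep_bounds g hC hCs (q + 1)
  cases q with
  | zero =>
    obtain ⟨c, hc, hc'⟩ := (chartMetric g x₀).garding_zero hK hKO
    refine ⟨c * b, by positivity, fun v hv => ?_⟩
    refine (hc' _ (Form.contDiff_rep hC hCs hv) (Form.rep_eq_zero hv)).trans ?_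
    simp only [covD_fderiv_rep hC hCs hv]
    rw [mul_assoc]
    refine mul_le_mul_of_nonneg_left (((hb' _ (hv.extD hC.isClosed)).1).trans ?_) hc
    exact mul_le_mul_of_nonneg_left (le_add_of_nonneg_right (l2_self_nonneg g v)) hb
  | succ q =>
    obtain ⟨c, hc, hc'⟩ := (chartMetric g x₀).garding_succ q hK hKO
    obtain ⟨b₁, hb₁, hb₁'⟩ := exists_norm_rep_bounds g hC hCs (q + 1)
    obtain ⟨b₀, hb₀, hb₀'⟩ := exists_norm_rep_bounds g hC hCs q
    obtain ⟨D, hD⟩ := hK.exists_bound_of_continuousOn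
      ((chartMetric g x₀).continuousOn_codiffZero.mono hKO : ContinuousOn
        ((chartMetric g x₀).codiffZero q) _)
    refine ⟨c * (b + 2 * b₀ + (2 * D ^ 2 + 1) * b₁), by positivity, fun v hv => ?_⟩
    refine (hc' _ (Form.contDiff_rep hC hCs hv) (Form.rep_eq_zero hv)).trans ?_
    simp only [covD_fderiv_rep hC hCs hv]
    rw [mul_assoc]
    refine mul_le_mul_of_nonneg_left ?_ hc
    have hδ := (codifferential_of_suppIn g hC hCs hv).1
    have h1 := (hb' _ (hv.extD hC.isClosed)).1
    have h2 := (hb₀' _ hδ).1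
    have h3 := (hb₁' _ hv).1
    have hw := Form.contDiff_rep hC hCs hv
    have h0 := Form.rep_eq_zero hv (x₀ := x₀)
    have hwδ := Form.contDiff_rep hC hCs hδ
    have h0δ := Form.rep_eq_zero hδ (x₀ := x₀)
    have hd0 := fderiv_eq_zero_of_zero hK h0
    have hi1 : Integrable fun z => ‖Form.rep x₀ v z‖ ^ 2 :=
      integrable_of_continuousOn (hw.continuous.norm.pow 2).continuousOn hK hKO
        fun z hz => by simp [h0 z hz]
    have hi2 : Integrable fun z => ‖Form.rep x₀ (codifferential g q v) z‖ ^ 2 :=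
      integrable_of_continuousOn (hwδ.continuous.norm.pow 2).continuousOn hK hKO
        fun z hz => by simp [h0δ z hz]
    have hi3 : Integrable fun z =>
        ‖covDiv q ((chartMetric g x₀).B z) (fderiv ℝ (Form.rep x₀ v) z)‖ ^ 2 :=
      integrable_of_continuousOn (((((chartMetric g x₀).continuousOn_covDiv (q := q)).clm_apply
        (hw.continuous_fderiv (by simp)).continuousOn).norm).pow 2) hK hKO
        fun z hz => by simp [hd0 z hz]
    have h4 : (∫ z, ‖covDiv q ((chartMetric g x₀).B z) (fderiv ℝ (Form.rep x₀ v) z)‖ ^ 2) ≤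
        2 * D ^ 2 * (∫ z, ‖Form.rep x₀ v z‖ ^ 2) +
          2 * ∫ z, ‖Form.rep x₀ (codifferential g q v) z‖ ^ 2 := by
      rw [← integral_const_mul, ← integral_const_mul,
        ← integral_add (hi1.const_mul _) (hi2.const_mul _)]
      refine integral_mono hi3 ((hi1.const_mul _).add (hi2.const_mul _)) fun z => ?_
      by_cases hz : z ∈ extChartAt (𝓡 n) x₀ '' C
      · simp only [covDiv_fderiv_rep g hC hCs hv (hKO hz)]
        have e1 : ‖(chartMetric g x₀).codiffZero q z (Form.rep x₀ v z)‖ ≤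
            D * ‖Form.rep x₀ v z‖ := (ContinuousLinearMap.le_opNorm _ _).trans (by
          gcongr; exact hD z hz)
        have e2 := norm_sub_le ((chartMetric g x₀).codiffZero q z (Form.rep x₀ v z))
          (Form.rep x₀ (codifferential g q v) z)
        have e3 := e2.trans (add_le_add_left e1 _)
        calc _ ≤ (D * ‖Form.rep x₀ v z‖ + ‖Form.rep x₀ (codifferential g q v) z‖) ^ 2 :=
              pow_le_pow_left₀ (norm_nonneg _) e3 2
          _ ≤ _ := by
              have := sq_nonneg (D * ‖Form.rep x₀ v z‖ - ‖Form.rep x₀ (codifferential g q v) z‖)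
              nlinarith
      · simp [h0 z hz, h0δ z hz, hd0 z hz]
    have p1 := l2_self_nonneg g (extD n M (q + 1) v)
    have p2 := l2_self_nonneg g (codifferential g q v)
    have p3 := l2_self_nonneg g v
    have h5 : 2 * D ^ 2 * (∫ z, ‖Form.rep x₀ v z‖ ^ 2) ≤ 2 * D ^ 2 * (b₁ * l2 g v v) :=
      mul_le_mul_of_nonneg_left h3 (by positivity)
    simp only [energy]
    set X := l2 g (extD n M (q + 1) v) (extD n M (q + 1) v)
    set Y := l2 g (codifferential g q v) (codifferential g q v)
    set Z := l2 g v v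
    have q1 : 0 ≤ b * (Y + Z) := by positivity
    have q2 : 0 ≤ b₀ * (X + Z) := by positivity
    have q3 : 0 ≤ (2 * D ^ 2 + 1) * b₁ * (X + Y) := by positivity
    nlinarith

theorem exists_energy_mul_le (g : Metric n M) (f : C^∞⟮𝓡 n, M; ℝ⟯) (t : ℝ) (h : C^∞⟮𝓡 n, M; ℝ⟯)
    (q : ℕ) : ∃ C, 0 ≤ C ∧ ∀ u : Form n M q,
      energy g (extD n M) (codifferential g) q (Form.mul h q u) ≤
        C * (energy g (dt f t) (dtStar g f t) q u + l2 g u u) := by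
  obtain ⟨c, hc, hc'⟩ := exists_l2_le_of_l2Bounded g h (l2Bounded_extDComm (q := q) g h)
    (l2Bounded_dt_sub g f t q)
  cases q with
  | zero => exact ⟨c, hc, hc'⟩
  | succ q =>
    obtain ⟨b, hb, hb'⟩ := exists_l2_le_of_l2Bounded g h (l2Bounded_codifferential_comm g h q)
      (l2Bounded_dtStar_sub g f t q)
    refine ⟨c + b, by positivity, fun u => ?_⟩
    have h1 := hc' u
    have h2 := hb' u
    simp only [energy]
    have p1 := mul_nonneg hb (l2_self_nonneg g (dt f t (q + 1) u))
    have p2 := mul_nonneg hc (l2_self_nonneg g (dtStar g f t q u))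
    linarith

/-- Poincaré's inequality followed by Gårding's for the cutoff form; the constants of the latter do
not depend on the grid, so it can be refined afterwards. -/
theorem exists_cofg_mul (g : Metric n M) (f : C^∞⟮𝓡 n, M; ℝ⟯) (t : ℝ) {x₀ : M}
    {χ : C^∞⟮𝓡 n, M; ℝ⟯} (hχ : tsupport χ ⊆ (extChartAt (𝓡 n) x₀).source) (q : ℕ) {ε : ℝ}
    (hε : 0 < ε) : ∃ N : Submodule ℝ (Form n M q), N.CoFG ∧ ∀ u ∈ N,
      l2 g (Form.mul χ q u) (Form.mul χ q u) ≤
        ε * (energy g (dt f t) (dtStar g f t) q u + l2 g u u) := by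
  have hC := (isClosed_tsupport χ).isCompact
  obtain ⟨a, ha, ha'⟩ := exists_norm_rep_bounds g hC hχ q
  obtain ⟨b, hb, hb'⟩ := exists_garding_chart g hC hχ q
  obtain ⟨c, hc, hc'⟩ := exists_energy_mul_le g f t χ q
  obtain ⟨d, hd, hd'⟩ := l2Bounded_mul (q := q) g χ
  -- The denominator absorbs all constants of the chain of estimates; the summand `1` keeps it
  -- positive.
  obtain ⟨N, hN, hN'⟩ := exists_cofg_poincare hχ q
    (ε := ε / (a * b * (c + d) + 1)) (by positivity)
  refine ⟨N, hN, fun u hu => ?_⟩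
  have hs := Form.SuppIn.mul (α := u) χ
  have h1 := (ha' _ hs).2
  have h2 := hN' u hu
  have h3 := hb' _ hs
  have h4 := hc' u
  have h5 := hd' u
  have h6 := energy_nonneg g (dt f t) (dtStar g f t) q u
  have h7 := l2_self_nonneg g u
  set E := energy g (dt f t) (dtStar g f t) q u + l2 g u u with hE
  have hE0 : 0 ≤ E := add_nonneg h6 h7
  have h8 : energy g (extD n M) (codifferential g) q (Form.mul χ q u) +
      l2 g (Form.mul χ q u) (Form.mul χ q u) ≤ (c + d) * E := by
    have : d * l2 g u u ≤ d * E := mul_le_mul_of_nonneg_left (by linarith) hd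
    linarith
  calc _ ≤ a * ∫ z, ‖Form.rep x₀ (Form.mul χ q u) z‖ ^ 2 := h1
    _ ≤ a * (ε / (a * b * (c + d) + 1) * (b * ((c + d) * E))) := by
        refine mul_le_mul_of_nonneg_left (h2.trans ?_) ha
        exact mul_le_mul_of_nonneg_left (h3.trans (mul_le_mul_of_nonneg_left h8 hb)) (by positivity)
    _ = ε * E * (a * b * (c + d) / (a * b * (c + d) + 1)) := by ring
    _ ≤ ε * E * 1 := by
        refine mul_le_mul_of_nonneg_left ?_ (by positivity)
        exact div_le_one_of_le₀ (by linarith) (by positivity)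
    _ = _ := mul_one _

/-- The substitute for Rellich's theorem: intersect the finitely many subspaces belonging to the
pieces of a partition of unity. -/
theorem exists_cofg_l2_le (g : Metric n M) (f : C^∞⟮𝓡 n, M; ℝ⟯) (t : ℝ) (q : ℕ) {ε : ℝ}
    (hε : 0 < ε) : ∃ N : Submodule ℝ (Form n M q), N.CoFG ∧ ∀ u ∈ N,
      l2 g u u ≤ ε * (energy g (dt f t) (dtStar g f t) q u + l2 g u u) := by
  obtain ⟨s, χ, hχ, hsum⟩ := exists_partition n M
  -- One factor `s.card` comes from the square of a sum and the other from adding the equal bounds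
  -- of the pieces.
  choose N hN hN' using fun i : s => exists_cofg_mul g f t (hχ i) q
    (ε := ε / ((s.card : ℝ) ^ 2 + 1)) (by positivity)
  refine ⟨⨅ i, N i, ?_, fun u hu => ?_⟩
  · exact Submodule.CoFG.sInf_of_finite (Set.finite_range N) (by rintro _ ⟨i, rfl⟩; exact hN i)
  · have h1 := l2_sum_self_le g Finset.univ fun i => Form.mul (χ i) q u
    rw [Form.sum_mul hsum] at h1
    have hE : 0 ≤ energy g (dt f t) (dtStar g f t) q u + l2 g u u :=
      add_nonneg (energy_nonneg g _ _ q u) (l2_self_nonneg g u)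
    set E := energy g (dt f t) (dtStar g f t) q u + l2 g u u
    calc l2 g u u ≤ s.card * ∑ _i : s, ε / ((s.card : ℝ) ^ 2 + 1) * E := by
          refine h1.trans ?_
          rw [Finset.card_univ, Fintype.card_coe]
          refine mul_le_mul_of_nonneg_left (Finset.sum_le_sum fun i _ => ?_) (by positivity)
          exact hN' i u (Submodule.mem_iInf N |>.1 hu i)
      _ = ε * E * ((s.card : ℝ) ^ 2 / ((s.card : ℝ) ^ 2 + 1)) := by
          rw [Finset.sum_const, Finset.card_univ, Fintype.card_coe, nsmul_eq_mul]
          ring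
      _ ≤ ε * E * 1 := by
          refine mul_le_mul_of_nonneg_left ?_ (by positivity)
          exact div_le_one_of_le₀ (by linarith) (by positivity)
      _ = _ := mul_one _

end Garding

/-! ### Hodge theory on the sums of eigenspaces. -/

section Hodge

variable {n q p : ℕ} {M : Type*} [TopologicalSpace M] [ChartedSpace (Model n) M]
  [IsManifold (𝓡 n) ∞ M]

theorem Form.eq_zero_of_lt (h : n < q) (u : Form n M q) : u = 0 := by
  refine Form.ext_chart fun x₀ z _ => ?_
  rw [map_zero, Pi.zero_apply]
  ext v
  refine AlternatingMap.map_linearDependent (Form.chart x₀ u z).toAlternatingMap v fun hv => ?_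
  have := hv.fintype_card_le_finrank
  simp only [Fintype.card_fin, finrank_euclideanSpace] at this
  omega

variable [MeasurableSpace M]

theorem mem_eigenSum {g : Metric n M} {f : C^∞⟮𝓡 n, M; ℝ⟯} {t : ℝ} {I : Set ℝ} {μ : ℝ} (hμ : μ ∈ I)
    {u : Form n M q} (hu : u ∈ Module.End.eigenspace (laplacian g f t q) μ) :
    u ∈ eigenSum g f t I q := by
  -- The supremum runs over genuine eigenvalues only, so a zero vector must be treated apart. It
  -- occurs when an intertwining map kills an eigenvector.
  by_cases h0 : u = 0
  · rw [h0]; exact zero_mem _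
  · exact Submodule.mem_iSup_of_mem μ (Submodule.mem_iSup_of_mem
      ⟨Module.End.hasEigenvalue_of_hasEigenvector ⟨hu, h0⟩, hμ⟩ hu)

theorem eigenSum_le {g : Metric n M} {f : C^∞⟮𝓡 n, M; ℝ⟯} {t : ℝ} {I : Set ℝ}
    {N : Submodule ℝ (Form n M q)}
    (h : ∀ μ ∈ I, ∀ u, laplacian g f t q u = μ • u → u ∈ N) : eigenSum g f t I q ≤ N :=
  iSup₂_le fun μ hμ u hu => h μ hμ.2 u (Module.End.mem_eigenspace_iff.1 hu)

theorem laplacian_dt (g : Metric n M) (f : C^∞⟮𝓡 n, M; ℝ⟯) (t : ℝ) (u : Form n M q) :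
    laplacian g f t (q + 1) (dt f t q u) = dt f t q (laplacian g f t q u) := by
  cases q <;> simp [laplacian, dt_dt]

theorem map_mem_eigenSum {g : Metric n M} {f : C^∞⟮𝓡 n, M; ℝ⟯} {t : ℝ} (I : Set ℝ)
    {A : Form n M q →ₗ[ℝ] Form n M p} (hA : ∀ u, laplacian g f t p (A u) = A (laplacian g f t q u))
    {u : Form n M q} (hu : u ∈ eigenSum g f t I q) : A u ∈ eigenSum g f t I p := by
  have h : eigenSum g f t I q ≤ (eigenSum g f t I p).comap A := eigenSum_le fun μ hμ u hu =>
    mem_eigenSum hμ (Module.End.mem_eigenspace_iff.2 (by rw [hA, hu, map_smul]))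
  exact h hu

/-- An eigenvector is the image of its multiple by `μ⁻¹`; here the exclusion of the eigenvalue zero
is essential. -/
theorem exists_laplacian_eq {g : Metric n M} {f : C^∞⟮𝓡 n, M; ℝ⟯} {t lam : ℝ} {u : Form n M q}
    (hu : u ∈ eigenSum g f t (Set.Ioc 0 lam) q) :
    ∃ w ∈ eigenSum g f t (Set.Ioc 0 lam) q, laplacian g f t q w = u := by
  have h : eigenSum g f t (Set.Ioc 0 lam) q ≤
      (eigenSum g f t (Set.Ioc 0 lam) q).map (laplacian g f t q) := eigenSum_le fun μ hμ u hu =>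
    ⟨μ⁻¹ • u, Submodule.smul_mem _ _ (mem_eigenSum hμ (Module.End.mem_eigenspace_iff.2 hu)), by
      rw [map_smul, hu, smul_smul, inv_mul_cancel₀ hμ.1.ne', one_smul]⟩
  exact h hu

variable [BorelSpace M] [CompactSpace M] [T2Space M] (g : Metric n M) (f : C^∞⟮𝓡 n, M; ℝ⟯) (t : ℝ)

theorem dtStar_dtStar (v : Form n M (q + 2)) : dtStar g f t q (dtStar g f t (q + 1) v) = 0 :=
  eq_of_l2_eq g fun u => by
    rw [← l2_dt, ← l2_dt, dt_dt, map_zero, map_zero, LinearMap.zero_apply]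

theorem l2_dtStar (v : Form n M (q + 1)) (u : Form n M q) :
    l2 g (dtStar g f t q v) u = l2 g v (dt f t q u) := by
  rw [l2_comm, ← l2_dt, l2_comm]

theorem laplacian_dtStar (u : Form n M (q + 1)) :
    laplacian g f t q (dtStar g f t q u) = dtStar g f t q (laplacian g f t (q + 1) u) := by
  cases q <;> simp [laplacian, dtStar_dtStar]

theorem l2_laplacian_self (u : Form n M q) :
    l2 g (laplacian g f t q u) u = energy g (dt f t) (dtStar g f t) q u := by
  cases q with
  | zero =>
    change l2 g (dtStar g f t 0 (dt f t 0 u)) u = l2 g (dt f t 0 u) (dt f t 0 u)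
    rw [l2_dtStar]
  | succ q =>
    change l2 g (dt f t q (dtStar g f t q u) + dtStar g f t (q + 1) (dt f t (q + 1) u)) u =
      l2 g (dt f t (q + 1) u) (dt f t (q + 1) u) + l2 g (dtStar g f t q u) (dtStar g f t q u)
    rw [map_add, LinearMap.add_apply, l2_dt, l2_dtStar g f t (dt f t (q + 1) u) u, add_comm]

theorem l2_laplacian (u v : Form n M q) :
    l2 g (laplacian g f t q u) v = l2 g u (laplacian g f t q v) := by
  cases q with
  | zero =>
    change l2 g (dtStar g f t 0 (dt f t 0 u)) v = l2 g u (dtStar g f t 0 (dt f t 0 v))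
    rw [l2_dtStar, l2_dt]
  | succ q =>
    change l2 g (dt f t q (dtStar g f t q u) + dtStar g f t (q + 1) (dt f t (q + 1) u)) v =
      l2 g u (dt f t q (dtStar g f t q v) + dtStar g f t (q + 1) (dt f t (q + 1) v))
    rw [map_add, LinearMap.add_apply, map_add, l2_dt, ← l2_dtStar g f t u,
      l2_dtStar g f t (dt f t (q + 1) u), l2_dt]

variable {lam : ℝ}

/-- The kernel of a symmetric operator is orthogonal to its image, and `u` lies in both. -/
theorem eq_zero_of_laplacian_eq_zero {u : Form n M q}
    (hu : u ∈ eigenSum g f t (Set.Ioc 0 lam) q) (h : laplacian g f t q u = 0) : u = 0 := by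
  obtain ⟨w, -, rfl⟩ := exists_laplacian_eq hu
  refine eq_zero_of_l2_self g ?_
  rw [l2_laplacian, h, map_zero]

/-- A preimage `w` of `u` satisfies `Δ (d_t w) = d_t u = 0`, and the Laplacian is injective on the
sum of eigenspaces containing `d_t w`. -/
theorem exists_laplacian_eq_of_dt_eq_zero {u : Form n M q}
    (hu : u ∈ eigenSum g f t (Set.Ioc 0 lam) q) (h : dt f t q u = 0) :
    ∃ w ∈ eigenSum g f t (Set.Ioc 0 lam) q, laplacian g f t q w = u ∧ dt f t q w = 0 := by
  obtain ⟨w, hw, hwu⟩ := exists_laplacian_eq hu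
  refine ⟨w, hw, hwu, ?_⟩
  refine eq_zero_of_laplacian_eq_zero g f t (map_mem_eigenSum _ (laplacian_dt g f t) hw) ?_
  rw [laplacian_dt, hwu, h]

theorem eq_zero_of_dt_zero_eq_zero {u : Form n M 0} (hu : u ∈ eigenSum g f t (Set.Ioc 0 lam) 0)
    (h : dt f t 0 u = 0) : u = 0 := by
  obtain ⟨w, -, rfl, hw⟩ := exists_laplacian_eq_of_dt_eq_zero g f t hu h
  change dtStar g f t 0 (dt f t 0 w) = 0
  rw [hw, map_zero]

/-- With `u = Δ w` and `d_t w = 0` only `d_t (d_t^* w)` is left of the Laplacian, so `d_t^* w` is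
the primitive. -/
theorem exists_dt_eq_of_dt_eq_zero {u : Form n M (q + 1)}
    (hu : u ∈ eigenSum g f t (Set.Ioc 0 lam) (q + 1)) (h : dt f t (q + 1) u = 0) :
    ∃ w ∈ eigenSum g f t (Set.Ioc 0 lam) q, dt f t q w = u := by
  obtain ⟨w, hw, rfl, hdw⟩ := exists_laplacian_eq_of_dt_eq_zero g f t hu h
  refine ⟨dtStar g f t q w, map_mem_eigenSum _ (laplacian_dtStar g f t) hw, ?_⟩
  change _ = dt f t q (dtStar g f t q w) + dtStar g f t (q + 1) (dt f t (q + 1) w)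
  rw [hdw, map_zero, add_zero]

/-- Eigenvectors for different eigenvalues are orthogonal, so energy and norm are sums over the
components, with ratio `μ ≤ λ` in each. -/
theorem energy_le_of_mem_eigenSum {u : Form n M q} (hu : u ∈ eigenSum g f t (Set.Ioc 0 lam) q) :
    energy g (dt f t) (dtStar g f t) q u ≤ lam * l2 g u u := by
  rw [eigenSum, iSup_subtype', Submodule.mem_iSup_iff_exists_finsupp] at hu
  obtain ⟨e, he, rfl⟩ := hu
  have he' : ∀ μ, laplacian g f t q (e μ) = μ.1 • e μ := fun μ =>
    Module.End.mem_eigenspace_iff.1 (he μ)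
  have horth : ∀ μ ν, μ ≠ ν → l2 g (e μ) (e ν) = 0 := fun μ ν hne => by
    have h := l2_laplacian g f t (e μ) (e ν)
    rw [he', he', map_smul, map_smul, LinearMap.smul_apply, smul_eq_mul, smul_eq_mul] at h
    have h2 : (μ.1 - ν.1) * l2 g (e μ) (e ν) = 0 := by linarith
    exact (mul_eq_zero.1 h2).resolve_left (sub_ne_zero.2 fun h => hne (Subtype.ext h))
  have hsum : ∀ c : {μ // μ ∈ {μ : ℝ | Module.End.HasEigenvalue (laplacian g f t q) μ} ∩
      Set.Ioc 0 lam} → ℝ, l2 g (∑ μ ∈ e.support, c μ • e μ) (∑ μ ∈ e.support, e μ) =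
        ∑ μ ∈ e.support, c μ * l2 g (e μ) (e μ) := fun c => by
    simp only [map_sum, LinearMap.sum_apply, map_smul, LinearMap.smul_apply, smul_eq_mul]
    rw [Finset.sum_comm]
    refine Finset.sum_congr rfl fun μ hμ => ?_
    refine Finset.sum_eq_single_of_mem μ hμ fun ν _ hne => ?_
    rw [horth μ ν hne.symm, mul_zero]
  have h1 := hsum fun μ => μ.1
  have h2 := hsum fun _ => 1
  simp only [one_smul, one_mul] at h2
  have h3 : laplacian g f t q (∑ μ ∈ e.support, e μ) = ∑ μ ∈ e.support, μ.1 • e μ := by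
    rw [map_sum]
    exact Finset.sum_congr rfl fun μ _ => he' μ
  rw [← l2_laplacian_self, Finsupp.sum, h3, h1, h2, Finset.mul_sum]
  exact Finset.sum_le_sum fun μ _ => mul_le_mul_of_nonneg_right μ.2.2.2 (l2_self_nonneg g _)

/-- A subspace that meets a subspace of finite codimension only in zero is finite-dimensional. -/
theorem finiteDimensional_eigenSum (hlam : 0 < lam) (q : ℕ) :
    FiniteDimensional ℝ (eigenSum g f t (Set.Ioc 0 lam) q) := by
  -- On `E^q` the energy plus the norm is at most `(λ + 1) ‖u‖²`, so this `ε` gives `‖u‖² ≤ ‖u‖² /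
  -- 2` on the intersection.
  obtain ⟨N, hN, h⟩ := exists_cofg_l2_le g f t q (ε := 1 / (2 * (lam + 1))) (by positivity)
  refine Module.Finite.iff_fg.2 (hN.fg_of_disjoint ?_)
  refine Submodule.disjoint_def.2 fun u hE hu => eq_zero_of_l2_self g ?_
  have h1 := h u hu
  have h2 := energy_le_of_mem_eigenSum g f t hE
  have h3 := l2_self_nonneg g u
  refine le_antisymm ?_ h3
  have h4 : l2 g u u ≤ 1 / (2 * (lam + 1)) * ((lam + 1) * l2 g u u) := h1.trans (by
    refine mul_le_mul_of_nonneg_left ?_ (by positivity)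
    linarith)
  have h5 : 1 / (2 * (lam + 1)) * ((lam + 1) * l2 g u u) = l2 g u u / 2 := by
    field_simp
  linarith

end Hodge

/-! ### Alternating sums of dimensions in an exact sequence. -/

section Dimension

/-- Exactness turns rank–nullity into `dim V_{q+1} = rank d_{q+1} + rank d_q`, so the alternating
sum telescopes. -/
theorem sum_finrank_eq_finrank_range {V : ℕ → Type*} [∀ q, AddCommGroup (V q)]
    [∀ q, Module ℝ (V q)] [∀ q, FiniteDimensional ℝ (V q)] (d : ∀ q, V q →ₗ[ℝ] V (q + 1))
    (h0 : Function.Injective (d 0)) (h : ∀ q, Function.Exact (d q) (d (q + 1))) (q : ℕ) :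
    ∑ j ∈ Finset.range (q + 1), (-1 : ℤ) ^ (q - j) * (Module.finrank ℝ (V j) : ℤ) =
      Module.finrank ℝ (LinearMap.range (d q)) := by
  induction q with
  | zero => simp [LinearMap.finrank_range_of_inj h0]
  | succ q ih =>
    have h1 := (d (q + 1)).finrank_range_add_finrank_ker
    rw [LinearMap.exact_iff.1 (h q)] at h1
    rw [Finset.sum_range_succ]
    have h2 : ∑ j ∈ Finset.range (q + 1), (-1 : ℤ) ^ (q + 1 - j) * (Module.finrank ℝ (V j) : ℤ) =
        -∑ j ∈ Finset.range (q + 1), (-1 : ℤ) ^ (q - j) * (Module.finrank ℝ (V j) : ℤ) := by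
      rw [← Finset.sum_neg_distrib]
      refine Finset.sum_congr rfl fun j hj => ?_
      rw [Nat.succ_sub (Nat.lt_succ_iff.1 (Finset.mem_range.1 hj)), pow_succ]
      ring
    rw [h2, ih]
    simp only [Nat.sub_self, pow_zero, one_mul]
    omega

end Dimension

end Witten

end

/-! ### The theorem. -/

theorem mainTheorem6 {n : ℕ} {M : Type*} [TopologicalSpace M] [T2Space M] [CompactSpace M]
    [ChartedSpace (EuclideanSpace ℝ (Fin n)) M] [IsManifold (𝓡 n) ∞ M]
    [MeasurableSpace M] [BorelSpace M]
    (g : Bundle.ContMDiffRiemannianMetric (𝓡 n) ∞ (EuclideanSpace ℝ (Fin n))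
      (TangentSpace (𝓡 n) : M → Type _))
    (f : C^∞⟮𝓡 n, M; ℝ⟯) (t : ℝ) (ht : 0 ≤ t) :
    -- `d_t` has a formal adjoint, namely `dtStar`
    (∀ q, Witten.IsFormalAdjoint g (Witten.dt f t q) (Witten.dtStar g f t q)) ∧
    ∀ lam : ℝ, 0 < lam →
      -- `d_t` maps `E^q` to `E^{q+1}`, and the sequence `0 → E^0 → E^1 → ⋯ → E^n → 0` is exact
      (∃ hd : ∀ q, ∀ u ∈ Witten.eigenSum g f t (Set.Ioc 0 lam) q,
          Witten.dt f t q u ∈ Witten.eigenSum g f t (Set.Ioc 0 lam) (q + 1),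
        Function.Injective ((Witten.dt f t 0).restrict (hd 0)) ∧
        (∀ q < n, Function.Exact ((Witten.dt f t q).restrict (hd q))
          ((Witten.dt f t (q + 1)).restrict (hd (q + 1)))) ∧
        Witten.eigenSum g f t (Set.Ioc 0 lam) (n + 1) = ⊥) ∧
      -- the spaces are finite-dimensional, with nonnegative alternating sums of dimensions
      (∀ q ≤ n, FiniteDimensional ℝ (Witten.eigenSum g f t (Set.Ioc 0 lam) q)) ∧
      (∀ q ≤ n, 0 ≤ ∑ j ∈ Finset.range (q + 1), (-1 : ℤ) ^ (q - j) *
        (Module.finrank ℝ (Witten.eigenSum g f t (Set.Ioc 0 lam) j) : ℤ)) ∧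
      ∑ j ∈ Finset.range (n + 1), (-1 : ℤ) ^ (n - j) *
        (Module.finrank ℝ (Witten.eigenSum g f t (Set.Ioc 0 lam) j) : ℤ) = 0 := by
  refine ⟨Witten.isFormalAdjoint_dtStar g f t, fun lam hlam => ?_⟩
  have hd : ∀ q, ∀ u ∈ Witten.eigenSum g f t (Set.Ioc 0 lam) q,
      Witten.dt f t q u ∈ Witten.eigenSum g f t (Set.Ioc 0 lam) (q + 1) := fun q u hu =>
    Witten.map_mem_eigenSum _ (Witten.laplacian_dt g f t) hu
  have hfin := Witten.finiteDimensional_eigenSum g f t hlam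
  have hinj : Function.Injective ((Witten.dt f t 0).restrict (hd 0)) := by
    refine (injective_iff_map_eq_zero _).2 fun u hu => Subtype.ext ?_
    exact Witten.eq_zero_of_dt_zero_eq_zero g f t u.2 (congrArg Subtype.val hu)
  have hex : ∀ q, Function.Exact ((Witten.dt f t q).restrict (hd q))
      ((Witten.dt f t (q + 1)).restrict (hd (q + 1))) := fun q u => by
    constructor
    · intro hu
      obtain ⟨w, hw, hwu⟩ := Witten.exists_dt_eq_of_dt_eq_zero g f t u.2 (congrArg Subtype.val hu)
      exact ⟨⟨w, hw⟩, Subtype.ext hwu⟩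
    · rintro ⟨w, rfl⟩
      exact Subtype.ext (Witten.dt_dt f t w.1)
  have hbot : Witten.eigenSum g f t (Set.Ioc 0 lam) (n + 1) = ⊥ :=
    (Submodule.eq_bot_iff _).2 fun u _ => Witten.Form.eq_zero_of_lt (Nat.lt_succ_self n) u
  have hsum := Witten.sum_finrank_eq_finrank_range
    (fun q => (Witten.dt f t q).restrict (hd q)) hinj hex
  refine ⟨⟨hd, hinj, fun q _ => hex q, hbot⟩, fun q _ => hfin q, fun q _ => ?_, ?_⟩
  · rw [hsum]
    exact Int.natCast_nonneg _
  -- For `q = n` the alternating sum is the rank of a map into forms of degree `n + 1`, all of which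
  -- vanish.
  · rw [hsum, Nat.cast_eq_zero, Submodule.finrank_eq_zero, Submodule.eq_bot_iff]
    rintro _ ⟨u, rfl⟩
    exact Subtype.ext (Witten.Form.eq_zero_of_lt (Nat.lt_succ_self n) _)
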